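/- Let $n\ge 2$, let $\Omega\subset\mathbb R^n$ be a bounded domain (nonempty, open, connected) with $C^\infty$ boundary, let $\nu$ be the outward unit normal and $\sigma$ the surface measure on $\partial\Omega$, and let $h\in C^1(\partial\Omega)$ be strictly positive. For $v,w\in H^1(\Omega)$ put $$\mathcal B[v,w]=\int_\Omega\nabla v\cdot\nabla w\,dx+\int_{\partial\Omega}\frac{vw}{h}\,d\sigma,\qquad \|v\|_{\mathcal B}=\mathcal B[v,v]^{1/2},$$ where boundary values are taken in the sense of traces, and, for $v\not\equiv 0$, $$R(v)=\frac{\int_\Omega|\nabla v|^2\,dx+\int_{\partial\Omega}\frac{v^2}{h}\,d\sigma}{\int_\Omega v^2\,dx}.$$ Let $u_0\in C^1(\Omega)\cap L^\infty(\Omega)\cap H^1(\Omega)$ be strictly positive on $\overline\Omega$ and, for each integer $k\ge 0$, let $u_{k+1}\in C^2(\Omega)\cap C^1(\overline\Omega)$ be the classical solution of $$-\Delta u_{k+1}=R(u_k)\,u_k\ \text{ in }\Omega,\qquad u_{k+1}+h\,\partial_\nu u_{k+1}=0\ \text{ on }\partial\Omega .$$ Then, for all $k\ge 0$, $$R(u_{k+1})\|u_{k+1}\|_{L^2(\Omega)}\le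 R(u_k)\|u_k\|_{L^2(\Omega)},\qquad \|u_{k+1}\|_{\mathcal B}\ge\|u_k\|_{\mathcal B},$$ $$\|u_{k+1}\|_{L^2(\Omega)}\ge\|u_k\|_{L^2(\Omega)},\qquad R(u_{k+1})\le R(u_k).$$ Moreover the sequence $\{u_k\}_{k\ge 0}$ lies in $H^1(\Omega)$ and is uniformly bounded there: there is a constant $C$ with $\|u_k\|_{H^1(\Omega)}\le C$ for all $k\ge 0$. -/

import Mathlib

open MeasureTheory Set Filter Topology
open scoped Gradient Laplacian ContDiff ENNReal RealInnerProductSpace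

noncomputable section

namespace RobinIteration

variable {n : ℕ}

/-! ### Domains, outward normal, surface measure -/

/-- `Ω` has a `C^∞` boundary: near each boundary point, after choosing a vertical unit direction `e`,
`Ω` is exactly the region above the graph of a smooth function `γ` of the horizontal variable
`x - ⟪e, x⟫ e`. -/
def HasSmoothBoundary (Ω : Set (EuclideanSpace ℝ (Fin n))) : Prop :=
  ∀ x₀ ∈ frontier Ω, ∃ r > 0, ∃ e : EuclideanSpace ℝ (Fin n), ‖e‖ = 1 ∧
    ∃ γ : EuclideanSpace ℝ (Fin n) → ℝ, ContDiff ℝ ∞ γ ∧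
      ∀ x ∈ Metric.ball x₀ r, x ∈ Ω ↔ γ (x - ⟪e, x⟫ • e) < ⟪e, x⟫

/-- A smooth bounded domain: nonempty, open, connected, bounded, with `C^∞` boundary. -/
structure IsSmoothBoundedDomain (Ω : Set (EuclideanSpace ℝ (Fin n))) : Prop where
  isOpen : IsOpen Ω
  isConnected : IsConnected Ω
  isBounded : Bornology.IsBounded Ω
  smoothBoundary : HasSmoothBoundary Ω

/-- `ν` is the outward unit normal of `Ω` at the boundary point `x`: directions on the negative side
of `ν` enter `Ω`, directions on the positive side leave it. (There is at most one such `ν`.) -/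
def IsOutwardUnitNormal (Ω : Set (EuclideanSpace ℝ (Fin n))) (x ν : EuclideanSpace ℝ (Fin n)) :
    Prop :=
  ‖ν‖ = 1 ∧
    (∀ w, ⟪w, ν⟫ < 0 → ∀ᶠ t : ℝ in 𝓝[>] 0, x + t • w ∈ Ω) ∧
    (∀ w, 0 < ⟪w, ν⟫ → ∀ᶠ t : ℝ in 𝓝[>] 0, x + t • w ∉ Ω)

/-- The outward unit normal field `ν` on `∂Ω`. -/
def outwardNormal (Ω : Set (EuclideanSpace ℝ (Fin n))) (x : EuclideanSpace ℝ (Fin n)) :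
    EuclideanSpace ℝ (Fin n) :=
  Classical.epsilon (IsOutwardUnitNormal Ω x)

/-- The surface measure `σ` on `∂Ω`: the `(n-1)`-dimensional Hausdorff measure (normalised so as to
agree with Lebesgue measure on `(n-1)`-dimensional subspaces) restricted to `∂Ω`. -/
def surfaceMeasure (Ω : Set (EuclideanSpace ℝ (Fin n))) :
    Measure (EuclideanSpace ℝ (Fin n)) :=
  (Measure.euclideanHausdorffMeasure (n - 1)).restrict (frontier Ω)

/-- `h ∈ C^1(∂Ω)`: `h` agrees on `∂Ω` with a `C^1` function on the ambient space. -/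
def IsC1OnBoundary (Ω : Set (EuclideanSpace ℝ (Fin n))) (h : EuclideanSpace ℝ (Fin n) → ℝ) :
    Prop :=
  ∃ H : EuclideanSpace ℝ (Fin n) → ℝ, ContDiff ℝ 1 H ∧ EqOn h H (frontier Ω)

/-! ### Classical function spaces -/

/-- The extension by continuity to `closure Ω` of the classical gradient of `u` on `Ω`. -/
def gradBar (Ω : Set (EuclideanSpace ℝ (Fin n))) (u : EuclideanSpace ℝ (Fin n) → ℝ) :
    EuclideanSpace ℝ (Fin n) → EuclideanSpace ℝ (Fin n) :=
  extendFrom Ω (∇ u)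

/-- `u ∈ C^1(closure Ω)`: `u` is `C^1` in `Ω`, continuous on `closure Ω`, and its gradient extends
continuously to `closure Ω`. -/
structure IsC1Closure (Ω : Set (EuclideanSpace ℝ (Fin n))) (u : EuclideanSpace ℝ (Fin n) → ℝ) :
    Prop where
  contDiffOn : ContDiffOn ℝ 1 u Ω
  continuousOn : ContinuousOn u (closure Ω)
  continuousOn_grad : ContinuousOn (gradBar Ω u) (closure Ω)

/-- The outward normal derivative `∂_ν u = ∇u · ν` at a boundary point. -/
def normalDeriv (Ω : Set (EuclideanSpace ℝ (Fin n))) (u : EuclideanSpace ℝ (Fin n) → ℝ)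
    (x : EuclideanSpace ℝ (Fin n)) : ℝ :=
  ⟪gradBar Ω u x, outwardNormal Ω x⟫

/-- `v ∈ C^2(Ω) ∩ C^1(closure Ω)` is a classical solution of
`-Δ v = f` in `Ω`, `v + h ∂_ν v = 0` on `∂Ω`. -/
structure IsClassicalRobinSolution (Ω : Set (EuclideanSpace ℝ (Fin n)))
    (h f v : EuclideanSpace ℝ (Fin n) → ℝ) : Prop where
  contDiffOn : ContDiffOn ℝ 2 v Ω
  isC1Closure : IsC1Closure Ω v
  equation : ∀ x ∈ Ω, -(Δ v) x = f x
  boundary : ∀ x ∈ frontier Ω, v x + h x * normalDeriv Ω v x = 0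

/-! ### The Sobolev space `H^1(Ω)` and its trace operator -/

/-- `G` is a weak gradient of `v` in `Ω` (for `v`, `G` locally integrable in `Ω`). -/
def HasWeakGrad (Ω : Set (EuclideanSpace ℝ (Fin n))) (v : EuclideanSpace ℝ (Fin n) → ℝ)
    (G : EuclideanSpace ℝ (Fin n) → EuclideanSpace ℝ (Fin n)) : Prop :=
  ∀ φ : EuclideanSpace ℝ (Fin n) → ℝ, ContDiff ℝ ∞ φ → HasCompactSupport φ → tsupport φ ⊆ Ω →
    ∫ x in Ω, v x • ∇ φ x = -∫ x in Ω, φ x • G x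

/-- `G` is a square integrable weak gradient of `v` in `Ω`. -/
def IsL2WeakGrad (Ω : Set (EuclideanSpace ℝ (Fin n))) (v : EuclideanSpace ℝ (Fin n) → ℝ)
    (G : EuclideanSpace ℝ (Fin n) → EuclideanSpace ℝ (Fin n)) : Prop :=
  MemLp G 2 (volume.restrict Ω) ∧ HasWeakGrad Ω v G

/-- `v ∈ H^1(Ω)`. -/
def MemH1 (Ω : Set (EuclideanSpace ℝ (Fin n))) (v : EuclideanSpace ℝ (Fin n) → ℝ) : Prop :=
  MemLp v 2 (volume.restrict Ω) ∧ ∃ G, IsL2WeakGrad Ω v G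

open Classical in
/-- The weak gradient of `v ∈ H^1(Ω)` (well defined almost everywhere in `Ω`). -/
def weakGrad (Ω : Set (EuclideanSpace ℝ (Fin n))) (v : EuclideanSpace ℝ (Fin n) → ℝ) :
    EuclideanSpace ℝ (Fin n) → EuclideanSpace ℝ (Fin n) :=
  if hv : ∃ G, IsL2WeakGrad Ω v G then hv.choose else 0

/-- `g ∈ L^2(∂Ω)` is the trace of `v ∈ H^1(Ω)`: functions in `C^1(closure Ω)` converge to `v` in
`H^1(Ω)` while their boundary values converge to `g` in `L^2(∂Ω)`. -/
def IsTrace (Ω : Set (EuclideanSpace ℝ (Fin n))) (v g : EuclideanSpace ℝ (Fin n) → ℝ) : Prop :=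
  MemLp g 2 (surfaceMeasure Ω) ∧
    ∃ φ : ℕ → EuclideanSpace ℝ (Fin n) → ℝ, (∀ j, IsC1Closure Ω (φ j)) ∧
      Tendsto (fun j => eLpNorm (fun x => φ j x - v x) 2 (volume.restrict Ω)) atTop (𝓝 0) ∧
      Tendsto (fun j => eLpNorm (fun x => ∇ (φ j) x - weakGrad Ω v x) 2 (volume.restrict Ω))
        atTop (𝓝 0) ∧
      Tendsto (fun j => eLpNorm (fun x => φ j x - g x) 2 (surfaceMeasure Ω)) atTop (𝓝 0)

open Classical in
/-- The trace operator on `H^1(Ω)` (well defined `σ`-almost everywhere on `∂Ω`). -/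
def trace (Ω : Set (EuclideanSpace ℝ (Fin n))) (v : EuclideanSpace ℝ (Fin n) → ℝ) :
    EuclideanSpace ℝ (Fin n) → ℝ :=
  if hv : ∃ g, IsTrace Ω v g then hv.choose else 0

/-! ### Norms, the bilinear form and the Rayleigh quotient -/

/-- `‖v‖₂`, the `L^2(Ω)` norm. -/
def normL2 (Ω : Set (EuclideanSpace ℝ (Fin n))) (v : EuclideanSpace ℝ (Fin n) → ℝ) : ℝ :=
  √(∫ x in Ω, v x ^ 2)

/-- The `H^1(Ω)` norm. -/
def normH1 (Ω : Set (EuclideanSpace ℝ (Fin n))) (v : EuclideanSpace ℝ (Fin n) → ℝ) : ℝ :=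
  √((∫ x in Ω, v x ^ 2) + ∫ x in Ω, ‖weakGrad Ω v x‖ ^ 2)

/-- `B[v, w] = ∫_Ω ∇v · ∇w dx + ∫_{∂Ω} v w / h dσ`, with boundary values in the sense of traces. -/
def formB (Ω : Set (EuclideanSpace ℝ (Fin n))) (h v w : EuclideanSpace ℝ (Fin n) → ℝ) : ℝ :=
  (∫ x in Ω, ⟪weakGrad Ω v x, weakGrad Ω w x⟫) +
    ∫ x, trace Ω v x * trace Ω w x / h x ∂(surfaceMeasure Ω)

/-- `‖v‖_B`, the norm induced by `B`. -/
def normB (Ω : Set (EuclideanSpace ℝ (Fin n))) (h v : EuclideanSpace ℝ (Fin n) → ℝ) : ℝ :=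
  √(formB Ω h v v)

/-- The Robin Rayleigh quotient
`R(v) = (∫_Ω |∇v|² dx + ∫_{∂Ω} v² / h dσ) / ∫_Ω v² dx`. -/
def rayleigh (Ω : Set (EuclideanSpace ℝ (Fin n))) (h v : EuclideanSpace ℝ (Fin n) → ℝ) : ℝ :=
  ((∫ x in Ω, ‖weakGrad Ω v x‖ ^ 2) + ∫ x, trace Ω v x ^ 2 / h x ∂(surfaceMeasure Ω)) /
    ∫ x in Ω, v x ^ 2

end RobinIteration

end

/-! Write `A k` for the squared L² norm of the iterate, `b k = B[u k, u k]` and `R k = b k / A k`.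
Integration by parts gives the weak form `B[u (k+1), w] = R k * ∫ u k * w`, and everything follows
from two choices of `w`.

Taking `w = u k` gives `B[u (k+1), u k] = b k`, and `2 B[v, w] ≤ B[v, v] + B[w, w]` then yields `b k
≤ b (k+1)`. Taking `w = u (k+1)` and applying Cauchy–Schwarz gives `b (k+1) ≤ R k √(A k) √(A
(k+1))`. Division by `√(A (k+1))` is the decay of `R √A`. Comparison with `R k * A k = b k ≤ b
(k+1)` makes `√A` increase, so `R` must decrease. For the bound, a Poincaré inequality with boundary
term gives `A ≤ C b`, i.e. `R ≥ 1/C`. Hence `√A ≤ C R √A` is bounded by its initial value times `C`,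
and so is `b = (R √A) √A`. This arithmetic is in `iteration_estimates` and `iteration_bounded`.

The analytic work is to justify the weak form when weak gradients and traces are arbitrary choices
and the boundary carries Hausdorff measure. The area formula `map_withDensity_normDet` computes
surface integrals in graph coordinates. Cutting a field off near the graph and passing to the limit
proves the divergence theorem `IsSmoothBoundedDomain.integral_divergence`, which in turn yields the
weak form, the trace inequality and the Poincaré inequality. The initial function is only C¹ inside
the domain, so its trace is obtained from approximation by functions that are C¹ up to the boundary
(`IsSmoothBoundedDomain.isH1Limit`). -/

noncomputable section

namespace RobinIteration

variable {n : ℕ}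

/-! ### Area formula for injective C¹ maps and Hausdorff measure. -/

section AreaFormula

open scoped NNReal
open Module

variable {X Y Z : Type*} [MetricSpace Y] [MeasurableSpace Y] [BorelSpace Y]
  [MetricSpace Z] [MeasurableSpace Z] [BorelSpace Z]

/-- On `s`, the map `f` factors through `g` by a `K`-Lipschitz map of `g '' s`, because points with
equal `g`-value have equal `f`-value. It is used with `f` a C¹ map and `g` its derivative at a
point, and with the roles exchanged. -/
lemma euclideanHausdorffMeasure_image_le_of_dist_le {f : X → Y} {g : X → Z} {s : Set X} {K : ℝ≥0}
    (d : ℕ) (h : ∀ x ∈ s, ∀ y ∈ s, dist (f x) (f y) ≤ K * dist (g x) (g y)) :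
    Measure.euclideanHausdorffMeasure d (f '' s) ≤
      (K : ℝ≥0∞) ^ d * Measure.euclideanHausdorffMeasure d (g '' s) := by
  rcases s.eq_empty_or_nonempty with rfl | ⟨x₀, hx₀⟩
  · simp
  have : Nonempty X := ⟨x₀⟩
  have hg : ∀ z ∈ g '' s, Function.invFunOn g s z ∈ s ∧ g (Function.invFunOn g s z) = z :=
    fun z hz => ⟨Function.invFunOn_mem hz, Function.invFunOn_eq hz⟩
  have hlip : LipschitzOnWith K (fun z => f (Function.invFunOn g s z)) (g '' s) :=
    LipschitzOnWith.of_dist_le_mul fun z hz w hw => by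
      have := h _ (hg z hz).1 _ (hg w hw).1
      rwa [(hg z hz).2, (hg w hw).2] at this
  have himg : f '' s = (fun z => f (Function.invFunOn g s z)) '' (g '' s) := by
    rw [image_image]
    refine image_congr fun x hx => ?_
    have h1 := hg (g x) (mem_image_of_mem g hx)
    have h2 := h x hx _ h1.1
    rw [h1.2, dist_self, mul_zero] at h2
    exact dist_le_zero.1 h2
  rw [himg, Measure.euclideanHausdorffMeasure_def, Measure.euclideanHausdorffMeasure_def,
    Measure.smul_apply, Measure.smul_apply, ENNReal.smul_def, ENNReal.smul_def, smul_eq_mul,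
    smul_eq_mul, mul_left_comm]
  gcongr
  have := hlip.hausdorffMeasure_image_le (d := d) (by positivity)
  simpa using this

variable {U V : Type*} [NormedAddCommGroup U] [InnerProductSpace ℝ U] [FiniteDimensional ℝ U]
  [MeasurableSpace U] [BorelSpace U] [NormedAddCommGroup V] [InnerProductSpace ℝ V]
  [MeasurableSpace V] [BorelSpace V]

omit [FiniteDimensional ℝ U] [MeasurableSpace U] [BorelSpace U] [MeasurableSpace V] [BorelSpace V] in
-- Strict differentiability bounds the linearisation error by a small multiple of `‖x - y‖`. As the
-- derivative does not shrink vectors, this is a small multiple of the linear term itself, so the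
-- comparison is multiplicative.
lemma exists_ball_dist_comparison {f : U → V} (hf : ContDiff ℝ 1 f)
    (hlow : ∀ y v, ‖v‖ ≤ ‖fderiv ℝ f y v‖) {K : ℝ≥0} (hK : 1 < K) (y₀ : U) :
    ∃ r > 0, ∀ x ∈ Metric.ball y₀ r, ∀ y ∈ Metric.ball y₀ r,
      dist (f x) (f y) ≤ K * dist (fderiv ℝ f y₀ x) (fderiv ℝ f y₀ y) ∧
      dist (fderiv ℝ f y₀ x) (fderiv ℝ f y₀ y) ≤ K * dist (f x) (f y) := by
  have hstrict : HasStrictFDerivAt f (fderiv ℝ f y₀) y₀ :=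
    (hf.contDiffAt).hasStrictFDerivAt one_ne_zero
  have hK0 : (0 : ℝ) < K := by exact_mod_cast zero_lt_one.trans hK
  have hK1 : (1 : ℝ) < K := by exact_mod_cast hK
  -- The relative error `c = 1 - 1/K` gives both factors: `1 + c ≤ K` because `K + 1/K ≥ 2`, and `1
  -- / (1 - c) = K`.
  have hc : (0 : ℝ) < 1 - (K : ℝ)⁻¹ := sub_pos.2 (inv_lt_one_of_one_lt₀ hK1)
  have hc1 : 1 + (1 - (K : ℝ)⁻¹) ≤ K := by
    have : (K : ℝ) * (K : ℝ)⁻¹ = 1 := mul_inv_cancel₀ hK0.ne'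
    nlinarith [sq_nonneg ((K : ℝ) - 1), inv_pos.2 hK0]
  have hc2 : (1 : ℝ) ≤ K * (1 - (1 - (K : ℝ)⁻¹)) := by
    have : (K : ℝ) * (K : ℝ)⁻¹ = 1 := mul_inv_cancel₀ hK0.ne'
    nlinarith
  set c : ℝ := 1 - (K : ℝ)⁻¹
  have hev := hstrict.isLittleO.def hc
  obtain ⟨r, hr, hball⟩ := Metric.eventually_nhds_iff_ball.1 hev
  refine ⟨r, hr, fun x hx y hy => ?_⟩
  have h1 := hball (x, y) (by rw [← ball_prod_same]; exact ⟨hx, hy⟩)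
  simp only at h1
  have h2 := hlow y₀ (x - y)
  have h3 : ‖f x - f y - fderiv ℝ f y₀ (x - y)‖ ≤ c * ‖fderiv ℝ f y₀ (x - y)‖ :=
    h1.trans (by gcongr)
  rw [dist_eq_norm, dist_eq_norm, ← map_sub]
  set N := ‖fderiv ℝ f y₀ (x - y)‖
  have hN : 0 ≤ N := norm_nonneg _
  have h4 : ‖f x - f y‖ ≤ N + c * N := by
    have := norm_le_norm_add_norm_sub' (f x - f y) (fderiv ℝ f y₀ (x - y))
    linarith
  have h5 : N ≤ ‖f x - f y‖ + c * N := by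
    have := norm_le_norm_add_norm_sub (f x - f y) (fderiv ℝ f y₀ (x - y))
    linarith
  constructor
  · nlinarith
  · nlinarith

/-- The pullback `ρ` of Hausdorff measure is compared with Lebesgue measure. Near `y₀` the map is
`K`-bi-Lipschitz to its derivative, which scales volume by `D y₀`, so `ρ` lies within factors `K ^
m` of `D y₀ * volume`. Hence `ρ` is locally finite and absolutely continuous, and Besicovitch
differentiation identifies its density. -/
theorem map_withDensity_normDet {f : U → V} (hf : ContDiff ℝ 1 f) (hinj : Function.Injective f)
    (hlow : ∀ y v, ‖v‖ ≤ ‖fderiv ℝ f y v‖) :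
    ((volume : Measure U).withDensity fun y =>
        ENNReal.ofReal (fderiv ℝ f y : U →ₗ[ℝ] V).normDet).map f =
      (Measure.euclideanHausdorffMeasure (finrank ℝ U)).restrict (range f) := by
  set m := finrank ℝ U
  have hemb : MeasurableEmbedding f := hf.continuous.measurableEmbedding hinj
  set ρ : Measure U := (Measure.euclideanHausdorffMeasure m).comap f with hρ
  set D : U → ℝ≥0∞ := fun y => ENNReal.ofReal (fderiv ℝ f y : U →ₗ[ℝ] V).normDet with hD
  have hρ_apply : ∀ s, ρ s = Measure.euclideanHausdorffMeasure m (f '' s) :=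
    fun s => hemb.comap_apply _ _
  have hlin : ∀ y s, Measure.euclideanHausdorffMeasure m (fderiv ℝ f y '' s) = D y * volume s := by
    intro y s
    have := LinearMap.euclideanHausdorffMeasure_image (fderiv ℝ f y : U →ₗ[ℝ] V) s
    rw [InnerProductSpace.euclideanHausdorffMeasure_eq_volume] at this
    exact this
  have hcomp : ∀ (K : ℝ≥0), 1 < K → ∀ y₀, ∃ r > 0, ∀ s ⊆ Metric.ball y₀ r,
      ρ s ≤ (K : ℝ≥0∞) ^ m * (D y₀ * volume s) ∧ D y₀ * volume s ≤ (K : ℝ≥0∞) ^ m * ρ s := by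
    intro K hK y₀
    obtain ⟨r, hr, h⟩ := exists_ball_dist_comparison hf hlow hK y₀
    refine ⟨r, hr, fun s hs => ?_⟩
    rw [hρ_apply, ← hlin]
    exact ⟨euclideanHausdorffMeasure_image_le_of_dist_le m
        fun x hx y hy => (h x (hs hx) y (hs hy)).1,
      euclideanHausdorffMeasure_image_le_of_dist_le m
        fun x hx y hy => (h x (hs hx) y (hs hy)).2⟩
  have hfin : IsLocallyFiniteMeasure ρ := by
    refine ⟨fun y₀ => ?_⟩
    obtain ⟨r, hr, h⟩ := hcomp 2 one_lt_two y₀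
    refine ⟨_, Metric.ball_mem_nhds y₀ hr, (h _ subset_rfl).1.trans_lt ?_⟩
    have : volume (Metric.ball y₀ r) < ⊤ := Metric.isBounded_ball.measure_lt_top
    exact ENNReal.mul_lt_top (ENNReal.pow_lt_top ENNReal.coe_lt_top)
      (ENNReal.mul_lt_top ENNReal.ofReal_lt_top this)
  have hac : ρ ≪ volume := by
    intro s hs
    refine measure_null_of_locally_null s fun y₀ _ => ?_
    obtain ⟨r, hr, h⟩ := hcomp 2 one_lt_two y₀
    refine ⟨s ∩ Metric.ball y₀ r, inter_mem_nhdsWithin _ (Metric.ball_mem_nhds y₀ hr), ?_⟩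
    have h0 : volume (s ∩ Metric.ball y₀ r) = 0 := measure_mono_null inter_subset_left hs
    have := (h (s ∩ Metric.ball y₀ r) inter_subset_right).1
    simpa [h0] using this
  have hderiv : ∀ᵐ y ∂(volume : Measure U), ρ.rnDeriv volume y = D y := by
    filter_upwards [Besicovitch.ae_tendsto_rnDeriv ρ volume] with y hy
    have hev : ∀ K : ℝ≥0, 1 < K → ρ.rnDeriv volume y ≤ (K : ℝ≥0∞) ^ m * D y ∧
        D y ≤ (K : ℝ≥0∞) ^ m * ρ.rnDeriv volume y := by
      intro K hK
      obtain ⟨r, hr, h⟩ := hcomp K hK y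
      have hKtop : (K : ℝ≥0∞) ^ m ≠ ⊤ := ENNReal.pow_ne_top ENNReal.coe_ne_top
      have hsmall : ∀ᶠ t in 𝓝[>] (0 : ℝ),
          ρ (Metric.closedBall y t) / volume (Metric.closedBall y t) ≤ (K : ℝ≥0∞) ^ m * D y ∧
          D y ≤ (K : ℝ≥0∞) ^ m *
            (ρ (Metric.closedBall y t) / volume (Metric.closedBall y t)) := by
        filter_upwards [Ioo_mem_nhdsGT hr] with t ht
        have hv0 : volume (Metric.closedBall y t) ≠ 0 :=
          (Metric.measure_closedBall_pos volume y ht.1).ne'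
        have hvtop : volume (Metric.closedBall y t) ≠ ⊤ :=
          Metric.isBounded_closedBall.measure_lt_top.ne
        obtain ⟨h1, h2⟩ := h (Metric.closedBall y t) (Metric.closedBall_subset_ball ht.2)
        constructor
        · rw [ENNReal.div_le_iff hv0 hvtop, mul_assoc]
          exact h1
        · rw [← mul_div_assoc, ENNReal.le_div_iff_mul_le (.inl hv0) (.inl hvtop)]
          exact h2
      exact ⟨le_of_tendsto hy (hsmall.mono fun t ht => ht.1),
        ge_of_tendsto (ENNReal.Tendsto.const_mul hy (.inr hKtop)) (hsmall.mono fun t ht => ht.2)⟩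
    -- Letting `K` decrease to `1` closes the two-sided bound on the density.
    have hlim : ∀ a : ℝ≥0∞, Tendsto (fun K : ℝ≥0 => (K : ℝ≥0∞) ^ m * a) (𝓝[>] 1) (𝓝 a) := by
      intro a
      have h1 : Tendsto (fun K : ℝ≥0 => (K : ℝ≥0∞) ^ m) (𝓝[>] 1) (𝓝 1) := by
        have : Continuous fun K : ℝ≥0 => (K : ℝ≥0∞) ^ m := by
          simpa [Function.comp_def] using ENNReal.continuous_coe.comp (continuous_pow (M := ℝ≥0) m)
        simpa using (this.tendsto 1).mono_left nhdsWithin_le_nhds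
      simpa using ENNReal.Tendsto.mul_const h1 (.inl one_ne_zero)
    have hself : ∀ᶠ K : ℝ≥0 in 𝓝[>] 1, 1 < K := self_mem_nhdsWithin
    exact le_antisymm (ge_of_tendsto (hlim _) (hself.mono fun K hK => (hev K hK).1))
      (ge_of_tendsto (hlim _) (hself.mono fun K hK => (hev K hK).2))
  have hρD : volume.withDensity D = ρ := by
    rw [← withDensity_congr_ae hderiv, Measure.withDensity_rnDeriv_eq _ _ hac]
  rw [hρD, hρ, hemb.map_comap]

end AreaFormula

/-! ### Graph coordinates near a boundary point. -/

open Module in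
/-- A unit vector `e` splits Euclidean space isometrically, hence measure-preservingly, into a
hyperplane and a line. -/
lemma exists_isometry_orthogonal {e : EuclideanSpace ℝ (Fin n)} (he : ‖e‖ = 1) :
    ∃ ι : EuclideanSpace ℝ (Fin (n - 1)) →ₗᵢ[ℝ] EuclideanSpace ℝ (Fin n),
      (∀ y, ⟪e, ι y⟫ = 0) ∧
      MeasurePreserving (fun p : EuclideanSpace ℝ (Fin (n - 1)) × ℝ => ι p.1 + p.2 • e) ∧
      ∀ x, ∃ y, ι y = x - ⟪e, x⟫ • e := by
  have he0 : e ≠ 0 := by rintro rfl; simp at he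
  have hpos : 0 < n := by
    rcases Nat.eq_zero_or_pos n with rfl | h
    · exact absurd (Subsingleton.elim e 0) he0
    · exact h
  have hrank : finrank ℝ (ℝ ∙ e)ᗮ = n - 1 := by
    have : Fact (finrank ℝ (EuclideanSpace ℝ (Fin n)) = (n - 1) + 1) :=
      ⟨by rw [finrank_euclideanSpace_fin]; omega⟩
    exact Submodule.finrank_orthogonal_span_singleton he0
  let b : OrthonormalBasis (Fin (n - 1)) ℝ (ℝ ∙ e)ᗮ :=
    (stdOrthonormalBasis ℝ (ℝ ∙ e)ᗮ).reindex (finCongr hrank)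
  let ι : EuclideanSpace ℝ (Fin (n - 1)) →ₗᵢ[ℝ] EuclideanSpace ℝ (Fin n) :=
    (ℝ ∙ e)ᗮ.subtypeₗᵢ.comp b.repr.symm.toLinearIsometry
  have horth : ∀ y, ⟪e, ι y⟫ = 0 := fun y =>
    Submodule.mem_orthogonal_singleton_iff_inner_right.1 (b.repr.symm y).2
  refine ⟨ι, horth, ?_, fun x => ?_⟩
  -- With the L² product norm the splitting is a linear isometry between spaces of equal dimension,
  -- hence preserves volume; passing from the plain product to `WithLp 2` also preserves volume.
  · let A : WithLp 2 (EuclideanSpace ℝ (Fin (n - 1)) × ℝ) →ₗᵢ[ℝ] EuclideanSpace ℝ (Fin n) :=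
      { toFun := fun p => ι p.fst + p.snd • e
        map_add' := fun p q => by simp [add_smul]; abel
        map_smul' := fun c p => by simp [mul_smul]
        norm_map' := fun p => by
          have h1 : ‖ι p.fst + p.snd • e‖ ^ 2 = ‖p‖ ^ 2 := by
            rw [norm_add_sq_real, inner_smul_right, real_inner_comm, horth, norm_smul, he,
              ι.norm_map, WithLp.prod_norm_sq_eq_of_L2]
            simp
          exact (sq_eq_sq₀ (norm_nonneg _) (norm_nonneg _)).1 h1 }
    have hdim : finrank ℝ (WithLp 2 (EuclideanSpace ℝ (Fin (n - 1)) × ℝ)) =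
        finrank ℝ (EuclideanSpace ℝ (Fin n)) := by
      rw [(WithLp.linearEquiv 2 ℝ (EuclideanSpace ℝ (Fin (n - 1)) × ℝ)).finrank_eq]
      simp
      omega
    have hA := (A.toLinearIsometryEquiv hdim).measurePreserving.comp
      (WithLp.volume_preserving_toLp (EuclideanSpace ℝ (Fin (n - 1))) ℝ)
    exact hA
  · have hx : x - ⟪e, x⟫ • e ∈ (ℝ ∙ e)ᗮ := by
      rw [Submodule.mem_orthogonal_singleton_iff_inner_right, inner_sub_right, inner_smul_right,
        real_inner_self_eq_norm_sq, he]
      ring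
    exact ⟨b.repr ⟨_, hx⟩, by simp [ι]⟩

/-- A description of `Ω` near `c` as the region above a smooth graph. -/
structure GraphChart (Ω : Set (EuclideanSpace ℝ (Fin n))) (c : EuclideanSpace ℝ (Fin n)) where
  radius : ℝ
  radius_pos : 0 < radius
  e : EuclideanSpace ℝ (Fin n)
  norm_e : ‖e‖ = 1
  γ : EuclideanSpace ℝ (Fin n) → ℝ
  contDiff_γ : ContDiff ℝ ∞ γ
  ι : EuclideanSpace ℝ (Fin (n - 1)) →ₗᵢ[ℝ] EuclideanSpace ℝ (Fin n)
  inner_e_ι : ∀ y, ⟪e, ι y⟫ = 0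
  measurePreserving :
    MeasurePreserving (fun p : EuclideanSpace ℝ (Fin (n - 1)) × ℝ => ι p.1 + p.2 • e)
  exists_ι_eq : ∀ x, ∃ y, ι y = x - ⟪e, x⟫ • e
  mem_iff' : ∀ x ∈ Metric.ball c radius, x ∈ Ω ↔ γ (x - ⟪e, x⟫ • e) < ⟪e, x⟫

lemma HasSmoothBoundary.nonempty_graphChart {Ω : Set (EuclideanSpace ℝ (Fin n))}
    (h : HasSmoothBoundary Ω) {c : EuclideanSpace ℝ (Fin n)} (hc : c ∈ frontier Ω) :
    Nonempty (GraphChart Ω c) := by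
  obtain ⟨r, hr, e, he, γ, hγ, hmem⟩ := h c hc
  obtain ⟨ι, h1, h2, h3⟩ := exists_isometry_orthogonal he
  exact ⟨⟨r, hr, e, he, γ, hγ, ι, h1, h2, h3, hmem⟩⟩

namespace GraphChart

variable {Ω : Set (EuclideanSpace ℝ (Fin n))} {c : EuclideanSpace ℝ (Fin n)} (T : GraphChart Ω c)

/-- The height above the graph. -/
def height (x : EuclideanSpace ℝ (Fin n)) : ℝ := ⟪T.e, x⟫ - T.γ (x - ⟪T.e, x⟫ • T.e)

/-- The parametrisation of the graph. -/
def graph (y : EuclideanSpace ℝ (Fin (n - 1))) : EuclideanSpace ℝ (Fin n) :=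
  T.ι y + T.γ (T.ι y) • T.e

lemma mem_iff {x : EuclideanSpace ℝ (Fin n)} (hx : x ∈ Metric.ball c T.radius) :
    x ∈ Ω ↔ 0 < T.height x := by
  rw [T.mem_iff' x hx, height, sub_pos]

lemma contDiff_height : ContDiff ℝ ∞ T.height := by
  have h1 : ContDiff ℝ ∞ fun x : EuclideanSpace ℝ (Fin n) => ⟪T.e, x⟫ :=
    contDiff_const.inner ℝ contDiff_id
  exact h1.sub (T.contDiff_γ.comp (contDiff_id.sub (h1.smul contDiff_const)))

lemma continuous_height : Continuous T.height := T.contDiff_height.continuous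

lemma inner_e_e : ⟪T.e, T.e⟫ = 1 := by rw [real_inner_self_eq_norm_sq, T.norm_e]; norm_num

lemma height_add_smul (x : EuclideanSpace ℝ (Fin n)) (t : ℝ) :
    T.height (x + t • T.e) = T.height x + t := by
  have : x + t • T.e - ⟪T.e, x + t • T.e⟫ • T.e = x - ⟪T.e, x⟫ • T.e := by
    rw [inner_add_right, inner_smul_right, T.inner_e_e, mul_one, add_smul]; abel
  rw [height, height, this, inner_add_right, inner_smul_right, T.inner_e_e]
  ring

lemma height_ι_add_smul (y : EuclideanSpace ℝ (Fin (n - 1))) (t : ℝ) :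
    T.height (T.ι y + t • T.e) = t - T.γ (T.ι y) := by
  rw [height_add_smul, height, T.inner_e_ι]
  simp
  ring

lemma graph_add_smul (y : EuclideanSpace ℝ (Fin (n - 1))) (t : ℝ) :
    T.graph y + t • T.e = T.ι y + (t + T.γ (T.ι y)) • T.e := by
  rw [graph, add_smul]; abel

lemma height_graph_add_smul (y : EuclideanSpace ℝ (Fin (n - 1))) (t : ℝ) :
    T.height (T.graph y + t • T.e) = t := by
  rw [graph_add_smul, height_ι_add_smul]; ring

lemma height_graph (y : EuclideanSpace ℝ (Fin (n - 1))) : T.height (T.graph y) = 0 := by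
  simpa using T.height_graph_add_smul y 0

lemma range_graph : range T.graph = {x | T.height x = 0} := by
  ext x
  constructor
  · rintro ⟨y, rfl⟩; exact T.height_graph y
  · intro hx
    obtain ⟨y, hy⟩ := T.exists_ι_eq x
    refine ⟨y, ?_⟩
    have : T.height x = 0 := hx
    rw [height, sub_eq_zero] at this
    rw [graph, hy, ← this]; abel

lemma contDiff_graph : ContDiff ℝ ∞ T.graph := by
  have := T.contDiff_γ
  have h2 : ContDiff ℝ ∞ T.ι := T.ι.toContinuousLinearMap.contDiff
  unfold graph
  fun_prop

lemma injective_graph : Function.Injective T.graph := by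
  intro y z h
  have h1 : ⟪T.e, T.graph y⟫ = ⟪T.e, T.graph z⟫ := by rw [h]
  simp only [graph, inner_add_right, inner_smul_right, T.inner_e_ι, T.inner_e_e] at h1
  have h2 : T.γ (T.ι y) = T.γ (T.ι z) := by linarith
  simp only [graph, h2] at h
  exact T.ι.injective (add_right_cancel h)

lemma continuous_gradient_height : Continuous (∇ T.height) :=
  (InnerProductSpace.toDual ℝ _).symm.continuous.comp
    (T.contDiff_height.continuous_fderiv (by simp))

lemma inner_gradient_height (x w : EuclideanSpace ℝ (Fin n)) :
    ⟪∇ T.height x, w⟫ = fderiv ℝ T.height x w := by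
  rw [gradient, InnerProductSpace.toDual_symm_apply]

lemma inner_gradient_height_e (x : EuclideanSpace ℝ (Fin n)) : ⟪∇ T.height x, T.e⟫ = 1 := by
  rw [inner_gradient_height]
  have h1 : HasDerivAt (fun t : ℝ => T.height (x + t • T.e)) (fderiv ℝ T.height x T.e) 0 := by
    have hd : HasFDerivAt T.height (fderiv ℝ T.height x) (x + (0 : ℝ) • T.e) := by
      simpa using (T.contDiff_height.differentiable (by simp) x).hasFDerivAt
    have hl : HasDerivAt (fun t : ℝ => x + t • T.e) T.e 0 := by
      simpa using ((hasDerivAt_id (0 : ℝ)).smul_const T.e).const_add x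
    exact hd.comp_hasDerivAt _ hl
  have h2 : HasDerivAt (fun t : ℝ => T.height (x + t • T.e)) 1 0 := by
    simp only [height_add_smul]
    exact (hasDerivAt_id (0 : ℝ)).const_add _
  exact h1.unique h2

lemma gradient_height_ne_zero (x : EuclideanSpace ℝ (Fin n)) : ∇ T.height x ≠ 0 := by
  intro h
  have := T.inner_gradient_height_e x
  simp [h] at this

lemma norm_gradient_height_pos (x : EuclideanSpace ℝ (Fin n)) : 0 < ‖∇ T.height x‖ :=
  norm_pos_iff.2 (T.gradient_height_ne_zero x)

lemma hasFDerivAt_graph (y : EuclideanSpace ℝ (Fin (n - 1))) :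
    HasFDerivAt T.graph (T.ι.toContinuousLinearMap +
      (fderiv ℝ (fun z => T.γ (T.ι z)) y).smulRight T.e) y := by
  have hd : DifferentiableAt ℝ (fun z => T.γ (T.ι z)) y := by
    have h2 : ContDiff ℝ ∞ T.ι := T.ι.toContinuousLinearMap.contDiff
    exact ((T.contDiff_γ.comp h2).differentiable (by simp)) y
  exact (T.ι.toContinuousLinearMap.hasFDerivAt).add (hd.hasFDerivAt.smul_const T.e)

lemma fderiv_graph_apply (y v : EuclideanSpace ℝ (Fin (n - 1))) :
    fderiv ℝ T.graph y v = T.ι v + ⟪∇ (fun z => T.γ (T.ι z)) y, v⟫ • T.e := by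
  rw [(T.hasFDerivAt_graph y).fderiv, gradient, InnerProductSpace.toDual_symm_apply]
  rfl

/-- The height vanishes identically along the graph, so the chain rule gives the component of its
gradient along each horizontal direction; the component along `e` is `1`. -/
lemma gradient_height_graph (y : EuclideanSpace ℝ (Fin (n - 1))) :
    ∇ T.height (T.graph y) = T.e - T.ι (∇ (fun z => T.γ (T.ι z)) y) := by
  have key : ∀ v, ⟪∇ T.height (T.graph y), T.ι v⟫ = -⟪∇ (fun z => T.γ (T.ι z)) y, v⟫ := by
    intro v
    have h1 : fderiv ℝ (fun z => T.height (T.graph z)) y = 0 := by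
      simp only [height_graph]
      exact (hasFDerivAt_const (0 : ℝ) y).fderiv
    have h2 : fderiv ℝ (fun z => T.height (T.graph z)) y =
        (fderiv ℝ T.height (T.graph y)).comp (fderiv ℝ T.graph y) :=
      fderiv_comp y (T.contDiff_height.differentiable (by simp) _)
        (T.contDiff_graph.differentiable (by simp) _)
    have h3 := congrArg (fun L => L v) (h2.symm.trans h1)
    simp only [ContinuousLinearMap.comp_apply, fderiv_graph_apply, ← inner_gradient_height,
      inner_add_right, inner_smul_right, inner_gradient_height_e,
      zero_apply] at h3
    linarith
  refine ext_inner_right ℝ fun w => ?_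
  obtain ⟨v, hv⟩ := T.exists_ι_eq w
  have hw : w = T.ι v + ⟪T.e, w⟫ • T.e := by rw [hv]; abel
  rw [hw, inner_add_right, key, inner_smul_right, inner_gradient_height_e, inner_sub_left,
    inner_add_right, inner_add_right, inner_smul_right, inner_smul_right, T.inner_e_ι,
    T.inner_e_e, T.ι.inner_map_map, real_inner_comm T.e (T.ι _), T.inner_e_ι]
  ring

/-- With `a` the gradient of the graph function, the Gram operator of the derivative is the identity
plus `a ⊗ a`, a transvection of determinant `1 + |a|²`. By `gradient_height_graph` this is the
squared norm of the height gradient. -/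
lemma normDet_fderiv_graph (y : EuclideanSpace ℝ (Fin (n - 1))) :
    (fderiv ℝ T.graph y : EuclideanSpace ℝ (Fin (n - 1)) →ₗ[ℝ] EuclideanSpace ℝ (Fin n)).normDet
      = ‖∇ T.height (T.graph y)‖ := by
  set a := ∇ (fun z => T.γ (T.ι z)) y with ha
  refine (sq_eq_sq₀ (LinearMap.normDet_nonneg _) (norm_nonneg _)).1 ?_
  have h1 := LinearMap.normDet_sq (𝕜 := ℝ)
    (fderiv ℝ T.graph y : EuclideanSpace ℝ (Fin (n - 1)) →ₗ[ℝ] EuclideanSpace ℝ (Fin n))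
  have h2 : LinearMap.adjoint (fderiv ℝ T.graph y : EuclideanSpace ℝ (Fin (n - 1)) →ₗ[ℝ]
      EuclideanSpace ℝ (Fin n)) ∘ₗ (fderiv ℝ T.graph y : EuclideanSpace ℝ (Fin (n - 1)) →ₗ[ℝ]
      EuclideanSpace ℝ (Fin n)) = LinearMap.transvection (innerₛₗ ℝ a) a := by
    refine LinearMap.ext fun v => ext_inner_right ℝ fun w => ?_
    rw [LinearMap.comp_apply, LinearMap.adjoint_inner_left, LinearMap.transvection.apply]
    simp only [ContinuousLinearMap.coe_coe, fderiv_graph_apply, inner_add_left, inner_add_right,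
      inner_smul_left, inner_smul_right, T.ι.inner_map_map, T.inner_e_ι, T.inner_e_e,
      real_inner_comm T.e (T.ι _), innerₛₗ_apply_apply, ← ha]
    simp [mul_comm]
  rw [h2, LinearMap.transvection.det] at h1
  have h3 : ‖∇ T.height (T.graph y)‖ ^ 2 = 1 + ⟪a, a⟫ := by
    rw [gradient_height_graph, norm_sub_sq_real, T.inner_e_ι, T.norm_e, T.ι.norm_map,
      real_inner_self_eq_norm_sq]
    ring
  rw [h3]
  exact h1

lemma le_norm_fderiv_graph (y v : EuclideanSpace ℝ (Fin (n - 1))) :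
    ‖v‖ ≤ ‖fderiv ℝ T.graph y v‖ := by
  refine (sq_le_sq₀ (norm_nonneg _) (norm_nonneg _)).1 ?_
  rw [fderiv_graph_apply, norm_add_sq_real, inner_smul_right, real_inner_comm T.e (T.ι v),
    T.inner_e_ι, T.ι.norm_map]
  nlinarith [sq_nonneg ‖⟪∇ (fun z => T.γ (T.ι z)) y, v⟫ • T.e‖]

lemma map_graph_withDensity :
    ((volume : Measure (EuclideanSpace ℝ (Fin (n - 1)))).withDensity fun y =>
        ENNReal.ofReal ‖∇ T.height (T.graph y)‖).map T.graph =
      (Measure.euclideanHausdorffMeasure (n - 1)).restrict {x | T.height x = 0} := by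
  have h := map_withDensity_normDet (T.contDiff_graph.of_le (by simp)) T.injective_graph
    T.le_norm_fderiv_graph
  simp only [normDet_fderiv_graph, finrank_euclideanSpace_fin, T.range_graph] at h
  exact h

lemma measurableEmbedding_graph : MeasurableEmbedding T.graph :=
  T.contDiff_graph.continuous.measurableEmbedding T.injective_graph

lemma setIntegral_height_eq_zero (f : EuclideanSpace ℝ (Fin n) → ℝ) :
    ∫ x in {x | T.height x = 0}, f x ∂Measure.euclideanHausdorffMeasure (n - 1) =
      ∫ y, ‖∇ T.height (T.graph y)‖ * f (T.graph y) := by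
  have hc : Continuous fun y => ‖∇ T.height (T.graph y)‖ :=
    (T.continuous_gradient_height.comp T.contDiff_graph.continuous).norm
  rw [← map_graph_withDensity, T.measurableEmbedding_graph.integral_map,
    integral_withDensity_eq_integral_toReal_smul hc.measurable.ennreal_ofReal (by simp)]
  simp

end GraphChart

/-! ### The outward normal and the surface measure. -/

section Normal

variable {Ω : Set (EuclideanSpace ℝ (Fin n))}

/-- If the two normals differed, the direction `ν' - ν` would enter the domain according to `ν` and
leave it according to `ν'`. -/
lemma IsOutwardUnitNormal.unique {x ν ν' : EuclideanSpace ℝ (Fin n)}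
    (h : IsOutwardUnitNormal Ω x ν) (h' : IsOutwardUnitNormal Ω x ν') : ν = ν' := by
  by_contra hne
  have hlt : ⟪ν, ν'⟫ < 1 := by
    refine lt_of_le_of_ne ?_ fun heq => hne ((inner_eq_one_iff_of_norm_eq_one h.1 h'.1).1 heq)
    simpa [h.1, h'.1] using real_inner_le_norm ν ν'
  have h1 : ⟪ν' - ν, ν⟫ < 0 := by
    rw [inner_sub_left, real_inner_self_eq_norm_sq, h.1, real_inner_comm]; linarith
  have h2 : 0 < ⟪ν' - ν, ν'⟫ := by
    rw [inner_sub_left, real_inner_self_eq_norm_sq, h'.1]; linarith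
  obtain ⟨t, ht, ht'⟩ := ((h.2.1 _ h1).and (h'.2.2 _ h2)).exists
  exact ht' ht

lemma IsOutwardUnitNormal.outwardNormal_eq {x ν : EuclideanSpace ℝ (Fin n)}
    (h : IsOutwardUnitNormal Ω x ν) : outwardNormal Ω x = ν :=
  (Classical.epsilon_spec ⟨ν, h⟩ : IsOutwardUnitNormal Ω x (outwardNormal Ω x)).unique h

end Normal

namespace GraphChart

variable {Ω : Set (EuclideanSpace ℝ (Fin n))} {c : EuclideanSpace ℝ (Fin n)} (T : GraphChart Ω c)

lemma height_nonneg {x : EuclideanSpace ℝ (Fin n)} (hx : x ∈ Metric.ball c T.radius)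
    (hxΩ : x ∈ closure Ω) : 0 ≤ T.height x := by
  by_contra! hlt
  have h1 : {y | T.height y < 0} ∩ Metric.ball c T.radius ∈ 𝓝 x :=
    ((isOpen_lt T.continuous_height continuous_const).inter Metric.isOpen_ball).mem_nhds ⟨hlt, hx⟩
  obtain ⟨y, ⟨hy, hyb⟩, hyΩ⟩ := mem_closure_iff_nhds.1 hxΩ _ h1
  exact lt_asymm ((T.mem_iff hyb).1 hyΩ) hy

lemma add_smul_mem {x : EuclideanSpace ℝ (Fin n)} {t : ℝ} (hx : x ∈ Metric.ball c T.radius)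
    (hxΩ : x ∈ closure Ω) (ht : 0 < t) (hxt : x + t • T.e ∈ Metric.ball c T.radius) :
    x + t • T.e ∈ Ω := by
  rw [T.mem_iff hxt, height_add_smul]
  linarith [T.height_nonneg hx hxΩ]

lemma tendsto_add_smul (x : EuclideanSpace ℝ (Fin n)) :
    Tendsto (fun t : ℝ => x + t • T.e) (𝓝[>] 0) (𝓝 x) := by
  have : Continuous fun t : ℝ => x + t • T.e := by fun_prop
  simpa using (this.tendsto 0).mono_left (nhdsWithin_le_nhds (s := Ioi 0))

lemma mem_frontier_iff (hΩ : IsOpen Ω) {x : EuclideanSpace ℝ (Fin n)}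
    (hx : x ∈ Metric.ball c T.radius) : x ∈ frontier Ω ↔ T.height x = 0 := by
  rw [hΩ.frontier_eq]
  constructor
  · rintro ⟨h1, h2⟩
    rw [T.mem_iff hx, not_lt] at h2
    exact le_antisymm h2 (T.height_nonneg hx h1)
  · intro h
    refine ⟨?_, by rw [T.mem_iff hx, h]; exact lt_irrefl _⟩
    refine mem_closure_of_tendsto (T.tendsto_add_smul x) ?_
    filter_upwards [self_mem_nhdsWithin,
      T.tendsto_add_smul x (Metric.isOpen_ball.mem_nhds hx)] with t ht htb
    rw [T.mem_iff htb, height_add_smul, h, zero_add]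
    exact ht

lemma graph_mem_frontier (hΩ : IsOpen Ω) {y : EuclideanSpace ℝ (Fin (n - 1))}
    (hy : T.graph y ∈ Metric.ball c T.radius) : T.graph y ∈ frontier Ω :=
  (T.mem_frontier_iff hΩ hy).2 (T.height_graph y)

/-- The domain is locally the set of positive height and `x` has height zero. So the sign of the
directional derivative of the height decides whether a ray enters or leaves. -/
lemma isOutwardUnitNormal (hΩ : IsOpen Ω) {x : EuclideanSpace ℝ (Fin n)}
    (hx : x ∈ Metric.ball c T.radius) (hxΩ : x ∈ frontier Ω) :
    IsOutwardUnitNormal Ω x (-(‖∇ T.height x‖⁻¹ • ∇ T.height x)) := by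
  have hpos := T.norm_gradient_height_pos x
  have h0 := (T.mem_frontier_iff hΩ hx).1 hxΩ
  have hinner : ∀ w, ⟪w, -(‖∇ T.height x‖⁻¹ • ∇ T.height x)⟫ =
      -(‖∇ T.height x‖⁻¹ * fderiv ℝ T.height x w) := fun w => by
    rw [inner_neg_right, inner_smul_right, real_inner_comm, inner_gradient_height]
  have hline : ∀ w, Tendsto (fun t : ℝ => x + t • w) (𝓝[>] 0) (𝓝 x) := fun w => by
    have : Continuous fun t : ℝ => x + t • w := by fun_prop
    simpa using (this.tendsto 0).mono_left (nhdsWithin_le_nhds (s := Ioi 0))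
  have hball : ∀ w, ∀ᶠ t in 𝓝[>] (0 : ℝ), x + t • w ∈ Metric.ball c T.radius := fun w =>
    hline w (Metric.isOpen_ball.mem_nhds hx)
  have hslope : ∀ w, Tendsto (fun t : ℝ => t⁻¹ * T.height (x + t • w)) (𝓝[>] 0)
      (𝓝 (fderiv ℝ T.height x w)) := fun w => by
    have hl := (T.contDiff_height.differentiable (by simp) x).hasFDerivAt.hasLineDerivAt w
    simpa [h0] using hl.tendsto_slope_zero_right
  refine ⟨?_, fun w hw => ?_, fun w hw => ?_⟩
  · rw [norm_neg, norm_smul, norm_inv, norm_norm, inv_mul_cancel₀ hpos.ne']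
  · rw [hinner] at hw
    have hw' : 0 < fderiv ℝ T.height x w :=
      pos_of_mul_pos_right (by linarith) (inv_nonneg.2 hpos.le)
    filter_upwards [hball w, (hslope w).eventually (lt_mem_nhds hw'),
      self_mem_nhdsWithin] with t h1 h2 h3
    rw [T.mem_iff h1]
    exact pos_of_mul_pos_right h2 (inv_nonneg.2 (le_of_lt h3))
  · rw [hinner] at hw
    have hw' : fderiv ℝ T.height x w < 0 := by
      by_contra! h
      have := mul_nonneg (inv_nonneg.2 hpos.le) h
      linarith
    filter_upwards [hball w, (hslope w).eventually (gt_mem_nhds hw'),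
      self_mem_nhdsWithin] with t h1 h2 h3
    rw [T.mem_iff h1, not_lt]
    by_contra! h
    have := mul_pos (inv_pos.2 h3) h
    linarith

lemma outwardNormal_eq (hΩ : IsOpen Ω) {x : EuclideanSpace ℝ (Fin n)}
    (hx : x ∈ Metric.ball c T.radius) (hxΩ : x ∈ frontier Ω) :
    outwardNormal Ω x = -(‖∇ T.height x‖⁻¹ • ∇ T.height x) :=
  (T.isOutwardUnitNormal hΩ hx hxΩ).outwardNormal_eq

lemma inner_outwardNormal_neg (hΩ : IsOpen Ω) {x : EuclideanSpace ℝ (Fin n)}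
    (hx : x ∈ Metric.ball c T.radius) (hxΩ : x ∈ frontier Ω) : ⟪T.e, outwardNormal Ω x⟫ < 0 := by
  rw [T.outwardNormal_eq hΩ hx hxΩ, inner_neg_right, inner_smul_right, real_inner_comm,
    inner_gradient_height_e, mul_one]
  exact neg_neg_of_pos (inv_pos.2 (T.norm_gradient_height_pos x))

/-- Surface integrals of functions supported in a chart, in graph coordinates. -/
lemma integral_surfaceMeasure (hΩ : IsOpen Ω) {f : EuclideanSpace ℝ (Fin n) → ℝ}
    (hf : ∀ x ∉ Metric.ball c T.radius, f x = 0) :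
    ∫ x, f x ∂surfaceMeasure Ω = ∫ y, ‖∇ T.height (T.graph y)‖ * f (T.graph y) := by
  have hm1 : MeasurableSet (frontier Ω) := isClosed_frontier.measurableSet
  have hm2 : MeasurableSet {x | T.height x = 0} :=
    (isClosed_eq T.continuous_height continuous_const).measurableSet
  rw [← setIntegral_height_eq_zero, surfaceMeasure, ← integral_indicator hm1,
    ← integral_indicator hm2]
  congr 1
  ext x
  by_cases hx : x ∈ Metric.ball c T.radius
  · by_cases h : x ∈ frontier Ω
    · rw [indicator_of_mem h, indicator_of_mem (show x ∈ {x | T.height x = 0} from (T.mem_frontier_iff hΩ hx).1 h)]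
    · rw [indicator_of_notMem h, indicator_of_notMem]
      exact fun h' => h ((T.mem_frontier_iff hΩ hx).2 h')
  · simp [indicator, hf x hx]

/-- The parametrisation does not shrink norms, so the part of the graph in the ball has bounded
parameter set, and the continuous density is integrable there. -/
lemma surfaceMeasure_ball_lt_top (hΩ : IsOpen Ω) :
    surfaceMeasure Ω (Metric.ball c T.radius) < ⊤ := by
  set B := Metric.ball c T.radius
  have hB : MeasurableSet B := Metric.isOpen_ball.measurableSet
  have hm2 : MeasurableSet {x | T.height x = 0} :=
    (isClosed_eq T.continuous_height continuous_const).measurableSet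
  have h1 : surfaceMeasure Ω B =
      (Measure.euclideanHausdorffMeasure (n - 1)).restrict {x | T.height x = 0} B := by
    rw [surfaceMeasure, Measure.restrict_apply hB, Measure.restrict_apply hB]
    congr 1
    ext x
    exact and_congr_right fun hx => T.mem_frontier_iff hΩ hx
  have hbdd : Bornology.IsBounded (T.graph ⁻¹' B) := by
    refine (Metric.isBounded_iff_subset_closedBall 0).2 ⟨‖c‖ + T.radius, fun y hy => ?_⟩
    have h2 : ‖T.graph y‖ ≤ ‖c‖ + T.radius := by
      have := (mem_ball_iff_norm.1 hy).le
      have h3 := norm_le_norm_add_norm_sub' (T.graph y) c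
      linarith
    have h3 : ‖T.ι y‖ ^ 2 ≤ ‖T.graph y‖ ^ 2 := by
      rw [graph, norm_add_sq_real, inner_smul_right, real_inner_comm, T.inner_e_ι]
      nlinarith [sq_nonneg ‖T.γ (T.ι y) • T.e‖]
    rw [T.ι.norm_map] at h3
    rw [mem_closedBall_zero_iff]
    exact ((sq_le_sq₀ (norm_nonneg _) (norm_nonneg _)).1 h3).trans h2
  have hc : Continuous fun y => ‖∇ T.height (T.graph y)‖ :=
    (T.continuous_gradient_height.comp T.contDiff_graph.continuous).norm
  rw [h1, ← map_graph_withDensity, T.measurableEmbedding_graph.map_apply,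
    withDensity_apply _ (T.measurableEmbedding_graph.measurable hB)]
  obtain ⟨R, hR⟩ := (Metric.isBounded_iff_subset_closedBall 0).1 hbdd
  refine (lintegral_mono_set hR).trans_lt ?_
  exact (hc.continuousOn.integrableOn_compact (isCompact_closedBall _ _)).lintegral_lt_top

end GraphChart

namespace IsSmoothBoundedDomain

variable {Ω : Set (EuclideanSpace ℝ (Fin n))} (hΩ : IsSmoothBoundedDomain Ω)
include hΩ

lemma isCompact_closure : IsCompact (closure Ω) := hΩ.isBounded.isCompact_closure

lemma isCompact_frontier : IsCompact (frontier Ω) :=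
  hΩ.isCompact_closure.of_isClosed_subset isClosed_frontier frontier_subset_closure

lemma isFiniteMeasure_surfaceMeasure : IsFiniteMeasure (surfaceMeasure Ω) := by
  have h : surfaceMeasure Ω (frontier Ω) < ⊤ := by
    refine hΩ.isCompact_frontier.measure_lt_top_of_nhdsWithin fun x hx => ?_
    obtain ⟨T⟩ := hΩ.smoothBoundary.nonempty_graphChart hx
    exact ⟨_, mem_nhdsWithin_of_mem_nhds (Metric.ball_mem_nhds x T.radius_pos),
      T.surfaceMeasure_ball_lt_top hΩ.isOpen⟩
  refine ⟨?_⟩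
  rw [surfaceMeasure, Measure.restrict_apply_self] at h
  rwa [surfaceMeasure, Measure.restrict_apply_univ]

lemma isFiniteMeasure_volume_restrict : IsFiniteMeasure (volume.restrict Ω) :=
  ⟨by rw [Measure.restrict_apply_univ]; exact hΩ.isBounded.measure_lt_top⟩

lemma continuousOn_outwardNormal : ContinuousOn (outwardNormal Ω) (frontier Ω) := by
  intro x hx
  obtain ⟨T⟩ := hΩ.smoothBoundary.nonempty_graphChart hx
  have hx' : x ∈ Metric.ball x T.radius := Metric.mem_ball_self T.radius_pos
  have hc : Continuous fun y => -(‖∇ T.height y‖⁻¹ • ∇ T.height y) :=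
    ((T.continuous_gradient_height.norm.inv₀ fun y => (T.norm_gradient_height_pos y).ne').smul
      T.continuous_gradient_height).neg
  refine hc.continuousWithinAt.congr_of_eventuallyEq ?_ (T.outwardNormal_eq hΩ.isOpen hx' hx)
  filter_upwards [self_mem_nhdsWithin,
    mem_nhdsWithin_of_mem_nhds (Metric.ball_mem_nhds x T.radius_pos)] with y hy hyb
  exact T.outwardNormal_eq hΩ.isOpen hyb hy

lemma norm_outwardNormal {x : EuclideanSpace ℝ (Fin n)} (hx : x ∈ frontier Ω) :
    ‖outwardNormal Ω x‖ = 1 := by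
  obtain ⟨T⟩ := hΩ.smoothBoundary.nonempty_graphChart hx
  have h := T.isOutwardUnitNormal hΩ.isOpen (Metric.mem_ball_self T.radius_pos) hx
  rw [h.outwardNormal_eq]
  exact h.1

lemma integrable_surfaceMeasure {F : Type*} [NormedAddCommGroup F]
    {f : EuclideanSpace ℝ (Fin n) → F}
    (hf : ContinuousOn f (frontier Ω)) : Integrable f (surfaceMeasure Ω) := by
  have := hΩ.isFiniteMeasure_surfaceMeasure
  have h := hf.integrableOn_compact (μ := surfaceMeasure Ω) hΩ.isCompact_frontier
  rwa [IntegrableOn, surfaceMeasure, Measure.restrict_restrict isClosed_frontier.measurableSet,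
    inter_self] at h

end IsSmoothBoundedDomain

/-! ### Divergence, smooth partitions of unity and the cutoff. -/

/-- The divergence of a vector field. -/
def divergence (X : EuclideanSpace ℝ (Fin n) → EuclideanSpace ℝ (Fin n))
    (x : EuclideanSpace ℝ (Fin n)) : ℝ :=
  ∑ i, fderiv ℝ X x (EuclideanSpace.single i 1) i

lemma inner_gradient_eq_fderiv {f : EuclideanSpace ℝ (Fin n) → ℝ} (x w : EuclideanSpace ℝ (Fin n)) :
    ⟪∇ f x, w⟫ = fderiv ℝ f x w := by
  rw [gradient, InnerProductSpace.toDual_symm_apply]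

lemma sum_fderiv_single_mul {f : EuclideanSpace ℝ (Fin n) → ℝ} (x w : EuclideanSpace ℝ (Fin n)) :
    ∑ i, fderiv ℝ f x (EuclideanSpace.single i 1) * w i = ⟪∇ f x, w⟫ := by
  rw [inner_gradient_eq_fderiv]
  conv_rhs => rw [← (EuclideanSpace.basisFun (Fin n) ℝ).sum_repr w]
  simp [mul_comm]

lemma divergence_smul {f : EuclideanSpace ℝ (Fin n) → ℝ}
    {X : EuclideanSpace ℝ (Fin n) → EuclideanSpace ℝ (Fin n)} {x : EuclideanSpace ℝ (Fin n)}
    (hf : DifferentiableAt ℝ f x) (hX : DifferentiableAt ℝ X x) :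
    divergence (fun y => f y • X y) x = f x * divergence X x + ⟪∇ f x, X x⟫ := by
  have h : fderiv ℝ (fun y => f y • X y) x = _ := (hf.hasFDerivAt.smul hX.hasFDerivAt).fderiv
  rw [divergence, h, ← sum_fderiv_single_mul, divergence, Finset.mul_sum, ← Finset.sum_add_distrib]
  simp

lemma divergence_congr {X Y : EuclideanSpace ℝ (Fin n) → EuclideanSpace ℝ (Fin n)}
    {x : EuclideanSpace ℝ (Fin n)} (h : X =ᶠ[𝓝 x] Y) : divergence X x = divergence Y x := by
  rw [divergence, divergence, h.fderiv_eq]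

lemma divergence_eq_zero {X : EuclideanSpace ℝ (Fin n) → EuclideanSpace ℝ (Fin n)}
    {x : EuclideanSpace ℝ (Fin n)} (h : ∀ᶠ y in 𝓝 x, X y = 0) : divergence X x = 0 := by
  rw [divergence_congr (show X =ᶠ[𝓝 x] fun _ => 0 from h)]
  simp [divergence]

lemma divergence_sum {ι : Type*} {t : Finset ι}
    {X : ι → EuclideanSpace ℝ (Fin n) → EuclideanSpace ℝ (Fin n)}
    {x : EuclideanSpace ℝ (Fin n)} (h : ∀ i ∈ t, DifferentiableAt ℝ (X i) x) :
    divergence (fun y => ∑ i ∈ t, X i y) x = ∑ i ∈ t, divergence (X i) x := by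
  simp only [divergence]
  rw [fderiv_fun_sum h, Finset.sum_comm]
  simp

lemma divergence_id (x : EuclideanSpace ℝ (Fin n)) :
    divergence (fun y : EuclideanSpace ℝ (Fin n) => y) x = n := by
  simp [divergence]

lemma divergence_gradient {u : EuclideanSpace ℝ (Fin n) → ℝ} {x : EuclideanSpace ℝ (Fin n)}
    (hu : ContDiffAt ℝ 2 u x) : divergence (∇ u) x = (Δ u) x := by
  have h1 : DifferentiableAt ℝ (fderiv ℝ u) x :=
    (hu.fderiv_right (m := 1) (by norm_num)).differentiableAt one_ne_zero
  rw [InnerProductSpace.laplacian_eq_iteratedFDeriv_orthonormalBasis u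
    (EuclideanSpace.basisFun (Fin n) ℝ), divergence]
  refine Finset.sum_congr rfl fun i _ => ?_
  have h2 : fderiv ℝ (∇ u) x = ((InnerProductSpace.toDual ℝ
      (EuclideanSpace ℝ (Fin n))).symm.toContinuousLinearEquiv.toContinuousLinearMap).comp
        (fderiv ℝ (fderiv ℝ u) x) :=
    ((InnerProductSpace.toDual ℝ (EuclideanSpace ℝ (Fin n))).symm.toContinuousLinearEquiv
      |>.hasFDerivAt.comp x h1.hasFDerivAt).fderiv
  have h3 : ∀ w : EuclideanSpace ℝ (Fin n), w i = ⟪w, EuclideanSpace.single i 1⟫ := by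
    intro w
    rw [EuclideanSpace.inner_single_right]
    simp
  rw [h3, h2, iteratedFDeriv_two_apply]
  simp only [ContinuousLinearMap.comp_apply]
  simp only [EuclideanSpace.basisFun_apply]
  exact InnerProductSpace.toDual_symm_apply

lemma continuousAt_divergence {X : EuclideanSpace ℝ (Fin n) → EuclideanSpace ℝ (Fin n)}
    {x : EuclideanSpace ℝ (Fin n)} (hX : ContDiffAt ℝ 1 X x) : ContinuousAt (divergence X) x := by
  have h := (hX.fderiv_right (m := 0) (by norm_num)).continuousAt
  unfold divergence
  fun_prop

lemma integral_divergence_eq_zero {X : EuclideanSpace ℝ (Fin n) → EuclideanSpace ℝ (Fin n)}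
    (hX : ContDiff ℝ 1 X) (hc : HasCompactSupport X) :
    Integrable (divergence X) ∧ ∫ x, divergence X x = 0 := by
  have hcoord : ∀ i, ContDiff ℝ 1 fun x => X x i := fun i => by fun_prop
  have hcs : ∀ i, HasCompactSupport fun x => X x i := fun i =>
    hc.comp_left (g := fun w : EuclideanSpace ℝ (Fin n) => w i) rfl
  have hfd : ∀ i x v, fderiv ℝ X x v i = fderiv ℝ (fun y => X y i) x v := fun i x v => by
    have h1 : DifferentiableAt ℝ X x := hX.differentiable one_ne_zero x
    have h2 := ((EuclideanSpace.proj i : EuclideanSpace ℝ (Fin n) →L[ℝ] ℝ).hasFDerivAt.comp x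
      h1.hasFDerivAt).fderiv
    have h3 : fderiv ℝ (fun y => X y i) x = _ := h2
    rw [h3]
    rfl
  have hint : ∀ i, Integrable fun x => fderiv ℝ X x (EuclideanSpace.single i 1) i := fun i => by
    simp only [hfd]
    refine Continuous.integrable_of_hasCompactSupport ?_ ?_
    · exact ((hcoord i).continuous_fderiv one_ne_zero).clm_apply continuous_const
    · exact ((hcs i).fderiv ℝ).comp_left
        (g := fun L : EuclideanSpace ℝ (Fin n) →L[ℝ] ℝ => L (EuclideanSpace.single i 1)) rfl
  refine ⟨integrable_finsetSum _ fun i _ => hint i, ?_⟩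
  simp only [divergence]
  rw [integral_finsetSum _ fun i _ => hint i]
  refine Finset.sum_eq_zero fun i _ => ?_
  have hi := hint i
  simp only [hfd] at hi ⊢
  -- Integration by parts against the constant function `1`.
  have h := integral_mul_fderiv_eq_neg_fderiv_mul_of_integrable (μ := volume)
    (f := fun _ : EuclideanSpace ℝ (Fin n) => (1 : ℝ)) (g := fun x => X x i)
    (v := EuclideanSpace.single i 1) (by simp) (by simpa using hi)
    (by simpa using (hcoord i).continuous.integrable_of_hasCompactSupport (hcs i))
    (fun x _ => differentiableAt_const _)
    (fun x _ => (hcoord i).differentiable one_ne_zero x)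
  simpa using h

lemma exists_smooth_partition {K : Set (EuclideanSpace ℝ (Fin n))} (hK : IsCompact K)
    (U : EuclideanSpace ℝ (Fin n) → Set (EuclideanSpace ℝ (Fin n))) (hU : ∀ c ∈ K, U c ∈ 𝓝 c) :
    ∃ (t : Finset (EuclideanSpace ℝ (Fin n)))
      (ζ : EuclideanSpace ℝ (Fin n) → EuclideanSpace ℝ (Fin n) → ℝ),
      (∀ c ∈ t, c ∈ K) ∧ (∀ c ∈ t, ContDiff ℝ ∞ (ζ c)) ∧ (∀ c ∈ t, HasCompactSupport (ζ c)) ∧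
      (∀ c ∈ t, tsupport (ζ c) ⊆ U c) ∧ (∀ c ∈ t, ∀ x, 0 ≤ ζ c x) ∧
      ∀ x ∈ K, ∑ c ∈ t, ζ c x = 1 := by
  classical
  set W : EuclideanSpace ℝ (Fin n) → Set (EuclideanSpace ℝ (Fin n)) :=
    -- Intersecting with unit balls makes the supports bounded, hence compact.
    fun c => interior (U c) ∩ Metric.ball c 1
  have hW : ∀ c ∈ K, W c ∈ 𝓝 c := fun c hc =>
    inter_mem (interior_mem_nhds.2 (hU c hc)) (Metric.ball_mem_nhds c one_pos)
  obtain ⟨t, htK, ht⟩ := hK.elim_nhds_subcover W hW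
  obtain ⟨f, hf⟩ := SmoothPartitionOfUnity.exists_isSubordinate
    (modelWithCornersSelf ℝ (EuclideanSpace ℝ (Fin n))) hK.isClosed (fun c : t => W c)
    (fun c => isOpen_interior.inter Metric.isOpen_ball)
    (fun x hx => by simpa using ht hx)
  refine ⟨t, fun c => if h : c ∈ t then f ⟨c, h⟩ else 0, htK, ?_, ?_, ?_, ?_, ?_⟩
  · intro c hc
    simp only [hc, dif_pos]
    exact (f ⟨c, hc⟩).contMDiff.contDiff
  · intro c hc
    simp only [hc, dif_pos]
    exact Metric.isCompact_of_isClosed_isBounded (isClosed_tsupport _)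
      (Metric.isBounded_ball.subset ((hf ⟨c, hc⟩).trans inter_subset_right))
  · intro c hc
    simp only [hc, dif_pos]
    exact (hf ⟨c, hc⟩).trans (inter_subset_left.trans interior_subset)
  · intro c hc x
    simp only [hc, dif_pos]
    exact f.nonneg _ _
  · intro x hx
    have h := f.sum_eq_one hx
    rw [finsum_eq_sum_of_fintype] at h
    rw [← h, ← Finset.sum_coe_sort t]
    refine Finset.sum_congr rfl fun c _ => ?_
    simp

/-- A smooth cutoff, equal to `0` for `t ≤ 1` and to `1` for `t ≥ 2`. -/
def cutoff (t : ℝ) : ℝ := Real.smoothTransition (t - 1)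

lemma contDiff_cutoff : ContDiff ℝ 1 cutoff :=
  Real.smoothTransition.contDiff.comp (contDiff_id.sub contDiff_const)

lemma cutoff_of_le {t : ℝ} (h : t ≤ 1) : cutoff t = 0 :=
  Real.smoothTransition.zero_of_nonpos (by linarith)

lemma cutoff_of_ge {t : ℝ} (h : 2 ≤ t) : cutoff t = 1 :=
  Real.smoothTransition.one_of_one_le (by linarith)

lemma norm_cutoff_le (t : ℝ) : ‖cutoff t‖ ≤ 1 := by
  rw [Real.norm_eq_abs, cutoff, abs_of_nonneg (Real.smoothTransition.nonneg _)]
  exact Real.smoothTransition.le_one _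

lemma continuous_deriv_cutoff : Continuous (deriv cutoff) :=
  contDiff_cutoff.continuous_deriv le_rfl

lemma deriv_cutoff_of_lt {t : ℝ} (h : t < 1) : deriv cutoff t = 0 := by
  have : cutoff =ᶠ[𝓝 t] fun _ => 0 := by
    filter_upwards [gt_mem_nhds h] with s hs using cutoff_of_le (le_of_lt hs)
  rw [this.deriv_eq, deriv_const]

lemma deriv_cutoff_of_gt {t : ℝ} (h : 2 < t) : deriv cutoff t = 0 := by
  have : cutoff =ᶠ[𝓝 t] fun _ => 1 := by
    filter_upwards [lt_mem_nhds h] with s hs using cutoff_of_ge (le_of_lt hs)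
  rw [this.deriv_eq, deriv_const]

lemma hasCompactSupport_deriv_cutoff : HasCompactSupport (deriv cutoff) := by
  refine HasCompactSupport.intro (isCompact_Icc (a := (1 : ℝ)) (b := 2)) fun t ht => ?_
  rw [mem_Icc, not_and_or, not_le, not_le] at ht
  exact ht.elim deriv_cutoff_of_lt deriv_cutoff_of_gt

/-- This normalisation makes `ε⁻¹ * deriv cutoff (ε⁻¹ * t)` an approximate identity concentrating at
`t = 0`. -/
lemma integral_deriv_cutoff : ∫ t, deriv cutoff t = 1 := by
  have h1 : ∫ t in (0 : ℝ)..3, deriv cutoff t = ∫ t, deriv cutoff t := by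
    refine intervalIntegral.integral_eq_integral_of_support_subset fun t ht => ?_
    rw [Function.mem_support] at ht
    by_contra h
    rw [mem_Ioc, not_and_or, not_lt, not_le] at h
    rcases h with h | h
    · exact ht (deriv_cutoff_of_lt (by linarith))
    · exact ht (deriv_cutoff_of_gt (by linarith))
  rw [← h1, intervalIntegral.integral_deriv_eq_sub
    (fun t _ => contDiff_cutoff.differentiable one_ne_zero t)
    (continuous_deriv_cutoff.intervalIntegrable _ _), cutoff_of_ge (by norm_num),
    cutoff_of_le (by norm_num), sub_zero]

/-- Vector fields that are `C^1` in `Ω`, continuous on its closure and have integrable divergence: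
those to which the divergence theorem applies. -/
structure IsAdmissibleField (Ω : Set (EuclideanSpace ℝ (Fin n)))
    (X : EuclideanSpace ℝ (Fin n) → EuclideanSpace ℝ (Fin n)) : Prop where
  contDiffOn : ContDiffOn ℝ 1 X Ω
  continuousOn : ContinuousOn X (closure Ω)
  integrableOn : IntegrableOn (divergence X) Ω

/-! ### The divergence theorem for fields supported in one chart. -/

namespace GraphChart

variable {Ω : Set (EuclideanSpace ℝ (Fin n))} {c : EuclideanSpace ℝ (Fin n)} (T : GraphChart Ω c)

lemma norm_le_norm_ι_add_smul (y : EuclideanSpace ℝ (Fin (n - 1))) (t : ℝ) :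
    ‖y‖ ≤ ‖T.ι y + t • T.e‖ := by
  refine (sq_le_sq₀ (norm_nonneg _) (norm_nonneg _)).1 ?_
  rw [norm_add_sq_real, inner_smul_right, real_inner_comm, T.inner_e_ι, T.ι.norm_map]
  nlinarith [sq_nonneg ‖t • T.e‖]

/-- Integration in graph coordinates. -/
lemma integral_eq_integral_graph {f : EuclideanSpace ℝ (Fin n) → ℝ} (hf : Integrable f) {ε : ℝ}
    (hε : 0 < ε) : ∫ x, f x = ∫ y, ∫ s, ε * f (T.graph y + (ε * s) • T.e) := by
  have hemb : MeasurableEmbedding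
      fun p : EuclideanSpace ℝ (Fin (n - 1)) × ℝ => T.ι p.1 + p.2 • T.e := by
    refine Continuous.measurableEmbedding ?_ ?_
    · have := T.ι.continuous
      fun_prop
    · rintro ⟨y, t⟩ ⟨z, s⟩ h
      simp only at h
      have h1 : ⟪T.e, T.ι y + t • T.e⟫ = ⟪T.e, T.ι z + s • T.e⟫ := by rw [h]
      simp only [inner_add_right, inner_smul_right, T.inner_e_ι, T.inner_e_e] at h1
      have h2 : t = s := by linarith
      subst h2
      rw [T.ι.injective (add_right_cancel h)]
  have hint := (T.measurePreserving.integrable_comp_emb hemb).2 hf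
  rw [← T.measurePreserving.integral_comp hemb f, Measure.volume_eq_prod,
    integral_prod (fun p : EuclideanSpace ℝ (Fin (n - 1)) × ℝ => f (T.ι p.1 + p.2 • T.e)) hint]
  congr 1
  ext y
  simp only
  rw [integral_const_mul, Measure.integral_comp_mul_left
    (fun s => f (T.graph y + s • T.e)) ε, abs_of_pos (inv_pos.2 hε), smul_eq_mul, ← mul_assoc,
    mul_inv_cancel₀ hε.ne', one_mul, ← integral_add_right_eq_self _ (T.γ (T.ι y))]
  simp only [graph_add_smul]

variable {X : EuclideanSpace ℝ (Fin n) → EuclideanSpace ℝ (Fin n)}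
  {K : Set (EuclideanSpace ℝ (Fin n))}

/-- The field `X` cut off near the graph. -/
def cutoffField (X : EuclideanSpace ℝ (Fin n) → EuclideanSpace ℝ (Fin n)) (ε : ℝ) :
    EuclideanSpace ℝ (Fin n) → EuclideanSpace ℝ (Fin n) :=
  Ω.indicator fun x => cutoff (ε⁻¹ * T.height x) • X x

/-- A point of `K` outside the domain has height at most zero, and the cutoff already vanishes for
heights up to `ε`; off `K` the field itself vanishes. Hence extension by zero preserves C¹
regularity. -/
lemma cutoffField_eventuallyEq_zero (hK : IsCompact K)
    (hKB : K ⊆ Metric.ball c T.radius) (hXK : ∀ x ∉ K, X x = 0) {ε : ℝ} (hε : 0 < ε)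
    {x : EuclideanSpace ℝ (Fin n)} (hx : x ∉ Ω) : ∀ᶠ y in 𝓝 x, T.cutoffField X ε y = 0 := by
  classical
  by_cases hxK : x ∈ K
  · have h0 : T.height x < ε := by
      have h1 : ¬ 0 < T.height x := fun h => hx ((T.mem_iff (hKB hxK)).2 h)
      linarith
    filter_upwards [T.continuous_height.continuousAt.eventually (gt_mem_nhds h0)] with y hy
    rw [cutoffField, indicator_apply, cutoff_of_le, zero_smul, ite_self]
    rw [inv_mul_le_iff₀ hε]
    linarith
  · filter_upwards [hK.isClosed.isOpen_compl.mem_nhds hxK] with y hy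
    rw [cutoffField, indicator_apply, hXK y hy, smul_zero, ite_self]

lemma contDiff_cutoffField (hΩ : IsOpen Ω) (hX : ContDiffOn ℝ 1 X Ω) (hK : IsCompact K)
    (hKB : K ⊆ Metric.ball c T.radius) (hXK : ∀ x ∉ K, X x = 0) {ε : ℝ} (hε : 0 < ε) :
    ContDiff ℝ 1 (T.cutoffField X ε) := by
  refine contDiff_iff_contDiffAt.2 fun x => ?_
  by_cases hx : x ∈ Ω
  · have h1 : ContDiffAt ℝ 1 (fun x => cutoff (ε⁻¹ * T.height x) • X x) x :=
      ((contDiff_cutoff.comp (contDiff_const.mul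
        (T.contDiff_height.of_le (by simp)))).contDiffAt).smul (hX.contDiffAt (hΩ.mem_nhds hx))
    refine h1.congr_of_eventuallyEq ?_
    filter_upwards [hΩ.mem_nhds hx] with y hy
    rw [cutoffField, indicator_of_mem hy]
  · exact contDiffAt_const.congr_of_eventuallyEq
      (T.cutoffField_eventuallyEq_zero hK hKB hXK hε hx)

lemma divergence_cutoffField (hΩ : IsOpen Ω) (hX : ContDiffOn ℝ 1 X Ω) (ε : ℝ)
    {x : EuclideanSpace ℝ (Fin n)} (hx : x ∈ Ω) :
    divergence (T.cutoffField X ε) x = cutoff (ε⁻¹ * T.height x) * divergence X x +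
      ε⁻¹ * deriv cutoff (ε⁻¹ * T.height x) * ⟪∇ T.height x, X x⟫ := by
  have h1 : T.cutoffField X ε =ᶠ[𝓝 x] fun x => cutoff (ε⁻¹ * T.height x) • X x := by
    filter_upwards [hΩ.mem_nhds hx] with y hy
    rw [cutoffField, indicator_of_mem hy]
  have hd : HasFDerivAt T.height (fderiv ℝ T.height x) x :=
    (T.contDiff_height.differentiable (by simp) x).hasFDerivAt
  have h2 : HasFDerivAt (fun x => cutoff (ε⁻¹ * T.height x))
      (deriv cutoff (ε⁻¹ * T.height x) • (ε⁻¹ • fderiv ℝ T.height x)) x :=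
    ((contDiff_cutoff.differentiable one_ne_zero _).hasDerivAt).comp_hasFDerivAt x
      (hd.const_mul ε⁻¹)
  rw [divergence_congr h1, divergence_smul h2.differentiableAt
    ((hX.contDiffAt (hΩ.mem_nhds hx)).differentiableAt one_ne_zero), inner_gradient_eq_fderiv,
    inner_gradient_eq_fderiv, h2.fderiv]
  simp
  ring

/-- The cut-off field is C¹ with compact support, so its divergence has integral zero. The product
rule splits that divergence into the two terms compared here. -/
lemma setIntegral_cutoff_mul_divergence (hΩ : IsOpen Ω) (hX : IsAdmissibleField Ω X)
    (hK : IsCompact K) (hKB : K ⊆ Metric.ball c T.radius) (hXK : ∀ x ∉ K, X x = 0)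
    {ε : ℝ} (hε : 0 < ε) :
    Integrable (Ω.indicator fun x =>
      ε⁻¹ * deriv cutoff (ε⁻¹ * T.height x) * ⟪∇ T.height x, X x⟫) ∧
    ∫ x in Ω, cutoff (ε⁻¹ * T.height x) * divergence X x =
      -∫ x, Ω.indicator (fun x =>
        ε⁻¹ * deriv cutoff (ε⁻¹ * T.height x) * ⟪∇ T.height x, X x⟫) x := by
  classical
  have hcs : HasCompactSupport (T.cutoffField X ε) :=
    HasCompactSupport.intro hK fun x hx => by
      rw [cutoffField, indicator_apply, hXK x hx, smul_zero, ite_self]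
  obtain ⟨hint, hzero⟩ :=
    integral_divergence_eq_zero (T.contDiff_cutoffField hΩ hX.contDiffOn hK hKB hXK hε) hcs
  have hm := hΩ.measurableSet
  have hi1 : IntegrableOn (fun x => cutoff (ε⁻¹ * T.height x) * divergence X x) Ω := by
    refine Integrable.bdd_mul hX.integrableOn ?_ (ae_of_all _ fun x => norm_cutoff_le _)
    exact (contDiff_cutoff.continuous.comp
      (continuous_const.mul T.continuous_height)).aestronglyMeasurable
  have hcongr : ∀ x ∈ Ω, ε⁻¹ * deriv cutoff (ε⁻¹ * T.height x) * ⟪∇ T.height x, X x⟫ =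
      divergence (T.cutoffField X ε) x - cutoff (ε⁻¹ * T.height x) * divergence X x :=
    fun x hx => by rw [T.divergence_cutoffField hΩ hX.contDiffOn ε hx]; ring
  have hi2 : IntegrableOn (fun x => ε⁻¹ * deriv cutoff (ε⁻¹ * T.height x) *
      ⟪∇ T.height x, X x⟫) Ω :=
    (hint.integrableOn.sub hi1).congr_fun (fun x hx => (hcongr x hx).symm) hm
  refine ⟨(integrable_indicator_iff hm).2 hi2, ?_⟩
  rw [integral_indicator hm, setIntegral_congr_fun hm hcongr,
    integral_sub hint.integrableOn hi1, setIntegral_eq_integral_of_forall_compl_eq_zero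
      fun x hx => divergence_eq_zero (T.cutoffField_eventuallyEq_zero hK hKB hXK hε hx), hzero]
  ring

lemma tendsto_setIntegral_cutoff (hΩ : IsOpen Ω) (hX : IsAdmissibleField Ω X)
    (hK : IsCompact K) (hKB : K ⊆ Metric.ball c T.radius) (hXK : ∀ x ∉ K, X x = 0) :
    Tendsto (fun ε => ∫ x in Ω, cutoff (ε⁻¹ * T.height x) * divergence X x) (𝓝[>] 0)
      (𝓝 (∫ x in Ω, divergence X x)) := by
  refine tendsto_integral_filter_of_dominated_convergence (fun x => ‖divergence X x‖)
    (.of_forall fun ε => ?_) (.of_forall fun ε => ae_of_all _ fun x => ?_)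
    hX.integrableOn.norm ?_
  · exact (contDiff_cutoff.continuous.comp
      (continuous_const.mul T.continuous_height)).aestronglyMeasurable.mul
        hX.integrableOn.aestronglyMeasurable
  · rw [norm_mul]
    exact mul_le_of_le_one_left (norm_nonneg _) (norm_cutoff_le _)
  · filter_upwards [ae_restrict_mem hΩ.measurableSet] with x hx
    by_cases hxK : x ∈ K
    · have hpos := (T.mem_iff (hKB hxK)).1 hx
      refine tendsto_const_nhds.congr' ?_
      filter_upwards [Ioo_mem_nhdsGT (half_pos hpos)] with ε hε
      rw [cutoff_of_ge, one_mul]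
      rw [le_inv_mul_iff₀ hε.1]
      linarith [hε.2]
    · have : divergence X x = 0 := divergence_eq_zero (by
        filter_upwards [hK.isClosed.isOpen_compl.mem_nhds hxK] with y hy using hXK y hy)
      simp [this]

lemma tendsto_indicator_graph (hΩ : IsOpen Ω) (hX : ContinuousOn X (closure Ω))
    (hK : IsCompact K) (hKB : K ⊆ Metric.ball c T.radius) (hXK : ∀ x ∉ K, X x = 0)
    (y : EuclideanSpace ℝ (Fin (n - 1))) {s : ℝ} (hs : 0 < s) :
    Tendsto (fun ε => Ω.indicator (fun x => ⟪∇ T.height x, X x⟫) (T.graph y + (ε * s) • T.e))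
      (𝓝[>] 0) (𝓝 ⟪∇ T.height (T.graph y), X (T.graph y)⟫) := by
  classical
  have hline : Tendsto (fun ε : ℝ => T.graph y + (ε * s) • T.e) (𝓝[>] 0) (𝓝 (T.graph y)) := by
    have : Continuous fun ε : ℝ => T.graph y + (ε * s) • T.e := by fun_prop
    simpa using (this.tendsto 0).mono_left (nhdsWithin_le_nhds (s := Ioi 0))
  by_cases hy : T.graph y ∈ K
  · have hyB := hKB hy
    have hyΩ : T.graph y ∈ closure Ω :=
      frontier_subset_closure (T.graph_mem_frontier hΩ hyB)
    have hmem : ∀ᶠ ε in 𝓝[>] (0 : ℝ), T.graph y + (ε * s) • T.e ∈ Ω := by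
      filter_upwards [self_mem_nhdsWithin, hline (Metric.isOpen_ball.mem_nhds hyB)] with ε hε hεB
      exact T.add_smul_mem hyB hyΩ (mul_pos hε hs) hεB
    have hcont : ContinuousWithinAt (fun x => ⟪∇ T.height x, X x⟫) (closure Ω) (T.graph y) :=
      T.continuous_gradient_height.continuousWithinAt.inner (hX _ hyΩ)
    refine (hcont.tendsto.comp (tendsto_nhdsWithin_iff.2
      ⟨hline, hmem.mono fun ε h => subset_closure h⟩)).congr' ?_
    filter_upwards [hmem] with ε hε
    rw [indicator_of_mem hε]
    rfl
  · rw [hXK _ hy, inner_zero_right]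
    refine tendsto_const_nhds.congr' ?_
    filter_upwards [hline (hK.isClosed.isOpen_compl.mem_nhds hy)] with ε hε
    rw [indicator_apply, hXK _ hε, inner_zero_right, ite_self]

lemma exists_bound_indicator (hX : ContinuousOn X (closure Ω)) (hK : IsCompact K)
    (hXK : ∀ x ∉ K, X x = 0) :
    ∃ M, 0 ≤ M ∧ ∀ x, ‖Ω.indicator (fun x => ⟪∇ T.height x, X x⟫) x‖ ≤ K.indicator (fun _ => M) x := by
  classical
  obtain ⟨M, hM⟩ := (hK.inter_right isClosed_closure).exists_bound_of_continuousOn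
    (f := fun x => ⟪∇ T.height x, X x⟫) (s := K ∩ closure Ω)
    (T.continuous_gradient_height.continuousOn.inner (hX.mono inter_subset_right))
  refine ⟨max M 0, le_max_right _ _, fun x => ?_⟩
  by_cases hxK : x ∈ K
  · rw [indicator_of_mem hxK]
    by_cases hx : x ∈ Ω
    · rw [indicator_of_mem hx]
      exact (hM x ⟨hxK, subset_closure hx⟩).trans (le_max_left _ _)
    · rw [indicator_of_notMem hx, norm_zero]
      exact le_max_right _ _
  · rw [indicator_of_notMem hxK, indicator_apply, hXK x hxK, inner_zero_right, ite_self, norm_zero]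

/-- In graph coordinates with height `ε * s`, the Jacobian `ε` cancels `ε⁻¹`. What remains is `deriv
cutoff s` times the integrand at height `ε * s`, which tends to its boundary value; the `s`-integral
contributes `1`. -/
lemma tendsto_integral_deriv_cutoff (hΩ : IsOpen Ω) (hX : IsAdmissibleField Ω X)
    (hK : IsCompact K) (hKB : K ⊆ Metric.ball c T.radius) (hXK : ∀ x ∉ K, X x = 0) :
    Tendsto (fun ε => ∫ x, Ω.indicator (fun x =>
        ε⁻¹ * deriv cutoff (ε⁻¹ * T.height x) * ⟪∇ T.height x, X x⟫) x) (𝓝[>] 0)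
      (𝓝 (∫ y, ⟪∇ T.height (T.graph y), X (T.graph y)⟫)) := by
  classical
  set q : EuclideanSpace ℝ (Fin n) → ℝ := Ω.indicator fun x => ⟪∇ T.height x, X x⟫ with hq
  obtain ⟨M, hM0, hM⟩ := T.exists_bound_indicator hX.continuousOn hK hXK
  obtain ⟨R, hR⟩ := (Metric.isBounded_iff_subset_closedBall 0).1 hK.isBounded
  have hqm : Measurable q := by
    have h1 : ContinuousOn (fun x => ⟪∇ T.height x, X x⟫) Ω :=
      T.continuous_gradient_height.continuousOn.inner (hX.continuousOn.mono subset_closure)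
    rw [hq, ← piecewise_eq_indicator]
    exact ContinuousOn.measurable_piecewise h1 continuousOn_const hΩ.measurableSet
  have hmeas : ∀ ε : ℝ, Measurable fun p : EuclideanSpace ℝ (Fin (n - 1)) × ℝ =>
      deriv cutoff p.2 * q (T.graph p.1 + (ε * p.2) • T.e) := fun ε => by
    have hg := T.contDiff_graph.continuous
    refine (continuous_deriv_cutoff.comp continuous_snd).measurable.mul (hqm.comp ?_)
    exact Continuous.measurable (by fun_prop)
  -- An `ε`-independent majorant: the parameters of points of `K` stay in the ball of radius `R`,
  -- and `deriv cutoff` has compact support.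
  set bound : EuclideanSpace ℝ (Fin (n - 1)) × ℝ → ℝ := fun p =>
    (Metric.closedBall (0 : EuclideanSpace ℝ (Fin (n - 1))) R).indicator (fun _ => M) p.1 *
      ‖deriv cutoff p.2‖ with hbound
  have hbi : Integrable bound (volume.prod volume) := by
    refine Integrable.mul_prod (f := (Metric.closedBall
      (0 : EuclideanSpace ℝ (Fin (n - 1))) R).indicator fun _ => M)
      (g := fun t => ‖deriv cutoff t‖) ?_ ?_
    · exact (integrable_indicator_iff Metric.isClosed_closedBall.measurableSet).2
        (integrableOn_const (isCompact_closedBall _ _).measure_lt_top.ne)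
    · exact (continuous_deriv_cutoff.integrable_of_hasCompactSupport
        hasCompactSupport_deriv_cutoff).norm
  have hle : ∀ ε : ℝ, ∀ p : EuclideanSpace ℝ (Fin (n - 1)) × ℝ,
      ‖deriv cutoff p.2 * q (T.graph p.1 + (ε * p.2) • T.e)‖ ≤ bound p := fun ε p => by
    rw [norm_mul, mul_comm]
    refine mul_le_mul_of_nonneg_right ((hM _).trans ?_) (norm_nonneg _)
    by_cases hp : T.graph p.1 + (ε * p.2) • T.e ∈ K
    · have : p.1 ∈ Metric.closedBall (0 : EuclideanSpace ℝ (Fin (n - 1))) R := by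
        rw [mem_closedBall_zero_iff]
        refine le_trans ?_ (mem_closedBall_zero_iff.1 (hR hp))
        rw [graph_add_smul]
        exact T.norm_le_norm_ι_add_smul _ _
      rw [indicator_of_mem hp, indicator_of_mem this]
    · rw [indicator_of_notMem hp]
      exact indicator_nonneg (fun _ _ => hM0) _
  have hlim : Tendsto (fun ε : ℝ => ∫ p : EuclideanSpace ℝ (Fin (n - 1)) × ℝ,
        deriv cutoff p.2 * q (T.graph p.1 + (ε * p.2) • T.e) ∂(volume.prod volume)) (𝓝[>] 0)
      (𝓝 (∫ p : EuclideanSpace ℝ (Fin (n - 1)) × ℝ,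
        ⟪∇ T.height (T.graph p.1), X (T.graph p.1)⟫ * deriv cutoff p.2
          ∂(volume.prod volume))) := by
    refine tendsto_integral_filter_of_dominated_convergence bound
      (.of_forall fun ε => (hmeas ε).aestronglyMeasurable)
      (.of_forall fun ε => ae_of_all _ (hle ε)) hbi (ae_of_all _ fun p => ?_)
    -- For `s < 1` the factor `deriv cutoff s` is zero, so boundary values are approached only from
    -- inside the domain.
    rcases lt_or_ge p.2 1 with h | h
    · simp [deriv_cutoff_of_lt h]
    · rw [mul_comm]
      exact (T.tendsto_indicator_graph hΩ hX.continuousOn hK hKB hXK p.1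
        (by linarith)).const_mul _
  rw [integral_prod_mul (fun y => ⟪∇ T.height (T.graph y), X (T.graph y)⟫) (deriv cutoff),
    integral_deriv_cutoff, mul_one] at hlim
  refine hlim.congr' ?_
  filter_upwards [self_mem_nhdsWithin] with ε hε
  have hε' : 0 < ε := hε
  rw [T.integral_eq_integral_graph
    (T.setIntegral_cutoff_mul_divergence hΩ hX hK hKB hXK hε').1 hε', integral_prod]
  · congr 1
    ext y
    congr 1
    ext s
    rw [hq, indicator_apply, indicator_apply, height_graph_add_smul,
      inv_mul_cancel_left₀ hε'.ne']
    split_ifs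
    · field_simp
    · simp
  · exact hbi.mono' (hmeas ε).aestronglyMeasurable (ae_of_all _ (hle ε))

/-- Both sides of the cutoff identity are evaluated as `ε → 0`. The surface density `‖∇ height‖`
cancels the normalisation of the outward normal. -/
lemma integral_divergence (hΩ : IsOpen Ω) (hX : IsAdmissibleField Ω X)
    (hK : IsCompact K) (hKB : K ⊆ Metric.ball c T.radius) (hXK : ∀ x ∉ K, X x = 0) :
    ∫ x in Ω, divergence X x = ∫ x, ⟪X x, outwardNormal Ω x⟫ ∂surfaceMeasure Ω := by
  have h1 := T.tendsto_setIntegral_cutoff hΩ hX hK hKB hXK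
  have h2 := (T.tendsto_integral_deriv_cutoff hΩ hX hK hKB hXK).neg
  have h3 : ∫ x in Ω, divergence X x = -∫ y, ⟪∇ T.height (T.graph y), X (T.graph y)⟫ := by
    refine tendsto_nhds_unique h1 (h2.congr' ?_)
    filter_upwards [self_mem_nhdsWithin] with ε hε
    exact (T.setIntegral_cutoff_mul_divergence hΩ hX hK hKB hXK hε).2.symm
  rw [h3, T.integral_surfaceMeasure hΩ fun x hx => by
    rw [hXK x fun h => hx (hKB h), inner_zero_left], ← integral_neg]
  congr 1
  ext y
  by_cases hy : T.graph y ∈ K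
  · rw [T.outwardNormal_eq hΩ (hKB hy) (T.graph_mem_frontier hΩ (hKB hy)), inner_neg_right,
      inner_smul_right, real_inner_comm]
    have := (T.norm_gradient_height_pos (T.graph y)).ne'
    field_simp
  · simp [hXK _ hy]

end GraphChart

/-! ### Functions that are C¹ up to the boundary. -/

section ClosureC1

variable {Ω : Set (EuclideanSpace ℝ (Fin n))} {u v : EuclideanSpace ℝ (Fin n) → ℝ}

lemma continuousAt_gradient {x : EuclideanSpace ℝ (Fin n)} (hu : ContDiffAt ℝ 1 u x) :
    ContinuousAt (∇ u) x :=
  (InnerProductSpace.toDual ℝ _).symm.continuous.continuousAt.comp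
    (hu.fderiv_right (m := 0) (by norm_num)).continuousAt

lemma continuousOn_gradient (hΩ : IsOpen Ω) (hu : ContDiffOn ℝ 1 u Ω) : ContinuousOn (∇ u) Ω :=
  fun _ hx => (continuousAt_gradient (hu.contDiffAt (hΩ.mem_nhds hx))).continuousWithinAt

lemma gradBar_eq_gradient (hΩ : IsOpen Ω) (hu : ContDiffOn ℝ 1 u Ω) {x : EuclideanSpace ℝ (Fin n)}
    (hx : x ∈ Ω) : gradBar Ω u x = ∇ u x :=
  extendFrom_eq (subset_closure hx) (continuousOn_gradient hΩ hu x hx)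

lemma IsC1Closure.gradBar_eqOn (hΩ : IsOpen Ω) (hu : IsC1Closure Ω u) :
    EqOn (gradBar Ω u) (∇ u) Ω := fun _ hx => gradBar_eq_gradient hΩ hu.contDiffOn hx

/-- Any continuous extension `G` of the gradient must coincide with `gradBar` on the closure, so
regularity can be checked on a convenient `G`. -/
lemma isC1Closure_of_eqOn {G : EuclideanSpace ℝ (Fin n) → EuclideanSpace ℝ (Fin n)}
    (hu : ContDiffOn ℝ 1 u Ω) (hc : ContinuousOn u (closure Ω)) (hG : ContinuousOn G (closure Ω))
    (h : EqOn G (∇ u) Ω) : IsC1Closure Ω u := by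
  refine ⟨hu, hc, hG.congr fun x hx => extendFrom_eq hx ?_⟩
  exact ((hG x hx).mono subset_closure).tendsto.congr' (h.eventuallyEq_of_mem self_mem_nhdsWithin)

lemma isC1Closure_of_contDiffAt (h : ∀ x ∈ closure Ω, ContDiffAt ℝ 1 u x) : IsC1Closure Ω u :=
  isC1Closure_of_eqOn (fun x hx => (h x (subset_closure hx)).contDiffWithinAt)
    (fun x hx => (h x hx).continuousAt.continuousWithinAt)
    (fun x hx => (continuousAt_gradient (h x hx)).continuousWithinAt) fun _ _ => rfl

lemma differentiableAt_of_contDiffOn (hΩ : IsOpen Ω) (hu : ContDiffOn ℝ 1 u Ω)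
    {x : EuclideanSpace ℝ (Fin n)} (hx : x ∈ Ω) : DifferentiableAt ℝ u x :=
  (hu.contDiffAt (hΩ.mem_nhds hx)).differentiableAt one_ne_zero

lemma gradient_add {x : EuclideanSpace ℝ (Fin n)} (hu : DifferentiableAt ℝ u x)
    (hv : DifferentiableAt ℝ v x) : ∇ (fun y => u y + v y) x = ∇ u x + ∇ v x := by
  simp only [gradient]
  rw [fderiv_fun_add hu hv, map_add]

lemma gradient_sub {x : EuclideanSpace ℝ (Fin n)} (hu : DifferentiableAt ℝ u x)
    (hv : DifferentiableAt ℝ v x) : ∇ (fun y => u y - v y) x = ∇ u x - ∇ v x := by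
  simp only [gradient]
  rw [fderiv_fun_sub hu hv, map_sub]

lemma gradient_mul {x : EuclideanSpace ℝ (Fin n)} (hu : DifferentiableAt ℝ u x)
    (hv : DifferentiableAt ℝ v x) : ∇ (fun y => u y * v y) x = u x • ∇ v x + v x • ∇ u x := by
  simp only [gradient]
  rw [fderiv_fun_mul hu hv, map_add, map_smulₛₗ, map_smulₛₗ]
  simp

lemma IsC1Closure.add (hΩ : IsOpen Ω) (hu : IsC1Closure Ω u) (hv : IsC1Closure Ω v) :
    IsC1Closure Ω fun x => u x + v x :=
  isC1Closure_of_eqOn (hu.contDiffOn.add hv.contDiffOn) (hu.continuousOn.add hv.continuousOn)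
    (hu.continuousOn_grad.add hv.continuousOn_grad) fun x hx => by
      change _ = ∇ (fun y => u y + v y) x
      rw [gradient_add (differentiableAt_of_contDiffOn hΩ hu.contDiffOn hx)
        (differentiableAt_of_contDiffOn hΩ hv.contDiffOn hx), ← hu.gradBar_eqOn hΩ hx,
        ← hv.gradBar_eqOn hΩ hx]
      rfl

lemma IsC1Closure.sub (hΩ : IsOpen Ω) (hu : IsC1Closure Ω u) (hv : IsC1Closure Ω v) :
    IsC1Closure Ω fun x => u x - v x :=
  isC1Closure_of_eqOn (hu.contDiffOn.sub hv.contDiffOn) (hu.continuousOn.sub hv.continuousOn)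
    (hu.continuousOn_grad.sub hv.continuousOn_grad) fun x hx => by
      change _ = ∇ (fun y => u y - v y) x
      rw [gradient_sub (differentiableAt_of_contDiffOn hΩ hu.contDiffOn hx)
        (differentiableAt_of_contDiffOn hΩ hv.contDiffOn hx), ← hu.gradBar_eqOn hΩ hx,
        ← hv.gradBar_eqOn hΩ hx]
      rfl

end ClosureC1

/-! ### The global divergence theorem, the trace inequality and the Poincaré inequality. -/

namespace IsSmoothBoundedDomain

variable {Ω : Set (EuclideanSpace ℝ (Fin n))} (hΩ : IsSmoothBoundedDomain Ω)
include hΩ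

lemma memLp_of_continuousOn {F : Type*} [NormedAddCommGroup F]
    {f : EuclideanSpace ℝ (Fin n) → F} (hf : ContinuousOn f (closure Ω)) (p : ℝ≥0∞) :
    MemLp f p (volume.restrict Ω) := by
  have := hΩ.isFiniteMeasure_volume_restrict
  obtain ⟨M, hM⟩ := hΩ.isCompact_closure.exists_bound_of_continuousOn hf
  refine MemLp.of_bound ?_ M ?_
  · exact (hf.mono subset_closure).aestronglyMeasurable hΩ.isOpen.measurableSet
  · filter_upwards [ae_restrict_mem hΩ.isOpen.measurableSet] with x hx using hM x (subset_closure hx)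

lemma integrableOn_of_continuousOn {F : Type*} [NormedAddCommGroup F]
    {f : EuclideanSpace ℝ (Fin n) → F} (hf : ContinuousOn f (closure Ω)) : IntegrableOn f Ω :=
  memLp_one_iff_integrable.1 (hΩ.memLp_of_continuousOn hf 1)

lemma memLp_gradient {u : EuclideanSpace ℝ (Fin n) → ℝ} (hu : IsC1Closure Ω u) (p : ℝ≥0∞) :
    MemLp (∇ u) p (volume.restrict Ω) := by
  refine (memLp_congr_ae ?_).1 (hΩ.memLp_of_continuousOn hu.continuousOn_grad p)
  filter_upwards [ae_restrict_mem hΩ.isOpen.measurableSet] with x hx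
    using hu.gradBar_eqOn hΩ.isOpen hx

lemma memLp_surfaceMeasure {F : Type*} [NormedAddCommGroup F]
    {f : EuclideanSpace ℝ (Fin n) → F} (hf : ContinuousOn f (frontier Ω)) (p : ℝ≥0∞) :
    MemLp f p (surfaceMeasure Ω) := by
  have := hΩ.isFiniteMeasure_surfaceMeasure
  obtain ⟨M, hM⟩ := hΩ.isCompact_frontier.exists_bound_of_continuousOn hf
  refine MemLp.of_bound (hΩ.integrable_surfaceMeasure hf).aestronglyMeasurable M ?_
  filter_upwards [ae_restrict_mem isClosed_frontier.measurableSet] with x hx using hM x hx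

lemma divergence_smul_eq {φ : EuclideanSpace ℝ (Fin n) → ℝ} (hφ : IsC1Closure Ω φ)
    {X : EuclideanSpace ℝ (Fin n) → EuclideanSpace ℝ (Fin n)} (hX : IsAdmissibleField Ω X)
    {x : EuclideanSpace ℝ (Fin n)} (hx : x ∈ Ω) :
    divergence (fun y => φ y • X y) x = φ x * divergence X x + ⟪∇ φ x, X x⟫ :=
  divergence_smul (differentiableAt_of_contDiffOn hΩ.isOpen hφ.contDiffOn hx)
    ((hX.contDiffOn.contDiffAt (hΩ.isOpen.mem_nhds hx)).differentiableAt one_ne_zero)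

lemma isAdmissibleField_smul {φ : EuclideanSpace ℝ (Fin n) → ℝ} (hφ : IsC1Closure Ω φ)
    {X : EuclideanSpace ℝ (Fin n) → EuclideanSpace ℝ (Fin n)} (hX : IsAdmissibleField Ω X) :
    IsAdmissibleField Ω fun x => φ x • X x := by
  refine ⟨hφ.contDiffOn.smul hX.contDiffOn, hφ.continuousOn.smul hX.continuousOn, ?_⟩
  have h1 : IntegrableOn (fun x => φ x * divergence X x) Ω := by
    obtain ⟨M, hM⟩ := hΩ.isCompact_closure.exists_bound_of_continuousOn hφ.continuousOn
    refine Integrable.bdd_mul hX.integrableOn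
      (hΩ.memLp_of_continuousOn hφ.continuousOn 1).aestronglyMeasurable (c := M) ?_
    filter_upwards [ae_restrict_mem hΩ.isOpen.measurableSet] with x hx
      using hM x (subset_closure hx)
  have h2 : IntegrableOn (fun x => ⟪gradBar Ω φ x, X x⟫) Ω :=
    hΩ.integrableOn_of_continuousOn (hφ.continuousOn_grad.inner hX.continuousOn)
  refine (h1.add h2).congr_fun (fun x hx => ?_) hΩ.isOpen.measurableSet
  rw [hΩ.divergence_smul_eq hφ hX hx, ← hφ.gradBar_eqOn hΩ.isOpen hx]
  rfl

lemma isAdmissibleField_of_contDiff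
    {X : EuclideanSpace ℝ (Fin n) → EuclideanSpace ℝ (Fin n)} (hX : ContDiff ℝ 1 X) :
    IsAdmissibleField Ω X :=
  ⟨hX.contDiffOn, hX.continuous.continuousOn, hΩ.integrableOn_of_continuousOn
    fun _ _ => (continuousAt_divergence hX.contDiffAt).continuousWithinAt⟩

/-- The divergence theorem. -/
theorem integral_divergence {X : EuclideanSpace ℝ (Fin n) → EuclideanSpace ℝ (Fin n)}
    (hX : IsAdmissibleField Ω X) :
    ∫ x in Ω, divergence X x = ∫ x, ⟪X x, outwardNormal Ω x⟫ ∂surfaceMeasure Ω := by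
  -- It suffices to treat fields supported near one point of the closure; a partition of unity then
  -- sums the local identities.
  have hlocal : ∀ c ∈ closure Ω, ∃ U ∈ 𝓝 c, ∀ K ⊆ U, IsCompact K →
      ∀ Y, IsAdmissibleField Ω Y → (∀ x ∉ K, Y x = 0) →
        ∫ x in Ω, divergence Y x = ∫ x, ⟪Y x, outwardNormal Ω x⟫ ∂surfaceMeasure Ω := by
    intro c hc
    by_cases hcΩ : c ∈ Ω
    -- Away from the boundary both sides are zero: the field extends by zero to a compactly
    -- supported C¹ field and vanishes on the frontier.
    · refine ⟨Ω, hΩ.isOpen.mem_nhds hcΩ, fun K hKΩ hK Y hY hYK => ?_⟩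
      have hYc : ∀ x ∉ Ω, ∀ᶠ y in 𝓝 x, Y y = 0 := fun x hx => by
        filter_upwards [hK.isClosed.isOpen_compl.mem_nhds fun h => hx (hKΩ h)] with y hy
          using hYK y hy
      have hYd : ContDiff ℝ 1 Y := contDiff_iff_contDiffAt.2 fun x => by
        by_cases hx : x ∈ Ω
        · exact hY.contDiffOn.contDiffAt (hΩ.isOpen.mem_nhds hx)
        · exact contDiffAt_const.congr_of_eventuallyEq (hYc x hx)
      rw [setIntegral_eq_integral_of_forall_compl_eq_zero fun x hx => divergence_eq_zero (hYc x hx),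
        (integral_divergence_eq_zero hYd (HasCompactSupport.intro hK hYK)).2, surfaceMeasure,
        setIntegral_eq_zero_of_forall_eq_zero]
      intro x hx
      rw [hYK x fun h => ?_, inner_zero_left]
      rw [hΩ.isOpen.frontier_eq] at hx
      exact hx.2 (hKΩ h)
    · have hcf : c ∈ frontier Ω := by rw [hΩ.isOpen.frontier_eq]; exact ⟨hc, hcΩ⟩
      obtain ⟨T⟩ := hΩ.smoothBoundary.nonempty_graphChart hcf
      exact ⟨_, Metric.ball_mem_nhds c T.radius_pos, fun K hKB hK Y hY hYK =>
        T.integral_divergence hΩ.isOpen hY hK hKB hYK⟩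
  choose! U hU hint using hlocal
  obtain ⟨t, ζ, htΩ, hsm, hcs, hsub, -, hsum⟩ := exists_smooth_partition hΩ.isCompact_closure U hU
  have hadm : ∀ c ∈ t, IsAdmissibleField Ω fun x => ζ c x • X x := fun c hc =>
    hΩ.isAdmissibleField_smul (isC1Closure_of_contDiffAt fun x _ =>
      ((hsm c hc).of_le (by simp)).contDiffAt) hX
  have hXsum : ∀ x ∈ closure Ω, X x = ∑ c ∈ t, ζ c x • X x := fun x hx => by
    rw [← Finset.sum_smul, hsum x hx, one_smul]
  have h1 : ∫ x in Ω, divergence X x = ∑ c ∈ t, ∫ x in Ω, divergence (fun y => ζ c y • X y) x := by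
    rw [← integral_finsetSum _ fun c hc => (hadm c hc).integrableOn]
    refine setIntegral_congr_fun hΩ.isOpen.measurableSet fun x hx => ?_
    rw [← divergence_sum fun c hc =>
      (((hadm c hc).contDiffOn.contDiffAt (hΩ.isOpen.mem_nhds hx)).differentiableAt one_ne_zero)]
    refine divergence_congr ?_
    filter_upwards [hΩ.isOpen.mem_nhds hx] with y hy using hXsum y (subset_closure hy)
  have h2 : ∫ x, ⟪X x, outwardNormal Ω x⟫ ∂surfaceMeasure Ω =
      ∑ c ∈ t, ∫ x, ⟪ζ c x • X x, outwardNormal Ω x⟫ ∂surfaceMeasure Ω := by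
    rw [← integral_finsetSum _ fun c hc => hΩ.integrable_surfaceMeasure
      (((hadm c hc).continuousOn.mono frontier_subset_closure).inner hΩ.continuousOn_outwardNormal)]
    refine setIntegral_congr_fun isClosed_frontier.measurableSet fun x hx => ?_
    rw [← sum_inner, ← hXsum x (frontier_subset_closure hx)]
  rw [h1, h2]
  refine Finset.sum_congr rfl fun c hc => ?_
  exact hint c (htΩ c hc) _ (hsub c hc) (hcs c hc) _ (hadm c hc) fun x hx => by
    rw [image_eq_zero_of_notMem_tsupport hx, zero_smul]

lemma integral_smul_divergence {φ : EuclideanSpace ℝ (Fin n) → ℝ} (hφ : IsC1Closure Ω φ)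
    {X : EuclideanSpace ℝ (Fin n) → EuclideanSpace ℝ (Fin n)} (hX : IsAdmissibleField Ω X) :
    ∫ x in Ω, (φ x * divergence X x + ⟪∇ φ x, X x⟫) =
      ∫ x, φ x * ⟪X x, outwardNormal Ω x⟫ ∂surfaceMeasure Ω := by
  have h := hΩ.integral_divergence (hΩ.isAdmissibleField_smul hφ hX)
  rw [setIntegral_congr_fun hΩ.isOpen.measurableSet
    fun x hx => hΩ.divergence_smul_eq hφ hX hx] at h
  rw [h]
  simp [inner_smul_left]

lemma integral_sq_smul_divergence {φ : EuclideanSpace ℝ (Fin n) → ℝ} (hφ : IsC1Closure Ω φ)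
    {X : EuclideanSpace ℝ (Fin n) → EuclideanSpace ℝ (Fin n)} (hX : IsAdmissibleField Ω X) :
    ∫ x in Ω, (φ x ^ 2 * divergence X x + 2 * φ x * ⟪∇ φ x, X x⟫) =
      ∫ x, φ x ^ 2 * ⟪X x, outwardNormal Ω x⟫ ∂surfaceMeasure Ω := by
  have h := hΩ.integral_smul_divergence hφ (hΩ.isAdmissibleField_smul hφ hX)
  have h1 : ∀ x ∈ Ω, φ x * divergence (fun y => φ y • X y) x + ⟪∇ φ x, φ x • X x⟫ =
      φ x ^ 2 * divergence X x + 2 * φ x * ⟪∇ φ x, X x⟫ := fun x hx => by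
    rw [hΩ.divergence_smul_eq hφ hX hx, inner_smul_right]; ring
  rw [setIntegral_congr_fun hΩ.isOpen.measurableSet h1] at h
  rw [h]
  congr 1
  ext x
  rw [inner_smul_left]
  simp
  ring

/-- A smooth field pointing strictly outward along the boundary. -/
lemma exists_outward_field : ∃ X : EuclideanSpace ℝ (Fin n) → EuclideanSpace ℝ (Fin n),
    ContDiff ℝ 1 X ∧ ∃ a > 0, ∀ x ∈ frontier Ω, a ≤ ⟪X x, outwardNormal Ω x⟫ := by
  have hloc : ∀ c ∈ frontier Ω, ∃ (r : ℝ) (e : EuclideanSpace ℝ (Fin n)), 0 < r ∧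
      ∀ x ∈ Metric.ball c r, x ∈ frontier Ω → ⟪e, outwardNormal Ω x⟫ < 0 := fun c hc => by
    obtain ⟨T⟩ := hΩ.smoothBoundary.nonempty_graphChart hc
    exact ⟨T.radius, T.e, T.radius_pos, fun x hx hxΩ => T.inner_outwardNormal_neg hΩ.isOpen hx hxΩ⟩
  choose! r e hr he using hloc
  obtain ⟨t, ζ, htΩ, hsm, hcs, hsub, hnonneg, hsum⟩ := exists_smooth_partition
    hΩ.isCompact_frontier (fun c => Metric.ball c (r c)) fun c hc => Metric.ball_mem_nhds c (hr c hc)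
  -- Each `-(e c)` has positive inner product with the outward normal throughout its chart, and this
  -- survives averaging with nonnegative weights.
  set X : EuclideanSpace ℝ (Fin n) → EuclideanSpace ℝ (Fin n) := fun x => ∑ c ∈ t, ζ c x • -(e c)
    with hX
  have hXd : ContDiff ℝ 1 X := ContDiff.sum fun c hc =>
    ((hsm c hc).of_le (by simp)).smul contDiff_const
  refine ⟨X, hXd, ?_⟩
  have hpos : ∀ x ∈ frontier Ω, 0 < ⟪X x, outwardNormal Ω x⟫ := fun x hx => by
    have hterm : ∀ c ∈ t, 0 < ζ c x → 0 < ⟪ζ c x • -(e c), outwardNormal Ω x⟫ := by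
      intro c hc hpos
      have hxc : x ∈ Metric.ball c (r c) := hsub c hc (subset_tsupport _ hpos.ne')
      rw [real_inner_smul_left, inner_neg_left]
      exact mul_pos hpos (neg_pos.2 (he c (htΩ c hc) x hxc hx))
    have hnn : ∀ c ∈ t, 0 ≤ ⟪ζ c x • -(e c), outwardNormal Ω x⟫ := fun c hc => by
      rcases (hnonneg c hc x).eq_or_lt with h | h
      · simp [← h]
      · exact (hterm c hc h).le
    rw [hX]
    simp only [sum_inner]
    obtain ⟨c, hc, hc0⟩ : ∃ c ∈ t, 0 < ζ c x := by
      by_contra! h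
      have := Finset.sum_nonpos h
      rw [hsum x hx] at this
      linarith
    exact Finset.sum_pos' hnn ⟨c, hc, hterm c hc hc0⟩
  rcases (frontier Ω).eq_empty_or_nonempty with hemp | hne
  · exact ⟨1, one_pos, fun x hx => by simp [hemp] at hx⟩
  · obtain ⟨x₀, hx₀, hmin⟩ := hΩ.isCompact_frontier.exists_isMinOn
      (f := fun x => ⟪X x, outwardNormal Ω x⟫) hne
      (hXd.continuous.continuousOn.inner hΩ.continuousOn_outwardNormal)
    exact ⟨_, hpos x₀ hx₀, fun x hx => hmin hx⟩

lemma integrableOn_sq {φ : EuclideanSpace ℝ (Fin n) → ℝ} (hφ : IsC1Closure Ω φ) :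
    IntegrableOn (fun x => φ x ^ 2) Ω :=
  hΩ.integrableOn_of_continuousOn (hφ.continuousOn.pow 2)

lemma integrableOn_norm_gradient_sq {φ : EuclideanSpace ℝ (Fin n) → ℝ} (hφ : IsC1Closure Ω φ) :
    IntegrableOn (fun x => ‖∇ φ x‖ ^ 2) Ω :=
  (hΩ.memLp_gradient hφ 2).integrable_norm_pow two_ne_zero

lemma integrable_sq_surfaceMeasure {φ : EuclideanSpace ℝ (Fin n) → ℝ} (hφ : IsC1Closure Ω φ) :
    Integrable (fun x => φ x ^ 2) (surfaceMeasure Ω) :=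
  hΩ.integrable_surfaceMeasure ((hφ.continuousOn.mono frontier_subset_closure).pow 2)

lemma integrableOn_sq_smul_divergence {φ : EuclideanSpace ℝ (Fin n) → ℝ} (hφ : IsC1Closure Ω φ)
    {X : EuclideanSpace ℝ (Fin n) → EuclideanSpace ℝ (Fin n)} (hX : IsAdmissibleField Ω X) :
    IntegrableOn (fun x => φ x ^ 2 * divergence X x + 2 * φ x * ⟪∇ φ x, X x⟫) Ω := by
  refine (hΩ.isAdmissibleField_smul hφ (hΩ.isAdmissibleField_smul hφ hX)).integrableOn.congr_fun
    (fun x hx => ?_) hΩ.isOpen.measurableSet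
  rw [hΩ.divergence_smul_eq hφ (hΩ.isAdmissibleField_smul hφ hX) hx,
    hΩ.divergence_smul_eq hφ hX hx, inner_smul_right]
  ring

/-- The trace inequality. -/
lemma exists_trace_inequality : ∃ C, 0 ≤ C ∧ ∀ φ, IsC1Closure Ω φ →
    ∫ x, φ x ^ 2 ∂surfaceMeasure Ω ≤
      C * ((∫ x in Ω, φ x ^ 2) + ∫ x in Ω, ‖∇ φ x‖ ^ 2) := by
  -- Since `X` has normal component at least `a`, the boundary integral of `φ²` is controlled by `∫
  -- div (φ² X)`. The divergence term costs `D φ²`, and the cross term at most `M (φ² + |∇φ|²)`.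
  obtain ⟨X, hX, a, ha, hXν⟩ := hΩ.exists_outward_field
  have hXa := hΩ.isAdmissibleField_of_contDiff hX
  obtain ⟨M, hM⟩ := hΩ.isCompact_closure.exists_bound_of_continuousOn
    (f := X) hX.continuous.continuousOn
  obtain ⟨D, hD⟩ := hΩ.isCompact_closure.exists_bound_of_continuousOn (f := divergence X)
    fun x _ => (continuousAt_divergence hX.contDiffAt).continuousWithinAt
  set C := max (D + M) (max M 0)
  have hC0 : 0 ≤ C := (le_max_right _ _).trans (le_max_right _ _)
  refine ⟨a⁻¹ * C, by positivity, fun φ hφ => ?_⟩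
  have h1 : a * ∫ x, φ x ^ 2 ∂surfaceMeasure Ω ≤
      ∫ x, φ x ^ 2 * ⟪X x, outwardNormal Ω x⟫ ∂surfaceMeasure Ω := by
    rw [← integral_const_mul]
    refine setIntegral_mono_on ((hΩ.integrable_sq_surfaceMeasure hφ).const_mul a)
      (hΩ.integrable_surfaceMeasure (((hφ.continuousOn.mono frontier_subset_closure).pow 2).mul
        (hX.continuous.continuousOn.inner hΩ.continuousOn_outwardNormal)))
      isClosed_frontier.measurableSet fun x hx => ?_
    rw [mul_comm]
    exact mul_le_mul_of_nonneg_left (hXν x hx) (sq_nonneg _)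
  have h2 : ∫ x in Ω, (φ x ^ 2 * divergence X x + 2 * φ x * ⟪∇ φ x, X x⟫) ≤
      ∫ x in Ω, (C * φ x ^ 2 + C * ‖∇ φ x‖ ^ 2) := by
    refine setIntegral_mono_on (hΩ.integrableOn_sq_smul_divergence hφ hXa)
      (((hΩ.integrableOn_sq hφ).const_mul C).add ((hΩ.integrableOn_norm_gradient_sq hφ).const_mul C))
      hΩ.isOpen.measurableSet fun x hx => ?_
    have hxΩ := subset_closure hx
    have hd : divergence X x ≤ D := (le_abs_self _).trans (hD x hxΩ)
    have hM0 : 0 ≤ M := (norm_nonneg _).trans (hM x hxΩ)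
    have hi : |⟪∇ φ x, X x⟫| ≤ ‖∇ φ x‖ * M :=
      (abs_real_inner_le_norm _ _).trans (mul_le_mul_of_nonneg_left (hM x hxΩ) (norm_nonneg _))
    have h3 : 2 * φ x * ⟪∇ φ x, X x⟫ ≤ M * φ x ^ 2 + M * ‖∇ φ x‖ ^ 2 := by
      have h4 : φ x * ⟪∇ φ x, X x⟫ ≤ |φ x| * (‖∇ φ x‖ * M) := by
        refine (le_abs_self _).trans ?_
        rw [abs_mul]
        exact mul_le_mul_of_nonneg_left hi (abs_nonneg _)
      have h5 := mul_nonneg hM0 (sq_nonneg (|φ x| - ‖∇ φ x‖))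
      have h6 := sq_abs (φ x)
      nlinarith
    have h4 : D + M ≤ C := le_max_left _ _
    have h5 : M ≤ C := (le_max_left _ _).trans (le_max_right _ _)
    nlinarith [sq_nonneg (φ x), sq_nonneg ‖∇ φ x‖]
  rw [integral_add ((hΩ.integrableOn_sq hφ).const_mul C)
    ((hΩ.integrableOn_norm_gradient_sq hφ).const_mul C), integral_const_mul, integral_const_mul] at h2
  rw [hΩ.integral_sq_smul_divergence hφ hXa] at h2
  rw [mul_assoc, ← div_eq_inv_mul, le_div_iff₀ ha]
  linarith

/-- A Poincaré inequality with boundary term. -/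
lemma exists_poincare (hn : 1 ≤ n) : ∃ C, 0 ≤ C ∧ ∀ φ, IsC1Closure Ω φ →
    ∫ x in Ω, φ x ^ 2 ≤
      C * ((∫ x in Ω, ‖∇ φ x‖ ^ 2) + ∫ x, φ x ^ 2 ∂surfaceMeasure Ω) := by
  -- The divergence theorem is applied to `φ² x`: the identity field has divergence `n ≥ 1`, which
  -- produces the L² norm of `φ`.
  have hid : ContDiff ℝ 1 fun x : EuclideanSpace ℝ (Fin n) => x := contDiff_id
  have hXa := hΩ.isAdmissibleField_of_contDiff hid
  obtain ⟨M, hM⟩ := hΩ.isCompact_closure.exists_bound_of_continuousOn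
    (f := fun x => x) hid.continuous.continuousOn
  obtain ⟨x₀, hx₀⟩ := hΩ.isConnected.nonempty
  have hM0 : 0 ≤ M := (norm_nonneg _).trans (hM x₀ (subset_closure hx₀))
  set C := max (2 * M) (4 * M ^ 2)
  have hC0 : 0 ≤ C := le_max_of_le_left (by positivity)
  refine ⟨C, hC0, fun φ hφ => ?_⟩
  have h1 : ∫ x, φ x ^ 2 * ⟪x, outwardNormal Ω x⟫ ∂surfaceMeasure Ω ≤
      M * ∫ x, φ x ^ 2 ∂surfaceMeasure Ω := by
    rw [← integral_const_mul]
    refine setIntegral_mono_on (hΩ.integrable_surfaceMeasure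
      (((hφ.continuousOn.mono frontier_subset_closure).pow 2).mul
        (hid.continuous.continuousOn.inner hΩ.continuousOn_outwardNormal)))
      ((hΩ.integrable_sq_surfaceMeasure hφ).const_mul M)
      isClosed_frontier.measurableSet fun x hx => ?_
    rw [mul_comm]
    refine mul_le_mul_of_nonneg_right ((real_inner_le_norm _ _).trans ?_) (sq_nonneg _)
    rw [hΩ.norm_outwardNormal hx, mul_one]
    exact hM x (frontier_subset_closure hx)
  -- Young's inequality `2 |φ| |∇φ| M ≤ φ² / 2 + 2 M² |∇φ|²` absorbs half of `φ²`; doubling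
  -- afterwards produces the constants `2 M` and `4 M²`.
  have h2 : ∫ x in Ω, (2⁻¹ * φ x ^ 2 - 2 * M ^ 2 * ‖∇ φ x‖ ^ 2) ≤
      ∫ x in Ω, (φ x ^ 2 * divergence (fun y => y) x + 2 * φ x * ⟪∇ φ x, x⟫) := by
    refine setIntegral_mono_on (((hΩ.integrableOn_sq hφ).const_mul _).sub
        ((hΩ.integrableOn_norm_gradient_sq hφ).const_mul _))
      (hΩ.integrableOn_sq_smul_divergence hφ hXa)
      hΩ.isOpen.measurableSet fun x hx => ?_
    rw [divergence_id]
    have hi : |⟪∇ φ x, x⟫| ≤ ‖∇ φ x‖ * M := (abs_real_inner_le_norm _ _).trans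
      (mul_le_mul_of_nonneg_left (hM x (subset_closure hx)) (norm_nonneg _))
    have h4 : -(φ x * ⟪∇ φ x, x⟫) ≤ |φ x| * (‖∇ φ x‖ * M) := by
      refine (neg_le_abs _).trans ?_
      rw [abs_mul]
      exact mul_le_mul_of_nonneg_left hi (abs_nonneg _)
    have h5 := sq_nonneg (|φ x| - 2 * (‖∇ φ x‖ * M))
    have h6 := sq_abs (φ x)
    have hn' : (1 : ℝ) ≤ n := by exact_mod_cast hn
    have h7 : φ x ^ 2 ≤ φ x ^ 2 * n := le_mul_of_one_le_right (sq_nonneg _) hn'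
    nlinarith
  rw [hΩ.integral_sq_smul_divergence hφ hXa, integral_sub ((hΩ.integrableOn_sq hφ).const_mul _)
    ((hΩ.integrableOn_norm_gradient_sq hφ).const_mul _), integral_const_mul,
    integral_const_mul] at h2
  have h3 : 0 ≤ ∫ x in Ω, ‖∇ φ x‖ ^ 2 := integral_nonneg fun x => sq_nonneg _
  have h4 : 0 ≤ ∫ x, φ x ^ 2 ∂surfaceMeasure Ω := integral_nonneg fun x => sq_nonneg _
  have h5 : 2 * M ≤ C := le_max_left _ _
  have h6 : 4 * M ^ 2 ≤ C := le_max_right _ _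
  nlinarith

end IsSmoothBoundedDomain

/-! ### Limits of L² pairings and continuity of translations. -/

section SquareIntegrable

variable {α H : Type*} [MeasurableSpace α] {μ : Measure α} [NormedAddCommGroup H]

lemma tendsto_toLp_of_tendsto_eLpNorm {f : ℕ → α → H} {g : α → H} (hf : ∀ j, MemLp (f j) 2 μ)
    (hg : MemLp g 2 μ) (h : Tendsto (fun j => eLpNorm (fun x => f j x - g x) 2 μ) atTop (𝓝 0)) :
    Tendsto (fun j => (hf j).toLp (f j)) atTop (𝓝 (hg.toLp g)) :=
  (Lp.tendsto_Lp_iff_tendsto_eLpNorm'' _ hf _ hg).2 h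

variable [InnerProductSpace ℝ H]

lemma inner_toLp {f g : α → H} (hf : MemLp f 2 μ) (hg : MemLp g 2 μ) :
    ⟪hf.toLp f, hg.toLp g⟫ = ∫ x, ⟪f x, g x⟫ ∂μ := by
  rw [L2.inner_def]
  refine integral_congr_ae ?_
  filter_upwards [hf.coeFn_toLp, hg.coeFn_toLp] with x h1 h2
  rw [h1, h2]

lemma norm_toLp_sq {f : α → H} (hf : MemLp f 2 μ) :
    ‖hf.toLp f‖ ^ 2 = ∫ x, ‖f x‖ ^ 2 ∂μ := by
  rw [← real_inner_self_eq_norm_sq, inner_toLp]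
  simp

lemma norm_toLp_sub_sq {f g : α → H} (hf : MemLp f 2 μ) (hg : MemLp g 2 μ) :
    ‖hf.toLp f - hg.toLp g‖ ^ 2 = ∫ x, ‖f x - g x‖ ^ 2 ∂μ := by
  rw [← MemLp.toLp_sub hf hg, norm_toLp_sq]
  rfl

lemma integrable_inner_of_memLp {f g : α → H} (hf : MemLp f 2 μ) (hg : MemLp g 2 μ) :
    Integrable (fun x => ⟪f x, g x⟫) μ := by
  refine (L2.integrable_inner (𝕜 := ℝ) (hf.toLp f) (hg.toLp g)).congr ?_
  filter_upwards [hf.coeFn_toLp, hg.coeFn_toLp] with x h1 h2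
  rw [h1, h2]

lemma tendsto_integral_inner {f g : ℕ → α → H} {f₀ g₀ : α → H} (hf : ∀ j, MemLp (f j) 2 μ)
    (hg : ∀ j, MemLp (g j) 2 μ) (hf₀ : MemLp f₀ 2 μ) (hg₀ : MemLp g₀ 2 μ)
    (h : Tendsto (fun j => eLpNorm (fun x => f j x - f₀ x) 2 μ) atTop (𝓝 0))
    (h' : Tendsto (fun j => eLpNorm (fun x => g j x - g₀ x) 2 μ) atTop (𝓝 0)) :
    Tendsto (fun j => ∫ x, ⟪f j x, g j x⟫ ∂μ) atTop (𝓝 (∫ x, ⟪f₀ x, g₀ x⟫ ∂μ)) := by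
  have := (tendsto_toLp_of_tendsto_eLpNorm hf hf₀ h).inner (𝕜 := ℝ)
    (tendsto_toLp_of_tendsto_eLpNorm hg hg₀ h')
  simpa only [inner_toLp] using this

lemma tendsto_integral_inner_const {g : ℕ → α → H} {a g₀ : α → H} (ha : MemLp a 2 μ)
    (hg : ∀ j, MemLp (g j) 2 μ) (hg₀ : MemLp g₀ 2 μ)
    (h' : Tendsto (fun j => eLpNorm (fun x => g j x - g₀ x) 2 μ) atTop (𝓝 0)) :
    Tendsto (fun j => ∫ x, ⟪a x, g j x⟫ ∂μ) atTop (𝓝 (∫ x, ⟪a x, g₀ x⟫ ∂μ)) :=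
  tendsto_integral_inner (fun _ => ha) hg ha hg₀ (by simp) h'

end SquareIntegrable

/-- Translations preserve measure and depend continuously on `t`, so composition with them is
continuous in L². -/
lemma tendsto_eLpNorm_translate {H : Type*} [NormedAddCommGroup H]
    {f : EuclideanSpace ℝ (Fin n) → H} (hf : MemLp f 2 volume) (e : EuclideanSpace ℝ (Fin n)) :
    Tendsto (fun t : ℝ => eLpNorm (fun x => f (x + t • e) - f x) 2 volume) (𝓝 0) (𝓝 0) := by
  let τ : C(ℝ × EuclideanSpace ℝ (Fin n), EuclideanSpace ℝ (Fin n)) :=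
    ⟨fun p => p.2 + p.1 • e, by fun_prop⟩
  have hmp : ∀ t : ℝ, MeasurePreserving (τ.curry t) volume volume := fun t =>
    measurePreserving_add_right volume (t • e)
  have h1 := (tendsto_const_nhds (x := hf.toLp f) (f := 𝓝 (0 : ℝ))).compMeasurePreservingLp
    (τ.curry.continuous.tendsto 0) hmp (hmp 0) (by simp)
  simp only [Lp.toLp_compMeasurePreserving] at h1
  have h0 : f ∘ (τ.curry 0) = f := by ext x; simp [τ]
  simp only [h0] at h1
  have h2 := (Lp.tendsto_Lp_iff_tendsto_eLpNorm'' _ (fun t => hf.comp_measurePreserving (hmp t))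
    _ hf).1 h1
  exact h2

/-! ### Weak gradients and their agreement with classical gradients. -/

section WeakGradient

variable {Ω : Set (EuclideanSpace ℝ (Fin n))} {v : EuclideanSpace ℝ (Fin n) → ℝ}

lemma gradient_eq_zero_of_eventually {x : EuclideanSpace ℝ (Fin n)}
    {φ : EuclideanSpace ℝ (Fin n) → ℝ} (h : ∀ᶠ y in 𝓝 x, φ y = 0) : ∇ φ x = 0 := by
  have : φ =ᶠ[𝓝 x] fun _ => 0 := h
  rw [gradient, this.fderiv_eq]
  simp

lemma continuous_smul_gradient (hΩ : IsOpen Ω) (hv : ContDiffOn ℝ 1 v Ω)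
    {φ : EuclideanSpace ℝ (Fin n) → ℝ} (hφ : Continuous φ) (hφΩ : tsupport φ ⊆ Ω) :
    Continuous fun x => φ x • ∇ v x := by
  refine continuous_iff_continuousAt.2 fun x => ?_
  by_cases hx : x ∈ Ω
  · exact hφ.continuousAt.smul (continuousAt_gradient (hv.contDiffAt (hΩ.mem_nhds hx)))
  · refine ContinuousAt.congr (f := fun _ => (0 : EuclideanSpace ℝ (Fin n)))
      continuousAt_const ?_
    filter_upwards [notMem_tsupport_iff_eventuallyEq.1 fun h => hx (hφΩ h)] with y hy
    rw [hy, Pi.zero_apply, zero_smul]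

lemma hasWeakGrad_of_contDiffOn (hΩ : IsOpen Ω) (hv : ContDiffOn ℝ 1 v Ω) :
    HasWeakGrad Ω v (∇ v) := by
  intro φ hφ hφc hφΩ
  have hφ0 : ∀ x ∉ Ω, ∀ᶠ y in 𝓝 x, φ y = 0 := fun x hx =>
    notMem_tsupport_iff_eventuallyEq.1 fun h => hx (hφΩ h)
  have hcont1 : Continuous fun x => v x • ∇ φ x := by
    refine continuous_iff_continuousAt.2 fun x => ?_
    by_cases hx : x ∈ Ω
    · exact (hv.contDiffAt (hΩ.mem_nhds hx)).continuousAt.smul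
        (continuousAt_gradient (hφ.contDiffAt.of_le (by simp)))
    · refine ContinuousAt.congr (f := fun _ => (0 : EuclideanSpace ℝ (Fin n)))
        continuousAt_const ?_
      filter_upwards [(hφ0 x hx).eventually_nhds] with y hy
      rw [gradient_eq_zero_of_eventually hy, smul_zero]
  have hcont2 := continuous_smul_gradient hΩ hv hφ.continuous hφΩ
  have hcs2 : HasCompactSupport fun x => φ x • ∇ v x := hφc.smul_right
  have hcs1 : HasCompactSupport fun x => v x • ∇ φ x := by
    refine HasCompactSupport.intro hφc fun x hx => ?_
    rw [gradient_eq_zero_of_eventually (notMem_tsupport_iff_eventuallyEq.1 hx), smul_zero]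
  have hi1 := hcont1.integrable_of_hasCompactSupport (μ := volume) hcs1
  have hi2 := hcont2.integrable_of_hasCompactSupport (μ := volume) hcs2
  rw [setIntegral_eq_integral_of_forall_compl_eq_zero fun x hx => by
      rw [gradient_eq_zero_of_eventually (hφ0 x hx), smul_zero],
    setIntegral_eq_integral_of_forall_compl_eq_zero fun x hx => by
      rw [(hφ0 x hx).self_of_nhds, zero_smul], eq_neg_iff_add_eq_zero, ← integral_add hi1 hi2]
  -- Paired with a constant vector `w`, the integrand is the divergence of `(φ v) w`, which extends
  -- by zero to a compactly supported C¹ field.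
  refine integral_eq_zero_of_forall_integral_inner_eq_zero (𝕜 := ℝ) _ (hi1.add hi2) fun w => ?_
  have hsm : ContDiff ℝ 1 fun x => (φ x * v x) • w := by
    refine contDiff_iff_contDiffAt.2 fun x => ?_
    by_cases hx : x ∈ Ω
    · exact ((hφ.contDiffAt.of_le (by simp)).mul (hv.contDiffAt (hΩ.mem_nhds hx))).smul
        contDiffAt_const
    · refine contDiffAt_const (c := (0 : EuclideanSpace ℝ (Fin n))) |>.congr_of_eventuallyEq ?_
      filter_upwards [hφ0 x hx] with y hy
      rw [hy, zero_mul, zero_smul]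
  have hcs : HasCompactSupport fun x => (φ x * v x) • w := (hφc.mul_right).smul_right
  rw [← (integral_divergence_eq_zero hsm hcs).2]
  congr 1
  ext x
  by_cases hx : x ∈ Ω
  · have h1 : DifferentiableAt ℝ φ x := hφ.differentiable (by simp) x
    have h2 := differentiableAt_of_contDiffOn hΩ hv hx
    rw [divergence_smul (f := fun y => φ y * v y) (h1.mul h2) (differentiableAt_const w), gradient_mul h1 h2,
      real_inner_comm]
    simp [divergence, add_comm]
  · have h3 : ∀ᶠ y in 𝓝 x, (φ y * v y) • w = 0 := by
      filter_upwards [hφ0 x hx] with y hy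
      rw [hy, zero_mul, zero_smul]
    rw [divergence_eq_zero h3, gradient_eq_zero_of_eventually (hφ0 x hx),
      (hφ0 x hx).self_of_nhds]
    simp

/-- The fundamental lemma of the calculus of variations, applied to `G - ∇ v`. It identifies the
arbitrarily chosen `weakGrad` almost everywhere for functions that are C¹ inside the domain. -/
lemma IsL2WeakGrad.ae_eq_gradient (hΩ : IsSmoothBoundedDomain Ω) (hv : ContDiffOn ℝ 1 v Ω)
    {G : EuclideanSpace ℝ (Fin n) → EuclideanSpace ℝ (Fin n)} (hG : IsL2WeakGrad Ω v G) :
    G =ᵐ[volume.restrict Ω] ∇ v := by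
  have hfin := hΩ.isFiniteMeasure_volume_restrict
  have hGi : IntegrableOn G Ω := hG.1.integrable (by norm_num)
  have hGl : LocallyIntegrableOn G Ω := hGi.locallyIntegrableOn
  have hvl : LocallyIntegrableOn (∇ v) Ω :=
    (continuousOn_gradient hΩ.isOpen hv).locallyIntegrableOn hΩ.isOpen.measurableSet
  have h := hΩ.isOpen.ae_eq_zero_of_integral_contDiff_smul_eq_zero (hGl.sub hvl)
    fun φ hφ hφc hφΩ => by
      have h1 := hG.2 φ hφ hφc hφΩ
      have h2 := hasWeakGrad_of_contDiffOn hΩ.isOpen hv φ hφ hφc hφΩ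
      have hφ0 : ∀ x ∉ Ω, φ x = 0 := fun x hx =>
        image_eq_zero_of_notMem_tsupport fun h => hx (hφΩ h)
      have hi1 : IntegrableOn (fun x => φ x • G x) Ω := by
        obtain ⟨M, hM⟩ := hφ.continuous.bounded_above_of_compact_support hφc
        exact Integrable.bdd_smul hGi M hφ.continuous.aestronglyMeasurable (ae_of_all _ hM)
      have hi2 : IntegrableOn (fun x => φ x • ∇ v x) Ω := by
        have h3 : Integrable fun x => φ x • ∇ v x :=
          (continuous_smul_gradient hΩ.isOpen hv hφ.continuous hφΩ).integrable_of_hasCompactSupport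
            hφc.smul_right
        exact h3.integrableOn
      rw [← setIntegral_eq_integral_of_forall_compl_eq_zero (s := Ω) fun x hx => by
        rw [hφ0 x hx, zero_smul]]
      simp only [Pi.sub_apply, smul_sub]
      rw [integral_sub hi1 hi2, sub_eq_zero]
      rw [h1] at h2
      exact neg_inj.1 h2
  rw [Filter.EventuallyEq, ae_restrict_iff' hΩ.isOpen.measurableSet]
  filter_upwards [h] with x hx hxΩ using sub_eq_zero.1 (hx hxΩ)

lemma MemH1.weakGrad_spec (hv : MemH1 Ω v) : IsL2WeakGrad Ω v (weakGrad Ω v) := by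
  rw [weakGrad, dif_pos hv.2]
  exact hv.2.choose_spec

lemma MemH1.weakGrad_ae_eq (hΩ : IsSmoothBoundedDomain Ω) (h : MemH1 Ω v)
    (hv : ContDiffOn ℝ 1 v Ω) : weakGrad Ω v =ᵐ[volume.restrict Ω] ∇ v :=
  h.weakGrad_spec.ae_eq_gradient hΩ hv

lemma IsSmoothBoundedDomain.memH1 (hΩ : IsSmoothBoundedDomain Ω) (hv : IsC1Closure Ω v) :
    MemH1 Ω v :=
  ⟨hΩ.memLp_of_continuousOn hv.continuousOn 2, ∇ v, hΩ.memLp_gradient hv 2,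
    hasWeakGrad_of_contDiffOn hΩ.isOpen hv.contDiffOn⟩

end WeakGradient

/-! ### Approximation in H¹ by functions C¹ up to the boundary. -/

section Density

variable {Ω : Set (EuclideanSpace ℝ (Fin n))} {v w : EuclideanSpace ℝ (Fin n) → ℝ}

/-- `v` is a limit in `H^1(Ω)` of functions in `C^1(closure Ω)`. -/
def IsH1Limit (Ω : Set (EuclideanSpace ℝ (Fin n))) (v : EuclideanSpace ℝ (Fin n) → ℝ) : Prop :=
  ∃ φ : ℕ → EuclideanSpace ℝ (Fin n) → ℝ, (∀ j, IsC1Closure Ω (φ j)) ∧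
    Tendsto (fun j => eLpNorm (fun x => φ j x - v x) 2 (volume.restrict Ω)) atTop (𝓝 0) ∧
    Tendsto (fun j => eLpNorm (fun x => ∇ (φ j) x - ∇ v x) 2 (volume.restrict Ω)) atTop (𝓝 0)

lemma IsH1Limit.congr (hΩ : IsOpen Ω) (hv : IsH1Limit Ω v) (h : EqOn v w Ω) : IsH1Limit Ω w := by
  obtain ⟨φ, h1, h2, h3⟩ := hv
  refine ⟨φ, h1, h2.congr fun j => eLpNorm_congr_ae ?_, h3.congr fun j => eLpNorm_congr_ae ?_⟩
  · filter_upwards [ae_restrict_mem hΩ.measurableSet] with x hx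
    rw [h hx]
  · filter_upwards [ae_restrict_mem hΩ.measurableSet] with x hx
    rw [gradient, gradient, gradient, (h.eventuallyEq_of_mem (hΩ.mem_nhds hx)).fderiv_eq]

lemma IsH1Limit.add (hΩ : IsOpen Ω) (hv : IsH1Limit Ω v) (hw : IsH1Limit Ω w)
    (hvd : ContDiffOn ℝ 1 v Ω) (hwd : ContDiffOn ℝ 1 w Ω) : IsH1Limit Ω fun x => v x + w x := by
  obtain ⟨φ, h1, h2, h3⟩ := hv
  obtain ⟨ψ, k1, k2, k3⟩ := hw
  have hm := hΩ.measurableSet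
  have hmeas : ∀ {u : EuclideanSpace ℝ (Fin n) → ℝ}, ContDiffOn ℝ 1 u Ω →
      AEStronglyMeasurable u (volume.restrict Ω) ∧
      AEStronglyMeasurable (∇ u) (volume.restrict Ω) := fun hu =>
    ⟨hu.continuousOn.aestronglyMeasurable hm,
      (continuousOn_gradient hΩ hu).aestronglyMeasurable hm⟩
  refine ⟨fun j x => φ j x + ψ j x, fun j => (h1 j).add hΩ (k1 j), ?_, ?_⟩
  · refine tendsto_of_tendsto_of_tendsto_of_le_of_le tendsto_const_nhds
      (by simpa using h2.add k2) (fun j => zero_le) fun j => ?_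
    refine le_trans (le_of_eq ?_) (eLpNorm_add_le
      ((hmeas (h1 j).contDiffOn).1.sub (hmeas hvd).1)
      ((hmeas (k1 j).contDiffOn).1.sub (hmeas hwd).1) one_le_two)
    congr 1
    ext x
    simp only [Pi.add_apply]
    ring
  · refine tendsto_of_tendsto_of_tendsto_of_le_of_le tendsto_const_nhds
      (by simpa using h3.add k3) (fun j => zero_le) fun j => ?_
    refine le_trans (le_of_eq ?_) (eLpNorm_add_le
      ((hmeas (h1 j).contDiffOn).2.sub (hmeas hvd).2)
      ((hmeas (k1 j).contDiffOn).2.sub (hmeas hwd).2) one_le_two)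
    refine eLpNorm_congr_ae ?_
    filter_upwards [ae_restrict_mem hm] with x hx
    rw [gradient_add (differentiableAt_of_contDiffOn hΩ (h1 j).contDiffOn hx)
        (differentiableAt_of_contDiffOn hΩ (k1 j).contDiffOn hx),
      gradient_add (differentiableAt_of_contDiffOn hΩ hvd hx)
        (differentiableAt_of_contDiffOn hΩ hwd hx)]
    simp only [Pi.add_apply]
    abel

lemma isH1Limit_of_isC1Closure (hv : IsC1Closure Ω v) : IsH1Limit Ω v :=
  ⟨fun _ => v, fun _ => hv, by simp, by simp⟩

lemma IsH1Limit.sum (hΩ : IsOpen Ω) {ι : Type*} {t : Finset ι}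
    {f : ι → EuclideanSpace ℝ (Fin n) → ℝ} (hf : ∀ i ∈ t, IsH1Limit Ω (f i))
    (hfd : ∀ i ∈ t, ContDiffOn ℝ 1 (f i) Ω) : IsH1Limit Ω fun x => ∑ i ∈ t, f i x := by
  classical
  induction t using Finset.induction_on with
  | empty =>
    simp only [Finset.sum_empty]
    exact isH1Limit_of_isC1Closure (isC1Closure_of_contDiffAt fun x _ => contDiffAt_const)
  | insert i t hi ih =>
    simp only [Finset.sum_insert hi]
    exact (hf i (Finset.mem_insert_self i t)).add hΩ
      (ih (fun j hj => hf j (Finset.mem_insert_of_mem hj))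
        fun j hj => hfd j (Finset.mem_insert_of_mem hj))
      (hfd i (Finset.mem_insert_self i t))
      (ContDiffOn.sum fun j hj => hfd j (Finset.mem_insert_of_mem hj))

/-- Localised functions are approximated by their translates into `Ω`. -/
lemma isH1Limit_mul_of_translate (hΩ : IsOpen Ω) (hvd : ContDiffOn ℝ 1 v Ω)
    (hv2 : MemLp v 2 (volume.restrict Ω)) (hg2 : MemLp (∇ v) 2 (volume.restrict Ω))
    {ζ : EuclideanSpace ℝ (Fin n) → ℝ} (hζ : ContDiff ℝ ∞ ζ) (hζc : HasCompactSupport ζ)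
    {e : EuclideanSpace ℝ (Fin n)} {δ : ℝ} (hδ : 0 < δ)
    (h : ∀ x ∈ closure Ω, x ∈ tsupport ζ → ∀ t ∈ Ioo 0 δ, x + t • e ∈ Ω) :
    IsH1Limit Ω fun x => ζ x * v x := by
  have hm := hΩ.measurableSet
  have hζ1 : ContDiff ℝ 1 ζ := hζ.of_le (by simp)
  -- Extension by zero makes L² continuity of translations available. The jump at the boundary is
  -- harmless: where `ζ` is nonzero, a point of `Ω` and its translate both lie in `Ω`. Weak
  -- differentiability of the extension is never used.
  set v' : EuclideanSpace ℝ (Fin n) → ℝ := Ω.indicator v with hv'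
  set g' : EuclideanSpace ℝ (Fin n) → EuclideanSpace ℝ (Fin n) := Ω.indicator (∇ v) with hg'
  have hv'2 : MemLp v' 2 volume := (memLp_indicator_iff_restrict hm).2 hv2
  have hg'2 : MemLp g' 2 volume := (memLp_indicator_iff_restrict hm).2 hg2
  obtain ⟨M, hM⟩ := hζ.continuous.bounded_above_of_compact_support hζc
  have hgc : Continuous (∇ ζ) :=
    continuous_iff_continuousAt.2 fun x => continuousAt_gradient hζ1.contDiffAt
  have hgs : ∀ x ∉ tsupport ζ, ∇ ζ x = 0 := fun x hx =>
    gradient_eq_zero_of_eventually (notMem_tsupport_iff_eventuallyEq.1 hx)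
  obtain ⟨N, hN⟩ := hgc.bounded_above_of_compact_support (HasCompactSupport.intro hζc hgs)
  -- The shift `j + 2` keeps every step, including the one for `j = 0`, strictly below `δ`.
  set s : ℕ → ℝ := fun j => δ / (j + 2) with hs
  have hs0 : Tendsto s atTop (𝓝 0) := by
    have := (tendsto_const_div_atTop_nhds_zero_nat δ).comp (tendsto_add_atTop_nat 2)
    refine this.congr fun j => ?_
    simp [hs]
  have hsmem : ∀ j, s j ∈ Ioo 0 δ := fun j => by
    have hj : (0 : ℝ) ≤ j := j.cast_nonneg
    refine ⟨by positivity, ?_⟩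
    rw [hs]
    exact div_lt_self hδ (by linarith)
  have hT1 := (tendsto_eLpNorm_translate hv'2 e).comp hs0
  have hT2 := (tendsto_eLpNorm_translate hg'2 e).comp hs0
  set φ : ℕ → EuclideanSpace ℝ (Fin n) → ℝ := fun j x => ζ x * v (x + s j • e) with hφ
  have hshift : ∀ j x, ContDiffAt ℝ 1 v (x + s j • e) →
      ContDiffAt ℝ 1 (fun y => v (y + s j • e)) x := fun j x hx =>
    hx.comp x (contDiffAt_id.add contDiffAt_const)
  have hφC1 : ∀ j, IsC1Closure Ω (φ j) := fun j => by
    refine isC1Closure_of_contDiffAt fun x hx => ?_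
    by_cases hxζ : x ∈ tsupport ζ
    · exact hζ1.contDiffAt.mul (hshift j x (hvd.contDiffAt (hΩ.mem_nhds (h x hx hxζ _ (hsmem j)))))
    · refine contDiffAt_const (c := (0 : ℝ)) |>.congr_of_eventuallyEq ?_
      filter_upwards [notMem_tsupport_iff_eventuallyEq.1 hxζ] with y hy
      simp [hφ, hy]
  have hdiff : ∀ j, ∀ x ∈ Ω, φ j x - ζ x * v x = ζ x * (v' (x + s j • e) - v' x) := by
    intro j x hx
    by_cases hxζ : x ∈ tsupport ζ
    · rw [hv', indicator_of_mem hx,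
        indicator_of_mem (h x (subset_closure hx) hxζ _ (hsmem j))]
      simp only [hφ]
      ring
    · simp [hφ, image_eq_zero_of_notMem_tsupport hxζ]
  have hgdiff : ∀ j, ∀ x ∈ Ω, ∇ (φ j) x - ∇ (fun y => ζ y * v y) x =
      ζ x • (g' (x + s j • e) - g' x) + (v' (x + s j • e) - v' x) • ∇ ζ x := by
    intro j x hx
    by_cases hxζ : x ∈ tsupport ζ
    · have hxj := h x (subset_closure hx) hxζ _ (hsmem j)
      have hd1 : DifferentiableAt ℝ (fun y => v (y + s j • e)) x :=
        (hshift j x (hvd.contDiffAt (hΩ.mem_nhds hxj))).differentiableAt one_ne_zero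
      have hgs : ∇ (fun y => v (y + s j • e)) x = ∇ v (x + s j • e) := by
        rw [gradient, gradient, fderiv_comp_add_right]
      rw [hφ, gradient_mul (hζ1.differentiable one_ne_zero x) hd1,
        gradient_mul (hζ1.differentiable one_ne_zero x)
          (differentiableAt_of_contDiffOn hΩ hvd hx), hgs, hv', hg', indicator_of_mem hx,
        indicator_of_mem hx, indicator_of_mem hxj, indicator_of_mem hxj, smul_sub, sub_smul]
      abel
    · have hz := notMem_tsupport_iff_eventuallyEq.1 hxζ
      rw [hgs x hxζ, image_eq_zero_of_notMem_tsupport hxζ,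
        gradient_eq_zero_of_eventually (φ := φ j) (by
          filter_upwards [hz] with y hy
          simp [hφ, hy]),
        gradient_eq_zero_of_eventually (φ := fun y => ζ y * v y) (by
          filter_upwards [hz] with y hy
          simp [hy])]
      simp
  have hlim0 : ∀ c : ℝ, Tendsto (fun j => ENNReal.ofReal c *
      eLpNorm (fun x => v' (x + s j • e) - v' x) 2 volume) atTop (𝓝 0) := fun c => by
    simpa using ENNReal.Tendsto.const_mul hT1 (.inr (ENNReal.ofReal_ne_top (r := c)))
  have hlim1 : ∀ c : ℝ, Tendsto (fun j => ENNReal.ofReal c *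
      eLpNorm (fun x => g' (x + s j • e) - g' x) 2 volume) atTop (𝓝 0) := fun c => by
    simpa using ENNReal.Tendsto.const_mul hT2 (.inr (ENNReal.ofReal_ne_top (r := c)))
  have hmv : ∀ j, AEStronglyMeasurable (fun x => v' (x + s j • e) - v' x) volume := fun j =>
    (hv'2.aestronglyMeasurable.comp_measurePreserving
      (measurePreserving_add_right volume (s j • e))).sub hv'2.aestronglyMeasurable
  have hmg : ∀ j, AEStronglyMeasurable (fun x => g' (x + s j • e) - g' x) volume := fun j =>
    (hg'2.aestronglyMeasurable.comp_measurePreserving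
      (measurePreserving_add_right volume (s j • e))).sub hg'2.aestronglyMeasurable
  refine ⟨φ, hφC1, ?_, ?_⟩
  · refine tendsto_of_tendsto_of_tendsto_of_le_of_le tendsto_const_nhds (hlim0 M)
      (fun j => zero_le) fun j => ?_
    refine (eLpNorm_le_mul_eLpNorm_of_ae_le_mul
      (g := fun x => v' (x + s j • e) - v' x) (c := M) ?_ 2).trans ?_
    · filter_upwards [ae_restrict_mem hm] with x hx
      rw [hdiff j x hx, norm_mul]
      exact mul_le_mul_of_nonneg_right (hM x) (norm_nonneg _)
    · exact mul_le_mul_right (eLpNorm_mono_measure _ Measure.restrict_le_self) _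
  · refine tendsto_of_tendsto_of_tendsto_of_le_of_le tendsto_const_nhds
      (by simpa using (hlim1 M).add (hlim0 N)) (fun j => zero_le) fun j => ?_
    have h1 : eLpNorm (fun x => ∇ (φ j) x - ∇ (fun y => ζ y * v y) x) 2 (volume.restrict Ω) =
        eLpNorm ((fun x => ζ x • (g' (x + s j • e) - g' x)) +
          fun x => (v' (x + s j • e) - v' x) • ∇ ζ x) 2 (volume.restrict Ω) := by
      refine eLpNorm_congr_ae ?_
      filter_upwards [ae_restrict_mem hm] with x hx using hgdiff j x hx
    rw [h1]
    refine (eLpNorm_mono_measure _ Measure.restrict_le_self).trans ((eLpNorm_add_le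
      (hζ.continuous.aestronglyMeasurable.smul (hmg j))
      ((hmv j).smul hgc.aestronglyMeasurable) one_le_two).trans (add_le_add ?_ ?_))
    · refine eLpNorm_le_mul_eLpNorm_of_ae_le_mul (ae_of_all _ fun x => ?_) 2
      rw [Pi.smul_apply', norm_smul]
      exact mul_le_mul_of_nonneg_right (hM x) (norm_nonneg _)
    · refine eLpNorm_le_mul_eLpNorm_of_ae_le_mul (ae_of_all _ fun x => ?_) 2
      rw [Pi.smul_apply', norm_smul, mul_comm]
      exact mul_le_mul_of_nonneg_right (hN x) (norm_nonneg _)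

/-- Density of `C^1(closure Ω)` in `H^1(Ω) ∩ C^1(Ω)`. -/
lemma IsSmoothBoundedDomain.isH1Limit (hΩ : IsSmoothBoundedDomain Ω) (hvd : ContDiffOn ℝ 1 v Ω)
    (hv2 : MemLp v 2 (volume.restrict Ω)) (hg2 : MemLp (∇ v) 2 (volume.restrict Ω)) :
    IsH1Limit Ω v := by
  have hloc : ∀ c ∈ closure Ω, ∃ U ∈ 𝓝 c, ∃ (e : EuclideanSpace ℝ (Fin n)) (δ : ℝ), 0 < δ ∧
      ∀ x ∈ closure Ω, x ∈ U → ∀ t ∈ Ioo 0 δ, x + t • e ∈ Ω := by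
    intro c hc
    by_cases hcΩ : c ∈ Ω
    -- Near an interior point no translation is needed, so the direction is zero.
    · exact ⟨Ω, hΩ.isOpen.mem_nhds hcΩ, 0, 1, one_pos, fun x _ hx t _ => by simpa using hx⟩
    · have hcf : c ∈ frontier Ω := by rw [hΩ.isOpen.frontier_eq]; exact ⟨hc, hcΩ⟩
      obtain ⟨T⟩ := hΩ.smoothBoundary.nonempty_graphChart hcf
      have hr := half_pos T.radius_pos
      refine ⟨_, Metric.ball_mem_nhds c hr, T.e, T.radius / 2, hr, fun x hx hxU t ht => ?_⟩
      refine T.add_smul_mem (Metric.ball_subset_ball (by linarith) hxU) hx ht.1 ?_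
      rw [mem_ball_iff_norm] at hxU ⊢
      have h1 : ‖x + t • T.e - c‖ ≤ ‖x - c‖ + ‖t • T.e‖ := by
        rw [add_sub_right_comm]; exact norm_add_le _ _
      rw [norm_smul, T.norm_e, mul_one, Real.norm_of_nonneg ht.1.le] at h1
      linarith [ht.2]
  choose! U hU e δ hδ hmem using hloc
  obtain ⟨t, ζ, htΩ, hsm, hcs, hsub, -, hsum⟩ := exists_smooth_partition hΩ.isCompact_closure U hU
  have h1 : IsH1Limit Ω fun x => ∑ c ∈ t, ζ c x * v x :=
    IsH1Limit.sum hΩ.isOpen (fun c hc => isH1Limit_mul_of_translate hΩ.isOpen hvd hv2 hg2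
      (hsm c hc) (hcs c hc) (hδ c (htΩ c hc))
      fun x hx hxζ => hmem c (htΩ c hc) x hx (hsub c hc hxζ))
      fun c hc => (((hsm c hc).of_le (by simp)).contDiffOn).mul hvd
  refine h1.congr hΩ.isOpen fun x hx => ?_
  rw [← Finset.sum_mul, hsum x (subset_closure hx), one_mul]

end Density

/-! ### Existence and uniqueness of traces. -/

section Trace

variable {Ω : Set (EuclideanSpace ℝ (Fin n))} {v : EuclideanSpace ℝ (Fin n) → ℝ}
  {G : EuclideanSpace ℝ (Fin n) → EuclideanSpace ℝ (Fin n)} {g g' : EuclideanSpace ℝ (Fin n) → ℝ}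

/-- `v` together with its weak gradient `G` and its trace `g` is a limit of functions in
`C^1(closure Ω)`. -/
structure HasGradTrace (Ω : Set (EuclideanSpace ℝ (Fin n))) (v : EuclideanSpace ℝ (Fin n) → ℝ)
    (G : EuclideanSpace ℝ (Fin n) → EuclideanSpace ℝ (Fin n))
    (g : EuclideanSpace ℝ (Fin n) → ℝ) : Prop where
  memLp : MemLp v 2 (volume.restrict Ω)
  memLp_grad : MemLp G 2 (volume.restrict Ω)
  memLp_trace : MemLp g 2 (surfaceMeasure Ω)
  exists_seq : ∃ φ : ℕ → EuclideanSpace ℝ (Fin n) → ℝ, (∀ j, IsC1Closure Ω (φ j)) ∧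
    Tendsto (fun j => eLpNorm (fun x => φ j x - v x) 2 (volume.restrict Ω)) atTop (𝓝 0) ∧
    Tendsto (fun j => eLpNorm (fun x => ∇ (φ j) x - G x) 2 (volume.restrict Ω)) atTop (𝓝 0) ∧
    Tendsto (fun j => eLpNorm (fun x => φ j x - g x) 2 (surfaceMeasure Ω)) atTop (𝓝 0)

lemma MemH1.hasGradTrace (hv : MemH1 Ω v) (hg : IsTrace Ω v g) :
    HasGradTrace Ω v (weakGrad Ω v) g :=
  ⟨hv.1, hv.weakGrad_spec.1, hg.1, hg.2⟩

lemma isTrace_trace (h : ∃ g, IsTrace Ω v g) : IsTrace Ω v (trace Ω v) := by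
  rw [trace, dif_pos h]
  exact h.choose_spec

namespace IsSmoothBoundedDomain

variable (hΩ : IsSmoothBoundedDomain Ω)
include hΩ

lemma memLp_trace {φ : EuclideanSpace ℝ (Fin n) → ℝ} (hφ : IsC1Closure Ω φ) :
    MemLp φ 2 (surfaceMeasure Ω) :=
  hΩ.memLp_surfaceMeasure (hφ.continuousOn.mono frontier_subset_closure) 2

/-- The trace inequality for `φ - ψ`, phrased in L² spaces: restriction to the boundary is Lipschitz
for the H¹ norm. Both uniqueness and existence of traces rest on it. -/
lemma exists_norm_trace_sub_sq_le : ∃ C, 0 ≤ C ∧ ∀ φ ψ, ∀ (hφ : IsC1Closure Ω φ)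
    (hψ : IsC1Closure Ω ψ),
    ‖(hΩ.memLp_trace hφ).toLp φ - (hΩ.memLp_trace hψ).toLp ψ‖ ^ 2 ≤
      C * (‖(hΩ.memLp_of_continuousOn hφ.continuousOn 2).toLp φ -
          (hΩ.memLp_of_continuousOn hψ.continuousOn 2).toLp ψ‖ ^ 2 +
        ‖(hΩ.memLp_gradient hφ 2).toLp (∇ φ) - (hΩ.memLp_gradient hψ 2).toLp (∇ ψ)‖ ^ 2) := by
  obtain ⟨C, hC, h⟩ := hΩ.exists_trace_inequality
  refine ⟨C, hC, fun φ ψ hφ hψ => ?_⟩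
  rw [norm_toLp_sub_sq, norm_toLp_sub_sq, norm_toLp_sub_sq]
  have h1 := h _ (hφ.sub hΩ.isOpen hψ)
  have h2 : ∫ x in Ω, ‖∇ (fun y => φ y - ψ y) x‖ ^ 2 = ∫ x in Ω, ‖∇ φ x - ∇ ψ x‖ ^ 2 := by
    refine setIntegral_congr_fun hΩ.isOpen.measurableSet fun x hx => ?_
    rw [gradient_sub (differentiableAt_of_contDiffOn hΩ.isOpen hφ.contDiffOn hx)
      (differentiableAt_of_contDiffOn hΩ.isOpen hψ.contDiffOn hx)]
  rw [h2] at h1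
  simpa only [Real.norm_eq_abs, sq_abs] using h1

lemma trace_unique (h : HasGradTrace Ω v G g) (h' : HasGradTrace Ω v G g') :
    g =ᵐ[surfaceMeasure Ω] g' := by
  obtain ⟨C, -, hC⟩ := hΩ.exists_norm_trace_sub_sq_le
  obtain ⟨φ, hφ, h1, h2, h3⟩ := h.exists_seq
  obtain ⟨ψ, hψ, k1, k2, k3⟩ := h'.exists_seq
  have l1 := (tendsto_toLp_of_tendsto_eLpNorm
    (fun j => hΩ.memLp_of_continuousOn (hφ j).continuousOn 2) h.memLp h1).sub
    (tendsto_toLp_of_tendsto_eLpNorm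
      (fun j => hΩ.memLp_of_continuousOn (hψ j).continuousOn 2) h'.memLp k1)
  have l2 := (tendsto_toLp_of_tendsto_eLpNorm
    (fun j => hΩ.memLp_gradient (hφ j) 2) h.memLp_grad h2).sub
    (tendsto_toLp_of_tendsto_eLpNorm (fun j => hΩ.memLp_gradient (hψ j) 2) h'.memLp_grad k2)
  have l3 := (tendsto_toLp_of_tendsto_eLpNorm
    (fun j => hΩ.memLp_trace (hφ j)) h.memLp_trace h3).sub
    (tendsto_toLp_of_tendsto_eLpNorm (fun j => hΩ.memLp_trace (hψ j)) h'.memLp_trace k3)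
  rw [sub_self] at l1 l2
  have hle := le_of_tendsto_of_tendsto' (l3.norm.pow 2)
    (((l1.norm.pow 2).add (l2.norm.pow 2)).const_mul C) fun j => hC _ _ (hφ j) (hψ j)
  have h0 : ‖h.memLp_trace.toLp g - h'.memLp_trace.toLp g'‖ = 0 := by
    refine pow_eq_zero_iff two_ne_zero |>.1 (le_antisymm ?_ (sq_nonneg _))
    simpa using hle
  exact (MemLp.toLp_eq_toLp_iff _ _).1 (sub_eq_zero.1 (norm_eq_zero.1 h0))

/-- Approximants converging in H¹ have Cauchy boundary values, and L² of the boundary is complete.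
This is what gives the initial function a trace, as it need not be C¹ up to the boundary. -/
lemma exists_isTrace (hv : MemH1 Ω v) (hvd : ContDiffOn ℝ 1 v Ω) : ∃ g, IsTrace Ω v g := by
  have hgrad := hv.weakGrad_ae_eq hΩ hvd
  have hg2 : MemLp (∇ v) 2 (volume.restrict Ω) := (memLp_congr_ae hgrad).1 hv.weakGrad_spec.1
  obtain ⟨φ, hφ, h1, h2⟩ := hΩ.isH1Limit hvd hv.1 hg2
  obtain ⟨C, hC0, hC⟩ := hΩ.exists_norm_trace_sub_sq_le
  have l1 := (tendsto_toLp_of_tendsto_eLpNorm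
    (fun j => hΩ.memLp_of_continuousOn (hφ j).continuousOn 2) hv.1 h1).cauchySeq
  have l2 := (tendsto_toLp_of_tendsto_eLpNorm
    (fun j => hΩ.memLp_gradient (hφ j) 2) hg2 h2).cauchySeq
  have l3 : CauchySeq fun j => (hΩ.memLp_trace (hφ j)).toLp (φ j) := by
    rw [cauchySeq_iff_tendsto_dist_atTop_0] at l1 l2 ⊢
    have hlim := (((l1.pow 2).add (l2.pow 2)).const_mul C).sqrt
    refine tendsto_of_tendsto_of_tendsto_of_le_of_le tendsto_const_nhds
      (by simpa using hlim) (fun _ => dist_nonneg) fun p => ?_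
    refine Real.le_sqrt_of_sq_le ?_
    simp only [dist_eq_norm]
    exact hC _ _ (hφ p.1) (hφ p.2)
  obtain ⟨γ, hγ⟩ := cauchySeq_tendsto_of_complete l3
  refine ⟨γ, Lp.memLp γ, φ, hφ, h1, h2.congr fun j => eLpNorm_congr_ae ?_, ?_⟩
  · filter_upwards [hgrad] with x hx
    rw [hx]
  · have h3 := (Lp.tendsto_Lp_iff_tendsto_eLpNorm' _ _).1 hγ
    refine h3.congr fun j => eLpNorm_congr_ae ?_
    filter_upwards [(hΩ.memLp_trace (hφ j)).coeFn_toLp] with x hx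
    rw [Pi.sub_apply, hx]

lemma hasGradTrace (hv : MemH1 Ω v) (hvd : ContDiffOn ℝ 1 v Ω) :
    HasGradTrace Ω v (weakGrad Ω v) (trace Ω v) :=
  hv.hasGradTrace (isTrace_trace (hΩ.exists_isTrace hv hvd))

/-- The constant sequence `v` exhibits the pointwise boundary values as a trace, and traces are
unique. -/
lemma trace_ae_eq (hv : IsC1Closure Ω v) : trace Ω v =ᵐ[surfaceMeasure Ω] v := by
  have hm := hΩ.memH1 hv
  refine hΩ.trace_unique (hΩ.hasGradTrace hm hv.contDiffOn) (hm.hasGradTrace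
    ⟨hΩ.memLp_trace hv, fun _ => v, fun _ => hv, by simp, ?_, by simp⟩)
  refine tendsto_const_nhds.congr fun _ => ?_
  refine ((eLpNorm_eq_zero_iff (f := fun x => ∇ v x - weakGrad Ω v x)
    ((hΩ.memLp_gradient hv 2).aestronglyMeasurable.sub
      hm.weakGrad_spec.1.aestronglyMeasurable) two_ne_zero).2 ?_).symm
  filter_upwards [hm.weakGrad_ae_eq hΩ hv.contDiffOn] with x hx
  simp [hx]

lemma exists_poincare_hasGradTrace (hn : 1 ≤ n) : ∃ C, 0 ≤ C ∧ ∀ v G g, HasGradTrace Ω v G g →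
    ∫ x in Ω, v x ^ 2 ≤ C * ((∫ x in Ω, ‖G x‖ ^ 2) + ∫ x, g x ^ 2 ∂surfaceMeasure Ω) := by
  obtain ⟨C, hC0, hC⟩ := hΩ.exists_poincare hn
  refine ⟨C, hC0, fun v G g h => ?_⟩
  obtain ⟨φ, hφ, h1, h2, h3⟩ := h.exists_seq
  have l1 := tendsto_integral_inner
    (fun j => hΩ.memLp_of_continuousOn (hφ j).continuousOn 2)
    (fun j => hΩ.memLp_of_continuousOn (hφ j).continuousOn 2) h.memLp h.memLp h1 h1
  have l2 := tendsto_integral_inner (fun j => hΩ.memLp_gradient (hφ j) 2)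
    (fun j => hΩ.memLp_gradient (hφ j) 2) h.memLp_grad h.memLp_grad h2 h2
  have l3 := tendsto_integral_inner (fun j => hΩ.memLp_trace (hφ j))
    (fun j => hΩ.memLp_trace (hφ j)) h.memLp_trace h.memLp_trace h3 h3
  simp only [real_inner_self_eq_norm_sq, Real.norm_eq_abs, sq_abs] at l1 l2 l3
  exact le_of_tendsto_of_tendsto' l1 ((l2.add l3).const_mul C) fun j => hC _ (hφ j)

end IsSmoothBoundedDomain

end Trace

/-! ### Weak formulation of the Robin problem. -/

section WeakForm

variable {Ω : Set (EuclideanSpace ℝ (Fin n))} {h f u : EuclideanSpace ℝ (Fin n) → ℝ}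

lemma IsC1OnBoundary.continuousOn (hC1 : IsC1OnBoundary Ω h) : ContinuousOn h (frontier Ω) := by
  obtain ⟨H, hH, heq⟩ := hC1
  exact hH.continuous.continuousOn.congr heq

/-- Second derivatives of `u` are not controlled at the boundary. Integrability of the divergence
comes from the equation: it equals `-f`, and L² functions are integrable on a bounded domain. -/
lemma IsClassicalRobinSolution.isAdmissibleField (hΩ : IsSmoothBoundedDomain Ω)
    (hu : IsClassicalRobinSolution Ω h f u) (hf : MemLp f 2 (volume.restrict Ω)) :
    IsAdmissibleField Ω (gradBar Ω u) ∧ ∀ x ∈ Ω, divergence (gradBar Ω u) x = -f x := by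
  have hd2 : ∀ x ∈ Ω, ContDiffAt ℝ 2 u x := fun x hx =>
    hu.contDiffOn.contDiffAt (hΩ.isOpen.mem_nhds hx)
  have hdiv : ∀ x ∈ Ω, divergence (gradBar Ω u) x = -f x := fun x hx => by
    rw [divergence_congr ((hu.isC1Closure.gradBar_eqOn hΩ.isOpen).eventuallyEq_of_mem
      (hΩ.isOpen.mem_nhds hx)), divergence_gradient (hd2 x hx), ← hu.equation x hx, neg_neg]
  refine ⟨⟨?_, hu.isC1Closure.continuousOn_grad, ?_⟩, hdiv⟩
  · refine ContDiffOn.congr (f := ∇ u) (fun x hx => ?_) (hu.isC1Closure.gradBar_eqOn hΩ.isOpen)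
    exact ((InnerProductSpace.toDual ℝ (EuclideanSpace ℝ (Fin n))).symm.contDiff.contDiffAt.comp x
      ((hd2 x hx).fderiv_right (m := 1) (by norm_num))).contDiffWithinAt
  · have := hΩ.isFiniteMeasure_volume_restrict
    have hfi : IntegrableOn f Ω := hf.integrable (by norm_num)
    exact hfi.neg.congr_fun (fun x hx => (hdiv x hx).symm) hΩ.isOpen.measurableSet

/-- The weak formulation, tested against functions in `C^1(closure Ω)`. -/
lemma IsClassicalRobinSolution.weak_form_of_isC1Closure (hΩ : IsSmoothBoundedDomain Ω)
    (hpos : ∀ x ∈ frontier Ω, 0 < h x) (hu : IsClassicalRobinSolution Ω h f u)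
    (hf : MemLp f 2 (volume.restrict Ω)) {φ : EuclideanSpace ℝ (Fin n) → ℝ}
    (hφ : IsC1Closure Ω φ) :
    (∫ x in Ω, ⟪∇ u x, ∇ φ x⟫) + ∫ x, ⟪u x / h x, φ x⟫ ∂surfaceMeasure Ω =
      ∫ x in Ω, ⟪f x, φ x⟫ := by
  obtain ⟨hadm, hdiv⟩ := hu.isAdmissibleField hΩ hf
  have h1 := hΩ.integral_smul_divergence hφ hadm
  have h2 : ∫ x in Ω, (φ x * divergence (gradBar Ω u) x + ⟪∇ φ x, gradBar Ω u x⟫) =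
      ∫ x in Ω, (⟪∇ u x, ∇ φ x⟫ - ⟪f x, φ x⟫) := by
    refine setIntegral_congr_fun hΩ.isOpen.measurableSet fun x hx => ?_
    simp only [hdiv x hx, hu.isC1Closure.gradBar_eqOn hΩ.isOpen hx, real_inner_comm (∇ φ x)]
    simp
    ring
  have h3 : ∫ x, φ x * ⟪gradBar Ω u x, outwardNormal Ω x⟫ ∂surfaceMeasure Ω =
      ∫ x, -⟪u x / h x, φ x⟫ ∂surfaceMeasure Ω := by
    refine setIntegral_congr_fun isClosed_frontier.measurableSet fun x hx => ?_
    have hb := hu.boundary x hx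
    have hh := (hpos x hx).ne'
    -- The Robin condition solved for the normal derivative, using `h > 0`.
    have h4 : ⟪gradBar Ω u x, outwardNormal Ω x⟫ = -(u x / h x) := by
      rw [← normalDeriv]
      field_simp
      linarith
    simp only [h4]
    simp
  rw [h2, h3, integral_neg, integral_sub (integrable_inner_of_memLp
    (hΩ.memLp_gradient hu.isC1Closure 2) (hΩ.memLp_gradient hφ 2)) (integrable_inner_of_memLp hf
      (hΩ.memLp_of_continuousOn hφ.continuousOn 2))] at h1
  linarith

/-- The weak formulation. -/
lemma IsClassicalRobinSolution.weak_form (hΩ : IsSmoothBoundedDomain Ω)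
    (hC1 : IsC1OnBoundary Ω h) (hpos : ∀ x ∈ frontier Ω, 0 < h x)
    (hu : IsClassicalRobinSolution Ω h f u) (hf : MemLp f 2 (volume.restrict Ω))
    {w g : EuclideanSpace ℝ (Fin n) → ℝ}
    {G : EuclideanSpace ℝ (Fin n) → EuclideanSpace ℝ (Fin n)} (hw : HasGradTrace Ω w G g) :
    (∫ x in Ω, ⟪∇ u x, G x⟫) + ∫ x, ⟪u x / h x, g x⟫ ∂surfaceMeasure Ω =
      ∫ x in Ω, ⟪f x, w x⟫ := by
  obtain ⟨φ, hφ, h1, h2, h3⟩ := hw.exists_seq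
  have huh : MemLp (fun x => u x / h x) 2 (surfaceMeasure Ω) :=
    hΩ.memLp_surfaceMeasure ((hu.isC1Closure.continuousOn.mono frontier_subset_closure).div
      hC1.continuousOn fun x hx => (hpos x hx).ne') 2
  have l1 := tendsto_integral_inner_const hf
    (fun j => hΩ.memLp_of_continuousOn (hφ j).continuousOn 2) hw.memLp h1
  have l2 := tendsto_integral_inner_const (hΩ.memLp_gradient hu.isC1Closure 2)
    (fun j => hΩ.memLp_gradient (hφ j) 2) hw.memLp_grad h2
  have l3 := tendsto_integral_inner_const huh
    (fun j => hΩ.memLp_trace (hφ j)) hw.memLp_trace h3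
  refine tendsto_nhds_unique ((l2.add l3).congr fun j => ?_) l1
  exact hu.weak_form_of_isC1Closure hΩ hpos hf (hφ j)

end WeakForm

/-! ### The energy form: positivity, coercivity and its value on solutions. -/

section Energy

variable {Ω : Set (EuclideanSpace ℝ (Fin n))} {h v w : EuclideanSpace ℝ (Fin n) → ℝ}

lemma IsSmoothBoundedDomain.memLp_div (hΩ : IsSmoothBoundedDomain Ω) (hC1 : IsC1OnBoundary Ω h)
    (hpos : ∀ x ∈ frontier Ω, 0 < h x) {g : EuclideanSpace ℝ (Fin n) → ℝ}
    (hg : MemLp g 2 (surfaceMeasure Ω)) : MemLp (fun x => g x / h x) 2 (surfaceMeasure Ω) := by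
  have hinv : ContinuousOn (fun x => (h x)⁻¹) (frontier Ω) :=
    hC1.continuousOn.inv₀ fun x hx => (hpos x hx).ne'
  obtain ⟨M, hM⟩ := hΩ.isCompact_frontier.exists_bound_of_continuousOn hinv
  refine hg.of_le_mul (c := M) (hg.aestronglyMeasurable.mul
    (hΩ.integrable_surfaceMeasure hinv).aestronglyMeasurable) ?_
  filter_upwards [ae_restrict_mem isClosed_frontier.measurableSet] with x hx
  rw [div_eq_mul_inv, norm_mul, mul_comm]
  exact mul_le_mul_of_nonneg_right (hM x hx) (norm_nonneg _)

lemma IsSmoothBoundedDomain.integrable_mul_div (hΩ : IsSmoothBoundedDomain Ω)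
    (hC1 : IsC1OnBoundary Ω h) (hpos : ∀ x ∈ frontier Ω, 0 < h x)
    {g g' : EuclideanSpace ℝ (Fin n) → ℝ} (hg : MemLp g 2 (surfaceMeasure Ω))
    (hg' : MemLp g' 2 (surfaceMeasure Ω)) :
    Integrable (fun x => g x * g' x / h x) (surfaceMeasure Ω) := by
  refine (integrable_inner_of_memLp hg (hΩ.memLp_div hC1 hpos hg')).congr (ae_of_all _ fun x => ?_)
  simp
  ring

lemma rayleigh_eq (Ω : Set (EuclideanSpace ℝ (Fin n))) (h v : EuclideanSpace ℝ (Fin n) → ℝ) :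
    rayleigh Ω h v = formB Ω h v v / ∫ x in Ω, v x ^ 2 := by
  simp only [rayleigh, formB, real_inner_self_eq_norm_sq, sq (trace Ω v _)]

lemma integral_mul_self_div_nonneg (hpos : ∀ x ∈ frontier Ω, 0 < h x)
    (g : EuclideanSpace ℝ (Fin n) → ℝ) : 0 ≤ ∫ x, g x * g x / h x ∂surfaceMeasure Ω :=
  setIntegral_nonneg isClosed_frontier.measurableSet fun x hx =>
    div_nonneg (mul_self_nonneg _) (hpos x hx).le

lemma integral_norm_weakGrad_sq_le (hpos : ∀ x ∈ frontier Ω, 0 < h x) :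
    ∫ x in Ω, ‖weakGrad Ω v x‖ ^ 2 ≤ formB Ω h v v := by
  simp only [formB, real_inner_self_eq_norm_sq]
  linarith [integral_mul_self_div_nonneg hpos (trace Ω v)]

/-- Squares of differences of gradients and of traces are expanded separately. This avoids linearity
of the choices `weakGrad` and `trace`, which holds only almost everywhere. -/
lemma two_mul_formB_le (hΩ : IsSmoothBoundedDomain Ω) (hC1 : IsC1OnBoundary Ω h)
    (hpos : ∀ x ∈ frontier Ω, 0 < h x)
    (hv : HasGradTrace Ω v (weakGrad Ω v) (trace Ω v))
    (hw : HasGradTrace Ω w (weakGrad Ω w) (trace Ω w)) :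
    2 * formB Ω h v w ≤ formB Ω h v v + formB Ω h w w := by
  have h1 : 2 * ∫ x in Ω, ⟪weakGrad Ω v x, weakGrad Ω w x⟫ ≤
      (∫ x in Ω, ⟪weakGrad Ω v x, weakGrad Ω v x⟫) +
        ∫ x in Ω, ⟪weakGrad Ω w x, weakGrad Ω w x⟫ := by
    rw [← inner_toLp hv.memLp_grad hw.memLp_grad, ← inner_toLp hv.memLp_grad hv.memLp_grad,
      ← inner_toLp hw.memLp_grad hw.memLp_grad, real_inner_self_eq_norm_sq,
      real_inner_self_eq_norm_sq]
    have := norm_sub_sq_real (hv.memLp_grad.toLp (weakGrad Ω v)) (hw.memLp_grad.toLp (weakGrad Ω w))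
    linarith [sq_nonneg ‖hv.memLp_grad.toLp (weakGrad Ω v) - hw.memLp_grad.toLp (weakGrad Ω w)‖]
  have h2 : 2 * ∫ x, trace Ω v x * trace Ω w x / h x ∂surfaceMeasure Ω ≤
      (∫ x, trace Ω v x * trace Ω v x / h x ∂surfaceMeasure Ω) +
        ∫ x, trace Ω w x * trace Ω w x / h x ∂surfaceMeasure Ω := by
    have i1 := hΩ.integrable_mul_div hC1 hpos hv.memLp_trace hw.memLp_trace
    have i2 := hΩ.integrable_mul_div hC1 hpos hv.memLp_trace hv.memLp_trace
    have i3 := hΩ.integrable_mul_div hC1 hpos hw.memLp_trace hw.memLp_trace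
    rw [← integral_const_mul, ← integral_add i2 i3]
    refine setIntegral_mono_on (i1.const_mul 2) (i2.add i3) isClosed_frontier.measurableSet
      fun x hx => ?_
    have h3 := div_nonneg (mul_self_nonneg (trace Ω v x - trace Ω w x)) (hpos x hx).le
    have h4 : (trace Ω v x - trace Ω w x) * (trace Ω v x - trace Ω w x) / h x =
        trace Ω v x * trace Ω v x / h x + trace Ω w x * trace Ω w x / h x -
          2 * (trace Ω v x * trace Ω w x / h x) := by ring
    change _ ≤ trace Ω v x * trace Ω v x / h x + trace Ω w x * trace Ω w x / h x
    linarith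
  simp only [formB]
  linarith

lemma exists_coercivity (hn : 1 ≤ n) (hΩ : IsSmoothBoundedDomain Ω) (hC1 : IsC1OnBoundary Ω h)
    (hpos : ∀ x ∈ frontier Ω, 0 < h x) : ∃ C, 0 < C ∧ ∀ v,
      HasGradTrace Ω v (weakGrad Ω v) (trace Ω v) →
        ∫ x in Ω, v x ^ 2 ≤ C * formB Ω h v v := by
  obtain ⟨C, hC0, hC⟩ := hΩ.exists_poincare_hasGradTrace hn
  obtain ⟨M, hM⟩ := hΩ.isCompact_frontier.exists_bound_of_continuousOn hC1.continuousOn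
  -- `h ≤ N` turns the boundary integral of the squared trace into `N` times the one weighted by `1
  -- / h`; `N ≥ 1` lets the same factor cover the gradient term. The `C + 1` below makes the final
  -- constant strictly positive.
  set N := max M 1
  have hN : 0 < N := lt_max_of_lt_right one_pos
  refine ⟨(C + 1) * N, by positivity, fun v hv => (hC _ _ _ hv).trans ?_⟩
  have h1 : ∫ x, trace Ω v x ^ 2 ∂surfaceMeasure Ω ≤
      N * ∫ x, trace Ω v x * trace Ω v x / h x ∂surfaceMeasure Ω := by
    rw [← integral_const_mul]
    refine setIntegral_mono_on (hv.memLp_trace.integrable_sq)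
      ((hΩ.integrable_mul_div hC1 hpos hv.memLp_trace hv.memLp_trace).const_mul N)
      isClosed_frontier.measurableSet fun x hx => ?_
    have hx0 := hpos x hx
    have hxN : h x ≤ N := (le_abs_self _).trans ((hM x hx).trans (le_max_left _ _))
    rw [mul_div_assoc', le_div_iff₀ hx0, ← sq, mul_comm]
    exact mul_le_mul_of_nonneg_right hxN (sq_nonneg _)
  have h2 : 0 ≤ ∫ x in Ω, ‖weakGrad Ω v x‖ ^ 2 := integral_nonneg fun x => sq_nonneg _
  have h3 := integral_mul_self_div_nonneg hpos (trace Ω v)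
  have h4 : (1 : ℝ) ≤ N := le_max_right _ _
  have h5 : (∫ x in Ω, ‖weakGrad Ω v x‖ ^ 2) + ∫ x, trace Ω v x ^ 2 ∂surfaceMeasure Ω ≤
      N * formB Ω h v v := by
    simp only [formB, real_inner_self_eq_norm_sq]
    nlinarith
  calc C * ((∫ x in Ω, ‖weakGrad Ω v x‖ ^ 2) + ∫ x, trace Ω v x ^ 2 ∂surfaceMeasure Ω)
      ≤ C * (N * formB Ω h v v) := mul_le_mul_of_nonneg_left h5 hC0
    _ ≤ (C + 1) * N * formB Ω h v v := by
      have : 0 ≤ formB Ω h v v := h2.trans (integral_norm_weakGrad_sq_le hpos)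
      nlinarith [mul_nonneg hN.le this]

/-- The weak formulation, with the classical gradient and boundary values of `u` replaced by the
almost everywhere equal `weakGrad` and `trace`. -/
lemma IsClassicalRobinSolution.formB_eq {f u : EuclideanSpace ℝ (Fin n) → ℝ}
    (hΩ : IsSmoothBoundedDomain Ω) (hC1 : IsC1OnBoundary Ω h) (hpos : ∀ x ∈ frontier Ω, 0 < h x)
    (hu : IsClassicalRobinSolution Ω h f u) (hf : MemLp f 2 (volume.restrict Ω))
    (hw : HasGradTrace Ω w (weakGrad Ω w) (trace Ω w)) :
    formB Ω h u w = ∫ x in Ω, f x * w x := by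
  have h1 := hu.weak_form hΩ hC1 hpos hf hw
  have h2 : ∫ x in Ω, ⟪weakGrad Ω u x, weakGrad Ω w x⟫ = ∫ x in Ω, ⟪∇ u x, weakGrad Ω w x⟫ := by
    refine integral_congr_ae ?_
    filter_upwards [(hΩ.memH1 hu.isC1Closure).weakGrad_ae_eq hΩ hu.isC1Closure.contDiffOn]
      with x hx
    rw [hx]
  have h3 : ∫ x, trace Ω u x * trace Ω w x / h x ∂surfaceMeasure Ω =
      ∫ x, ⟪u x / h x, trace Ω w x⟫ ∂surfaceMeasure Ω := by
    refine integral_congr_ae ?_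
    filter_upwards [hΩ.trace_ae_eq hu.isC1Closure] with x hx
    rw [hx]
    simp
    ring
  rw [formB, h2, h3, h1]
  congr 1
  ext x
  simp [mul_comm]

lemma integral_mul_sq_le {α : Type*} [MeasurableSpace α] {μ : Measure α} {f g : α → ℝ}
    (hf : MemLp f 2 μ) (hg : MemLp g 2 μ) :
    (∫ x, f x * g x ∂μ) ^ 2 ≤ (∫ x, f x ^ 2 ∂μ) * ∫ x, g x ^ 2 ∂μ := by
  have h := real_inner_mul_inner_self_le (hf.toLp f) (hg.toLp g)
  rw [inner_toLp, inner_toLp, inner_toLp] at h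
  simpa [sq, mul_comm] using h

end Energy

/-! ### Arithmetic of the iteration. -/

section Sequences

/-- The arithmetic behind the iteration: `A k = ‖u k‖²`, `b k = ‖u k‖_B²`, `c k = ⟨u k, u (k+1)⟩`. -/
lemma iteration_estimates {A b c : ℕ → ℝ} {C : ℝ} (hA0 : 0 < A 0)
    (hC : 0 < C) (hAb : ∀ k, A k ≤ C * b k) (hbc : ∀ k, b (k + 1) = b k / A k * c k)
    (hmono : ∀ k, 0 < A k → b k ≤ b (k + 1)) (hc : ∀ k, c k ^ 2 ≤ A k * A (k + 1)) (k : ℕ) :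
    0 < A k ∧ 0 < b k ∧ b (k + 1) / A (k + 1) * √(A (k + 1)) ≤ b k / A k * √(A k) ∧
      √(A k) ≤ √(A (k + 1)) ∧ b (k + 1) / A (k + 1) ≤ b k / A k := by
  have hbpos : ∀ k, 0 < A k → 0 < b k := fun k hk =>
    pos_of_mul_pos_right (hk.trans_le (hAb k)) hC.le
  have hApos : ∀ k, 0 < A k := by
    intro k
    induction k with
    | zero => exact hA0
    | succ k ih =>
      -- The energy stays positive, so `c k` cannot vanish, and Cauchy–Schwarz then forces `A (k +
      -- 1) > 0`: no iterate degenerates to zero.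
      have h1 : 0 < b k / A k * c k := by
        rw [← hbc]; exact (hbpos k ih).trans_le (hmono k ih)
      have h2 : c k ≠ 0 := by rintro h; simp [h] at h1
      exact pos_of_mul_pos_right ((sq_pos_of_ne_zero h2).trans_le (hc k)) ih.le
  have hk := hApos k
  have hk1 := hApos (k + 1)
  have hR : 0 < b k / A k := div_pos (hbpos k hk) hk
  have hs := Real.sqrt_pos.2 hk
  have hs1 := Real.sqrt_pos.2 hk1
  have hcle : c k ≤ √(A k) * √(A (k + 1)) := by
    rw [← Real.sqrt_mul hk.le]
    exact Real.le_sqrt_of_sq_le (hc k)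
  have hb1 : b (k + 1) ≤ b k / A k * (√(A k) * √(A (k + 1))) := by
    rw [hbc]; exact mul_le_mul_of_nonneg_left hcle hR.le
  have hq : b (k + 1) / A (k + 1) * √(A (k + 1)) ≤ b k / A k * √(A k) := by
    have h1 : b (k + 1) / A (k + 1) * √(A (k + 1)) = b (k + 1) / √(A (k + 1)) := by
      rw [div_mul_eq_mul_div, div_eq_div_iff hk1.ne' hs1.ne', mul_assoc, Real.mul_self_sqrt hk1.le]
    rw [h1, div_le_iff₀ hs1]
    linarith
  have hn : √(A k) ≤ √(A (k + 1)) := by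
    -- With `R = b k / A k`, this is `R * A k = b k ≤ b (k + 1) ≤ R √(A k) √(A (k + 1))`; cancelling
    -- `R √(A k)` gives growth of the norm.
    have h1 : b k / A k * (√(A k) * √(A k)) ≤ b k / A k * (√(A k) * √(A (k + 1))) := by
      rw [Real.mul_self_sqrt hk.le, div_mul_cancel₀ _ hk.ne']
      exact (hmono k hk).trans hb1
    exact le_of_mul_le_mul_left (le_of_mul_le_mul_left h1 hR) hs
  refine ⟨hk, hbpos k hk, hq, hn, ?_⟩
  -- The product of quotient and norm decreases while the norm increases, so the quotient decreases.
  exact le_of_mul_le_mul_right (hq.trans (mul_le_mul_of_nonneg_left hn hR.le)) hs1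

/-- The quantity `q = (b / A) √A` is nonincreasing, and `A ≤ C b` bounds `b / A` below by `1 / C`.
So `√A ≤ C q ≤ C q 0`, and then `D ≤ b = q √A` is bounded as well. -/
lemma iteration_bounded {A b D : ℕ → ℝ} {C : ℝ} (hC : 0 < C) (hAb : ∀ k, A k ≤ C * b k)
    (hD : ∀ k, D k ≤ b k)
    (h : ∀ k, 0 < A k ∧ 0 < b k ∧ b (k + 1) / A (k + 1) * √(A (k + 1)) ≤ b k / A k * √(A k)) :
    ∃ S, ∀ k, √(A k + D k) ≤ S := by
  set q : ℕ → ℝ := fun k => b k / A k * √(A k) with hq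
  have hanti : ∀ k, q k ≤ q 0 := fun k => antitone_nat_of_succ_le (fun k => (h k).2.2) k.zero_le
  have hs : ∀ k, √(A k) ≤ C * q 0 := fun k => by
    refine le_trans ?_ (mul_le_mul_of_nonneg_left (hanti k) hC.le)
    have h1 : 1 ≤ C * (b k / A k) := by
      rw [← mul_div_assoc, one_le_div (h k).1]; exact hAb k
    have h2 := mul_le_mul_of_nonneg_right h1 (Real.sqrt_nonneg (A k))
    rw [one_mul, mul_assoc] at h2
    exact h2
  have hq0 : 0 ≤ q 0 := mul_nonneg (div_nonneg (h 0).2.1.le (h 0).1.le) (Real.sqrt_nonneg _)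
  refine ⟨√((C * q 0) ^ 2 + q 0 * (C * q 0)), fun k => Real.sqrt_le_sqrt (add_le_add ?_ ?_)⟩
  · rw [← Real.sq_sqrt (h k).1.le]
    exact pow_le_pow_left₀ (Real.sqrt_nonneg _) (hs k) 2
  · refine (hD k).trans ?_
    have h1 : b k = q k * √(A k) := by
      simp only [hq]
      rw [mul_assoc, Real.mul_self_sqrt (h k).1.le, div_mul_cancel₀ _ (h k).1.ne']
    rw [h1]
    exact mul_le_mul (hanti k) (hs k) (Real.sqrt_nonneg _) hq0

end Sequences

end RobinIteration

end

/-! ### Assembly of the estimates. -/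

theorem mainTheorem5 (n : ℕ) (hn : 2 ≤ n) (Ω : Set (EuclideanSpace ℝ (Fin n)))
    (hΩ : RobinIteration.IsSmoothBoundedDomain Ω)
    (h : EuclideanSpace ℝ (Fin n) → ℝ) (hC1 : RobinIteration.IsC1OnBoundary Ω h)
    (hpos : ∀ x ∈ frontier Ω, 0 < h x)
    (u : ℕ → EuclideanSpace ℝ (Fin n) → ℝ)
    (hu0_C1 : ContDiffOn ℝ 1 (u 0) Ω)
    (hu0_bdd : MemLp (u 0) ∞ (volume.restrict Ω))
    (hu0_H1 : RobinIteration.MemH1 Ω (u 0))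
    (hu0_pos : ∀ x ∈ closure Ω, 0 < u 0 x)
    (hiter : ∀ k, RobinIteration.IsClassicalRobinSolution Ω h
      (fun x => RobinIteration.rayleigh Ω h (u k) * u k x) (u (k + 1))) :
    (∀ k, RobinIteration.rayleigh Ω h (u (k + 1)) * RobinIteration.normL2 Ω (u (k + 1)) ≤
        RobinIteration.rayleigh Ω h (u k) * RobinIteration.normL2 Ω (u k)) ∧
    (∀ k, RobinIteration.normB Ω h (u k) ≤ RobinIteration.normB Ω h (u (k + 1))) ∧
    (∀ k, RobinIteration.normL2 Ω (u k) ≤ RobinIteration.normL2 Ω (u (k + 1))) ∧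
    (∀ k, RobinIteration.rayleigh Ω h (u (k + 1)) ≤ RobinIteration.rayleigh Ω h (u k)) ∧
    (∀ k, RobinIteration.MemH1 Ω (u k)) ∧
    (∃ C : ℝ, ∀ k, RobinIteration.normH1 Ω (u k) ≤ C) := by
  open RobinIteration in
  have hH1 : ∀ k, MemH1 Ω (u k) := fun k => by
    cases k with
    | zero => exact hu0_H1
    | succ k => exact hΩ.memH1 (hiter k).isC1Closure
  have hd : ∀ k, ContDiffOn ℝ 1 (u k) Ω := fun k => by
    cases k with
    | zero => exact hu0_C1
    | succ k => exact (hiter k).isC1Closure.contDiffOn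
  have htr : ∀ k, HasGradTrace Ω (u k) (weakGrad Ω (u k)) (trace Ω (u k)) := fun k =>
    hΩ.hasGradTrace (hH1 k) (hd k)
  obtain ⟨C, hC, hAb⟩ := exists_coercivity (by omega) hΩ hC1 hpos
  set A : ℕ → ℝ := fun k => ∫ x in Ω, u k x ^ 2 with hA
  set b : ℕ → ℝ := fun k => formB Ω h (u k) (u k) with hb
  set c : ℕ → ℝ := fun k => ∫ x in Ω, u k x * u (k + 1) x with hc
  -- The weak form with right-hand side `R(u k) u k`. It is tested below with `w = u k` for energy
  -- growth and with `w = u (k + 1)` for the recursion of `b`.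
  have hform : ∀ k w, HasGradTrace Ω w (weakGrad Ω w) (trace Ω w) →
      formB Ω h (u (k + 1)) w = b k / A k * ∫ x in Ω, u k x * w x := fun k w hw => by
    rw [(hiter k).formB_eq hΩ hC1 hpos ((hH1 k).1.const_mul _) hw, ← integral_const_mul,
      rayleigh_eq]
    simp only [mul_assoc, hA, hb]
  have hA0 : 0 < A 0 := by
    refine (setIntegral_pos_iff_support_of_nonneg_ae (ae_of_all _ fun x => sq_nonneg _)
      (hH1 0).1.integrable_sq).2 ?_
    have : Function.support (fun x => u 0 x ^ 2) ∩ Ω = Ω := by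
      refine inter_eq_right.2 fun x hx => ?_
      exact pow_ne_zero 2 (hu0_pos x (subset_closure hx)).ne'
    rw [this]
    exact hΩ.isOpen.measure_pos _ hΩ.isConnected.nonempty
  have hmono : ∀ k, 0 < A k → b k ≤ b (k + 1) := fun k hk => by
    have h1 := two_mul_formB_le hΩ hC1 hpos (htr (k + 1)) (htr k)
    -- The factor `R(u k)` in the equation is exactly what makes this pairing equal `(b k / A k) * A
    -- k = b k`.
    have h2 : formB Ω h (u (k + 1)) (u k) = b k := by
      rw [hform k _ (htr k)]
      simp only [← sq]
      exact div_mul_cancel₀ _ hk.ne'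
    rw [h2] at h1
    simp only [hb] at h1 ⊢
    linarith
  have hest := iteration_estimates (A := A) (b := b) (c := c)
    hA0 hC (fun k => hAb _ (htr k))
    (fun k => hform k _ (htr (k + 1))) hmono
    (fun k => integral_mul_sq_le (hH1 k).1 (hH1 (k + 1)).1)
  simp only [rayleigh_eq, normL2, normB, normH1]
  refine ⟨fun k => (hest k).2.2.1, fun k => Real.sqrt_le_sqrt (hmono k (hest k).1),
    fun k => (hest k).2.2.2.1, fun k => (hest k).2.2.2.2, hH1, ?_⟩
  exact iteration_bounded (A := A) (b := b) hC (fun k => hAb _ (htr k))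
    (fun k => integral_norm_weakGrad_sq_le hpos)
    fun k => ⟨(hest k).1, (hest k).2.1, (hest k).2.2.1⟩
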